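/- Let $K$ be a (tame) knot in three-space. For a knot diagram $D$ let $c(D)$ be its number of crossings and $|D|$ its underlying four-valent graph; a \emph{region} of $D$ is a connected component of the complement of $|D|$. A \emph{region crossing change} at a region $R$ changes every crossing of $D$ that lies on the boundary $\partial R$ (each such crossing exactly once). The region unknotting number $u_R(D)$ is the minimal number of regions of $D$ such that successive region crossing changes at these regions, without Reidemeister moves, turn $D$ into a diagram of the trivial knot. Let $c(K)$ be the minimum of $c(D)$ over all diagrams $D$ of $K$, and let the region unknotting number $u_R(K)$ be the minimum of $u_R(D)$ over all diagrams $D$ of $K$ with $c(D)=c(K)$. Then $c(K)$ and $u_R(K)$ are well defined and finite, and $$u_R(K)\le \frac{c(K)}{2}+1 .$$ -/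

import Mathlib

/-!
Polygonal knots in three-space, their diagrams in the plane, and region crossing changes.
-/

namespace PLKnot

/-- The projection plane `ℝ²`. -/
abbrev Plane : Type := ℝ × ℝ

/-- Three-space `ℝ² × ℝ`; the second component is the height above the projection plane. -/
abbrev Space : Type := Plane × ℝ

section Polygon

variable {E : Type*} [AddCommGroup E] [Module ℝ E]

/-- The parameter circle of a closed polygon with `n` vertices: the pair `(i, t)` stands for the
point at time `t` of the half-open edge from vertex `i` to vertex `i + 1`. -/
abbrev Param (n : ℕ) : Type := ZMod n × Set.Ico (0 : ℝ) 1

/-- The point with parameter `x` on the closed polygon with vertices `p`. -/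
def point {n : ℕ} (p : ZMod n → E) (x : Param n) : E :=
  AffineMap.lineMap (p x.1) (p (x.1 + 1)) (x.2 : ℝ)

/-- The set of all points of the closed polygon with vertices `p`. -/
def trace {n : ℕ} (p : ZMod n → E) : Set E := Set.range (point p)

end Polygon

/-! ### Knots -/

/-- A (polygonal, that is, tame) knot: a simple closed polygon in three-space. -/
@[ext] structure Knot where
  carrier : Set Space
  isPolygon : ∃ (n : ℕ) (p : ZMod n → Space),
    0 < n ∧ Function.Injective (point p) ∧ carrier = trace p

namespace Knot

/-- `K'` arises from `K` by a triangle move: a segment `[a, b]` of `K` is replaced by the other two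
sides of a non-degenerate triangle `abc` which meets `K` in `[a, b]` only. -/
def TriangleMove (K K' : Knot) : Prop :=
  ∃ a b c : Space, AffineIndependent ℝ ![a, b, c] ∧
    convexHull ℝ {a, b, c} ∩ K.carrier = segment ℝ a b ∧
    K'.carrier = (K.carrier \ segment ℝ a b) ∪ (segment ℝ a c ∪ segment ℝ c b)

/-- Equivalence of knots: the equivalence relation generated by triangle moves. -/
def Equivalent : Knot → Knot → Prop := Relation.EqvGen TriangleMove

/-- The trivial knot type: knots equivalent to the boundary of a triangle. -/
def IsTrivial (K : Knot) : Prop :=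
  ∃ T : Knot, K.Equivalent T ∧ ∃ a b c : Space, AffineIndependent ℝ ![a, b, c] ∧
    T.carrier = segment ℝ a b ∪ segment ℝ b c ∪ segment ℝ c a

end Knot

/-! ### Diagrams -/

/-- A knot diagram: a closed polygon in the plane whose only multiple points are transverse double
points, none of them a vertex, together with the choice of an over-strand at each double point.
The choice is recorded by the set `upper` of those parameters which run along the over-strand of
a double point. -/
structure Diagram where
  n : ℕ
  n_pos : 0 < n
  vertex : ZMod n → Plane
  transverse : ∀ x y : Param n, x ≠ y → point vertex x = point vertex y →
    (x.2 : ℝ) ≠ 0 ∧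
    LinearIndependent ℝ ![vertex (x.1 + 1) - vertex x.1, vertex (y.1 + 1) - vertex y.1]
  no_triple : ∀ x y z : Param n, point vertex x = point vertex y →
    point vertex y = point vertex z → x = y ∨ y = z ∨ x = z
  upper : Set (Param n)
  upper_double : ∀ x ∈ upper, ∃ y, y ≠ x ∧ point vertex y = point vertex x
  upper_iff : ∀ x y : Param n, x ≠ y → point vertex x = point vertex y → (x ∈ upper ↔ y ∉ upper)

namespace Diagram

/-- The underlying four-valent graph `|D|` of the diagram, as a subset of the plane. -/
def graph (D : Diagram) : Set Plane := trace D.vertex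

/-- The crossing points of the diagram. -/
def crossings (D : Diagram) : Set Plane :=
  {v | ∃ x y : Param D.n, x ≠ y ∧ point D.vertex x = v ∧ point D.vertex y = v}

/-- The number `c(D)` of crossing points of the diagram. -/
noncomputable def crossingNumber (D : Diagram) : ℕ∞ := D.crossings.encard

/-- The knot `K` lies over the diagram `D`: there is a continuous height function `h` along the
parameter circle of `D` such that `K` consists of the points of `D` lifted to height `h`, and at
each crossing point the over-strand has the larger height. -/
def IsLift (D : Diagram) (K : Knot) : Prop :=
  ∃ h : ZMod D.n → ℝ → ℝ,
    (∀ i, ContinuousOn (h i) (Set.Icc 0 1)) ∧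
    (∀ i, h i 1 = h (i + 1) 0) ∧
    (∀ x y : Param D.n, x ≠ y → point D.vertex x = point D.vertex y → x ∈ D.upper →
      h y.1 y.2 < h x.1 x.2) ∧
    K.carrier = Set.range fun x : Param D.n => ((point D.vertex x, h x.1 x.2) : Space)

/-- `D` is a diagram of (the knot type of) `K`. -/
def IsDiagramOf (D : Diagram) (K : Knot) : Prop :=
  ∃ L : Knot, D.IsLift L ∧ L.Equivalent K

/-- `D` is a diagram of the trivial knot. -/
def IsDiagramOfTrivial (D : Diagram) : Prop :=
  ∃ K : Knot, K.IsTrivial ∧ D.IsDiagramOf K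

/-- The regions of the diagram: the connected components of the complement of `|D|`. -/
def regions (D : Diagram) : Set (Set Plane) :=
  {R | ∃ v ∈ D.graphᶜ, R = connectedComponentIn D.graphᶜ v}

/-- The diagram obtained from `D` by crossing changes at all crossing points in `S`. -/
def crossingChange (D : Diagram) (S : Set Plane) : Diagram where
  n := D.n
  n_pos := D.n_pos
  vertex := D.vertex
  transverse := D.transverse
  no_triple := D.no_triple
  upper := {x | (∃ y, y ≠ x ∧ point D.vertex y = point D.vertex x) ∧
    (x ∈ D.upper ↔ point D.vertex x ∉ S)}
  upper_double := fun _ hx => hx.1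
  upper_iff := by
    intro x y hxy h
    have hx : ∃ z, z ≠ x ∧ point D.vertex z = point D.vertex x := ⟨y, hxy.symm, h.symm⟩
    have hy : ∃ z, z ≠ y ∧ point D.vertex z = point D.vertex y := ⟨x, hxy, h⟩
    have ho := D.upper_iff x y hxy h
    simp only [Set.mem_ofPred_eq, hx, hy, true_and, h]
    tauto

/-- The region crossing change at `R`: crossing changes at all crossing points on `∂R`. -/
def regionCrossingChange (D : Diagram) (R : Set Plane) : Diagram :=
  D.crossingChange (D.crossings ∩ frontier R)

/-- The region unknotting number `u_R(D)`: the least number of regions of `D` such that successive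
region crossing changes at these regions turn `D` into a diagram of the trivial knot
(`⊤` if there were no such regions). -/
noncomputable def regionUnknottingNumber (D : Diagram) : ℕ∞ :=
  sInf {k | ∃ P : List (Set Plane), P.Nodup ∧ (∀ R ∈ P, R ∈ D.regions) ∧
    (P.foldl regionCrossingChange D).IsDiagramOfTrivial ∧ k = P.length}

end Diagram

namespace Knot

/-- The crossing number `c(K)`: the least crossing number of a diagram of `K`
(`⊤` if there were no diagram). -/
noncomputable def crossingNumber (K : Knot) : ℕ∞ :=
  sInf {k | ∃ D : Diagram, D.IsDiagramOf K ∧ k = D.crossingNumber}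

/-- The region unknotting number `u_R(K)`: the least `u_R(D)` over all diagrams `D` of `K` with
the minimal number of crossings. -/
noncomputable def regionUnknottingNumber (K : Knot) : ℕ∞ :=
  sInf {k | ∃ D : Diagram, D.IsDiagramOf K ∧ D.crossingNumber = K.crossingNumber ∧
    k = D.regionUnknottingNumber}

end Knot

end PLKnot

/-! Fix a diagram with `c` crossings. Over the field with two elements a set of regions is a vector
`x`, and the crossings it changes form a vector `effect x` depending linearly on `x`. Three facts
carry the theorem. There are at most `c + 2` regions (`regions_bound`). Every set of crossings is
the effect of a set of regions avoiding any prescribed region (`effectSpace_eq_top`,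
`exists_effect_eq`). Suitable crossing changes trivialise the diagram (`exists_isDiagramOfTrivial`).

Given these, fix a region `R`. The effect of the set of all regions is also achieved without `R`, so
the sum of the two sets has no effect and contains `R`. Adding it to the solutions of `effect x = y`
pairs those containing `R` with those avoiding it. Hence an average solution contains half of the
regions, and some solution has at most `(c + 2) / 2` of them (`exists_effect_eq_card_le`).

The first two facts rest on the mod 2 winding number of a closed polygon, defined by counting edges
met by a horizontal ray. It is locally constant off the polygon and jumps across each edge
(`pathParity_jump`). A function that is locally constant off the diagram has a corner sum at each
crossing, the sum of its four values there. If the corner sums vanish, the jump across the curve is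
carried unchanged along the curve and through the crossings, so absence of a jump at one place
forces the function to be constant (`eq_of_cornerSum_eq_zero`). Thus the corner sums and two values
beside a base point determine the function, which bounds the number of regions.

Conversely, the winding parity of the loop between the two passages of a crossing `v` has corner sum
one at `v` and zero elsewhere (`Frame.sum_loop`). Effect and corner sum agree except at nugatory
crossings, where one region occupies two opposite corners and the sum cancels it
(`Frame.effect_eq`). These corrections are removed by induction on the nesting of the loops of
nugatory crossings (`Frame.single_mem_of_nugatory`).

To trivialise a diagram, lift its vertices to rapidly growing heights. The resulting polygon is
built from a triangle by adding one vertex at a time, each addition being a triangle move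
(`IsSteep.exists_isTrivial`). Finally, a small perturbation of a knot is an equivalent knot with
generic projection (`Knot.eventually_equivalent`, `dense_isGeneric`), so diagrams exist and a
minimal one can be chosen. -/

namespace PLKnot

open Set Filter Topology

/-! ### Ray-crossing parity -/

open Classical in
/-- Whether the half-open edge `pq` meets the open horizontal ray from `x` to the right. -/
noncomputable def rayCross (p q x : Plane) : ZMod 2 :=
  if (p.2 ≤ x.2 ∧ x.2 < q.2 ∨ q.2 ≤ x.2 ∧ x.2 < p.2) ∧
    ∃ z ∈ segment ℝ p q, z.2 = x.2 ∧ x.1 < z.1 then 1 else 0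

theorem rayCross_comm (p q x : Plane) : rayCross p q x = rayCross q p x := by
  unfold rayCross
  rw [segment_symm]
  congr 1
  rw [or_comm]

theorem rayCross_eq_zero {p q x : Plane}
    (h : ¬ (p.2 ≤ x.2 ∧ x.2 < q.2 ∨ q.2 ≤ x.2 ∧ x.2 < p.2)) : rayCross p q x = 0 := by
  unfold rayCross
  rw [if_neg fun h' => h h'.1]

theorem mem_segment_plane {p q z : Plane} : z ∈ segment ℝ p q ↔
    ∃ t : ℝ, 0 ≤ t ∧ t ≤ 1 ∧ z.1 = p.1 + t * (q.1 - p.1) ∧ z.2 = p.2 + t * (q.2 - p.2) := by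
  rw [segment_eq_image']
  constructor
  · rintro ⟨t, ht, rfl⟩
    exact ⟨t, ht.1, ht.2, by simp, by simp⟩
  · rintro ⟨t, h0, h1, h2, h3⟩
    exact ⟨t, ⟨h0, h1⟩, Prod.ext (by simp [h2]) (by simp [h3])⟩

theorem exists_mem_segment_snd {p q : Plane} {b : ℝ} (h1 : p.2 ≤ b) (h2 : b ≤ q.2) :
    ∃ z ∈ segment ℝ p q, z.2 = b := by
  rcases eq_or_lt_of_le (h1.trans h2) with h | h
  · exact ⟨p, left_mem_segment ℝ p q, by linarith⟩
  · refine ⟨(p.1 + (b - p.2) / (q.2 - p.2) * (q.1 - p.1), b), mem_segment_plane.2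
      ⟨(b - p.2) / (q.2 - p.2), div_nonneg (by linarith) (by linarith),
        (div_le_one (by linarith)).2 (by linarith), rfl, ?_⟩, rfl⟩
    have : q.2 - p.2 ≠ 0 := by linarith
    field_simp
    ring

theorem exists_mem_segment_fst {p q : Plane} {a : ℝ} (h1 : p.1 ≤ a) (h2 : a < q.1) :
    ∃ z ∈ segment ℝ p q, z.1 = a ∧ (∀ b, b ≤ p.2 → b ≤ q.2 → b ≤ z.2) ∧
      (∀ b, p.2 ≤ b → q.2 ≤ b → z.2 ≤ b) := by
  have h : p.1 < q.1 := by linarith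
  set t := (a - p.1) / (q.1 - p.1) with ht
  have h0 : 0 ≤ t := div_nonneg (by linarith) (by linarith)
  have h1' : t ≤ 1 := (div_le_one (by linarith)).2 (by linarith)
  refine ⟨(a, p.2 + t * (q.2 - p.2)), mem_segment_plane.2 ⟨t, h0, h1', ?_, rfl⟩, rfl, ?_, ?_⟩
  · have : q.1 - p.1 ≠ 0 := by linarith
    rw [ht]
    field_simp
    ring
  · intro b hb hb'
    simp only
    nlinarith
  · intro b hb hb'
    simp only
    nlinarith

theorem segment_fst_eq_of_snd_eq {p q z z' : Plane} (hpq : p.2 ≠ q.2) (hz : z ∈ segment ℝ p q)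
    (hz' : z' ∈ segment ℝ p q) (h : z.2 = z'.2) : z = z' := by
  obtain ⟨t, -, -, h1, h2⟩ := mem_segment_plane.1 hz
  obtain ⟨t', -, -, h1', h2'⟩ := mem_segment_plane.1 hz'
  have : (t - t') * (q.2 - p.2) = 0 := by linarith
  rcases mul_eq_zero.1 this with h3 | h3
  · have : t = t' := by linarith
    subst this
    exact Prod.ext (by rw [h1, h1']) h
  · exact absurd (by linarith) hpq

open Classical in
theorem rayCross_of_mem {p q x z : Plane} (h : p.2 ≤ x.2 ∧ x.2 < q.2 ∨ q.2 ≤ x.2 ∧ x.2 < p.2)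
    (hz : z ∈ segment ℝ p q) (hz2 : z.2 = x.2) :
    rayCross p q x = if x.1 < z.1 then 1 else 0 := by
  have hne : p.2 ≠ q.2 := by
    rintro hh
    rcases h with h | h <;> linarith [h.1, h.2]
  unfold rayCross
  congr 1
  refine propext ⟨?_, fun h' => ⟨h, z, hz, hz2, h'⟩⟩
  rintro ⟨-, z', hz', h1, h2⟩
  rwa [segment_fst_eq_of_snd_eq hne hz hz' (by rw [hz2, h1])]

theorem mem_segment_horizontal {a a' b : ℝ} {z : Plane} (h : z.2 = b) (h1 : a ≤ z.1)
    (h2 : z.1 ≤ a') : z ∈ segment ℝ ((a, b) : Plane) (a', b) := by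
  rcases eq_or_lt_of_le (h1.trans h2) with h' | h'
  · have : z = (a, b) := Prod.ext (by simp; linarith) h
    rw [this]
    exact left_mem_segment _ _ _
  · refine mem_segment_plane.2 ⟨(z.1 - a) / (a' - a), div_nonneg (by linarith) (by linarith),
      (div_le_one (by linarith)).2 (by linarith), ?_, by simp [h]⟩
    have : a' - a ≠ 0 := by linarith
    simp only
    field_simp
    ring

theorem mem_segment_vertical {a b b' : ℝ} {z : Plane} (h : z.1 = a) (h1 : b ≤ z.2)
    (h2 : z.2 ≤ b') : z ∈ segment ℝ ((a, b) : Plane) (a, b') := by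
  rcases eq_or_lt_of_le (h1.trans h2) with h' | h'
  · have : z = (a, b) := Prod.ext h (by simp; linarith)
    rw [this]
    exact left_mem_segment _ _ _
  · refine mem_segment_plane.2 ⟨(z.2 - b) / (b' - b), div_nonneg (by linarith) (by linarith),
      (div_le_one (by linarith)).2 (by linarith), by simp [h], ?_⟩
    have : b' - b ≠ 0 := by linarith
    simp only
    field_simp
    ring

/-- An edge straddling the height `b` meets that height in a single point. Since the edge avoids the
path of the source, this point is to the right of both positions or of neither. -/
theorem rayCross_horizontal {p q : Plane} {a a' b : ℝ} (haa : a ≤ a')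
    (h : Disjoint (segment ℝ p q) (segment ℝ ((a, b) : Plane) (a', b))) :
    rayCross p q (a, b) = rayCross p q (a', b) := by
  classical
  by_cases hr : p.2 ≤ b ∧ b < q.2 ∨ q.2 ≤ b ∧ b < p.2
  · obtain ⟨z, hz, hzb⟩ : ∃ z ∈ segment ℝ p q, z.2 = b := by
      rcases hr with hr | hr
      · exact exists_mem_segment_snd hr.1 hr.2.le
      · rw [segment_symm]
        exact exists_mem_segment_snd hr.1 hr.2.le
    rw [rayCross_of_mem (x := (a, b)) hr hz hzb, rayCross_of_mem (x := (a', b)) hr hz hzb]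
    congr 1
    refine propext ⟨fun h' => ?_, fun h' => haa.trans_lt h'⟩
    by_contra hc
    exact Set.disjoint_left.1 h hz (mem_segment_horizontal hzb h'.le (not_lt.1 hc))
  · rw [rayCross_eq_zero (x := (a, b)) hr, rayCross_eq_zero (x := (a', b)) hr]

open Classical in
/-- The indicator of the half-open box to the right of the vertical segment from `(a, b)`
to `(a, b')`. -/
noncomputable def boxInd (a b b' : ℝ) (z : Plane) : ZMod 2 :=
  if a < z.1 ∧ b < z.2 ∧ z.2 ≤ b' then 1 else 0

/-- If the sides differed, the part of the edge between `z` and `z'` would cross the vertical line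
at a height between those of `z` and `z'`, hence on the excluded vertical segment. -/
theorem segment_same_side {p q z z' : Plane} {a b b' : ℝ}
    (h : Disjoint (segment ℝ p q) (segment ℝ ((a, b) : Plane) (a, b')))
    (hz : z ∈ segment ℝ p q) (hz' : z' ∈ segment ℝ p q) (h1 : b ≤ z.2) (h2 : z.2 ≤ b')
    (h1' : b ≤ z'.2) (h2' : z'.2 ≤ b') : a < z.1 → a < z'.1 := by
  intro hlt
  by_contra hc
  obtain ⟨y, hy, hy1, hy2, hy3⟩ := exists_mem_segment_fst (not_lt.1 hc) hlt
  exact Set.disjoint_left.1 h ((convex_segment p q).segment_subset hz' hz hy)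
    (mem_segment_vertical hy1 (hy2 b h1' h1) (hy3 b' h2' h2))

/-- When the source rises, an edge starts or stops being counted only as the source passes the
height of one of its ends, and this matters only if the end is to the right. An edge is counted at
its lower height but not at its upper one, which is why the box is open below and closed above. -/
theorem rayCross_vertical_aux {p q : Plane} {a b b' : ℝ} (hbb : b ≤ b') (hpq : p.2 ≤ q.2)
    (h : Disjoint (segment ℝ p q) (segment ℝ ((a, b) : Plane) (a, b'))) :
    rayCross p q (a, b) + rayCross p q (a, b') = boxInd a b b' p + boxInd a b b' q := by
  classical
  have hp := left_mem_segment ℝ p q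
  have hq := right_mem_segment ℝ p q
  have side : ∀ z ∈ segment ℝ p q, ∀ z' ∈ segment ℝ p q, b ≤ z.2 → z.2 ≤ b' → b ≤ z'.2 →
      z'.2 ≤ b' → (a < z.1 ↔ a < z'.1) := fun z hz z' hz' h1 h2 h1' h2' =>
    ⟨segment_same_side h hz hz' h1 h2 h1' h2', segment_same_side h hz' hz h1' h2' h1 h2⟩
  have zero : ∀ c, ¬ (p.2 ≤ c ∧ c < q.2) → rayCross p q (a, c) = 0 := by
    intro c hc
    refine rayCross_eq_zero ?_
    rintro (hh | hh)
    · exact hc hh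
    · simp only at hh
      linarith [hh.1, hh.2]
  have one : ∀ c, p.2 ≤ c → c < q.2 → ∃ z ∈ segment ℝ p q, z.2 = c ∧
      rayCross p q (a, c) = if a < z.1 then 1 else 0 := by
    intro c h1 h2
    obtain ⟨z, hz, hzc⟩ := exists_mem_segment_snd h1 h2.le
    exact ⟨z, hz, hzc, rayCross_of_mem (x := (a, c)) (Or.inl ⟨h1, h2⟩) hz hzc⟩
  have hadd : (1 : ZMod 2) + 1 = 0 := by decide
  unfold boxInd
  -- The cases locate the heights of the lower end `p` and the upper end `q` relative to `b` and
  -- `b'`.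
  by_cases c1 : q.2 ≤ b
  · rw [zero b (by rintro ⟨h1, h2⟩; linarith), zero b' (by rintro ⟨h1, h2⟩; linarith),
      if_neg (by rintro ⟨-, h1, -⟩; linarith), if_neg (by rintro ⟨-, h1, -⟩; linarith)]
  by_cases c2 : b' < p.2
  · rw [zero b (by rintro ⟨h1, h2⟩; linarith), zero b' (by rintro ⟨h1, h2⟩; linarith),
      if_neg (by rintro ⟨-, -, h1⟩; linarith), if_neg (by rintro ⟨-, -, h1⟩; linarith)]
  push Not at c1 c2
  by_cases c3 : p.2 ≤ b
  · obtain ⟨z, hz, hzc, e⟩ := one b c3 c1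
    rw [e, if_neg (c := a < p.1 ∧ _) (by rintro ⟨-, h1, -⟩; linarith)]
    by_cases c4 : q.2 ≤ b'
    · rw [zero b' (by rintro ⟨h1, h2⟩; linarith)]
      simp only [c1, c4, and_true, add_zero, zero_add]
      rw [if_congr (side z hz q hq (by linarith) (by linarith) (by linarith) c4) rfl rfl]
    · push Not at c4
      obtain ⟨z', hz', hzc', e'⟩ := one b' (by linarith) c4
      rw [e', if_neg (c := a < q.1 ∧ _) (by rintro ⟨-, -, h1⟩; linarith),
        if_congr (side z hz z' hz' (by linarith) (by linarith) (by linarith) (by linarith)) rfl rfl]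
      split_ifs <;> simp [hadd]
  · push Not at c3
    rw [zero b (by rintro ⟨h1, h2⟩; linarith)]
    by_cases c4 : q.2 ≤ b'
    · rw [zero b' (by rintro ⟨h1, h2⟩; linarith)]
      simp only [c1, c2, c3, c4, and_true, add_zero]
      rw [if_congr (side p hp q hq c3.le c2 c1.le c4) rfl rfl]
      split_ifs <;> simp [hadd]
    · push Not at c4
      obtain ⟨z', hz', hzc', e'⟩ := one b' c2 c4
      rw [e', if_neg (c := a < q.1 ∧ _) (by rintro ⟨-, -, h1⟩; linarith)]
      simp only [c2, c3, and_true, add_zero, zero_add]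
      rw [if_congr (side p hp z' hz' c3.le c2 (by linarith) (by linarith)) rfl rfl]

theorem rayCross_vertical {p q : Plane} {a b b' : ℝ} (hbb : b ≤ b')
    (h : Disjoint (segment ℝ p q) (segment ℝ ((a, b) : Plane) (a, b'))) :
    rayCross p q (a, b) + rayCross p q (a, b') = boxInd a b b' p + boxInd a b b' q := by
  rcases le_total p.2 q.2 with hpq | hpq
  · exact rayCross_vertical_aux hbb hpq h
  · rw [rayCross_comm p, rayCross_comm p, add_comm (boxInd a b b' p)]
    exact rayCross_vertical_aux hbb hpq (by rwa [segment_symm])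

/-- The number of edges of the polygonal path `Q 0, …, Q N` met by the horizontal ray
from `x` to the right, modulo two. -/
noncomputable def pathParity (N : ℕ) (Q : ℕ → Plane) (x : Plane) : ZMod 2 :=
  ∑ i ∈ Finset.range N, rayCross (Q i) (Q (i + 1)) x

/-- The point set of the polygonal path `Q 0, …, Q N`. -/
def pathTrace (N : ℕ) (Q : ℕ → Plane) : Set Plane :=
  ⋃ i ∈ Finset.range N, segment ℝ (Q i) (Q (i + 1))

theorem zmod_two_add_self (a : ZMod 2) : a + a = 0 := by
  revert a
  decide

theorem zmod_two_eq_of_add {a b : ZMod 2} (h : a + b = 0) : a = b := by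
  revert a b
  decide

theorem sum_range_zmod_two (g : ℕ → ZMod 2) (N : ℕ) :
    ∑ i ∈ Finset.range N, (g i + g (i + 1)) = g 0 + g N := by
  induction N with
  | zero => simp [zmod_two_add_self]
  | succ N ih =>
    rw [Finset.sum_range_succ, ih]
    linear_combination zmod_two_add_self (g N)

/-- Horizontally every summand is unchanged, so the path need not be closed. -/
theorem pathParity_horizontal {N : ℕ} {Q : ℕ → Plane} {a a' b : ℝ}
    (h : Disjoint (pathTrace N Q) (segment ℝ ((a, b) : Plane) (a', b))) :
    pathParity N Q (a, b) = pathParity N Q (a', b) := by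
  wlog haa : a ≤ a' generalizing a a'
  · exact (this (by rwa [segment_symm]) (le_of_not_ge haa)).symm
  refine Finset.sum_congr rfl fun i hi => rayCross_horizontal haa (h.mono_left ?_)
  exact Set.subset_biUnion_of_mem (u := fun i => segment ℝ (Q i) (Q (i + 1))) hi

/-- Single summands may change, but each change is a sum of box indicators at the two ends of an
edge. Around a closed polygon every vertex is an end twice, so the changes cancel. -/
theorem pathParity_vertical {N : ℕ} {Q : ℕ → Plane} (hQ : Q 0 = Q N) {a b b' : ℝ}
    (h : Disjoint (pathTrace N Q) (segment ℝ ((a, b) : Plane) (a, b'))) :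
    pathParity N Q (a, b) = pathParity N Q (a, b') := by
  wlog hbb : b ≤ b' generalizing b b'
  · exact (this (by rwa [segment_symm]) (le_of_not_ge hbb)).symm
  apply zmod_two_eq_of_add
  unfold pathParity
  rw [← Finset.sum_add_distrib]
  calc _ = ∑ i ∈ Finset.range N, (boxInd a b b' (Q i) + boxInd a b b' (Q (i + 1))) := by
        refine Finset.sum_congr rfl fun i hi => rayCross_vertical hbb (h.mono_left ?_)
        exact Set.subset_biUnion_of_mem (u := fun i => segment ℝ (Q i) (Q (i + 1))) hi
    _ = 0 := by
        rw [sum_range_zmod_two (fun i => boxInd a b b' (Q i)), hQ, zmod_two_add_self]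

theorem isCompact_segment {E : Type*} [AddCommGroup E] [Module ℝ E] [TopologicalSpace E]
    [ContinuousAdd E] [ContinuousSMul ℝ E] (p q : E) : IsCompact (segment ℝ p q) := by
  rw [segment_eq_image]
  exact isCompact_Icc.image (by fun_prop)

theorem isClosed_pathTrace (N : ℕ) (Q : ℕ → Plane) : IsClosed (pathTrace N Q) :=
  isClosed_biUnion_finset fun _ _ => (isCompact_segment _ _).isClosed

theorem pathParity_eq_of_ball {N : ℕ} {Q : ℕ → Plane} (hQ : Q 0 = Q N) {c x y : Plane} {r : ℝ}
    (h : Disjoint (pathTrace N Q) (Metric.ball c r)) (hx : x ∈ Metric.ball c r)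
    (hy : y ∈ Metric.ball c r) : pathParity N Q x = pathParity N Q y := by
  -- Balls of the product metric are squares, so the corner of the axis-parallel route from `x` to
  -- `y` stays inside.
  have hz : ((y.1, x.2) : Plane) ∈ Metric.ball c r := by
    rw [Metric.mem_ball, Prod.dist_eq, max_lt_iff] at *
    exact ⟨hy.1, hx.2⟩
  have hc := convex_ball c r
  exact (pathParity_horizontal (h.mono_right (hc.segment_subset hx hz))).trans
    (pathParity_vertical hQ (h.mono_right (hc.segment_subset hz hy)))

theorem pathParity_eventually_eq {N : ℕ} {Q : ℕ → Plane} (hQ : Q 0 = Q N) {x : Plane}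
    (hx : x ∉ pathTrace N Q) : ∀ᶠ y in 𝓝 x, pathParity N Q y = pathParity N Q x := by
  obtain ⟨r, hr, h⟩ := Metric.isOpen_iff.1 (isClosed_pathTrace N Q).isOpen_compl x hx
  filter_upwards [Metric.ball_mem_nhds x hr] with y hy
  exact pathParity_eq_of_ball hQ (disjoint_compl_right_iff_subset.2 le_rfl |>.mono_right h) hy
    (Metric.mem_ball_self hr)

/-- A function which is locally constant at each point of a preconnected set is constant on it. -/
theorem eq_of_eventually_eq {X Y : Type*} [TopologicalSpace X] {S : Set X} (hS : IsPreconnected S)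
    {f : X → Y} (hf : ∀ x ∈ S, ∀ᶠ y in 𝓝 x, f y = f x) {x y : X} (hx : x ∈ S) (hy : y ∈ S) :
    f x = f y := by
  -- With the discrete topology on `Y`, local constancy is continuity.
  let : TopologicalSpace Y := ⊥
  have : DiscreteTopology Y := ⟨rfl⟩
  refine hS.constant (f := f) (fun z hz => ContinuousAt.continuousWithinAt ?_) hx hy
  rw [ContinuousAt, nhds_discrete Y, tendsto_pure]
  exact hf z hz

theorem pathParity_eq_of_isPreconnected {N : ℕ} {Q : ℕ → Plane} (hQ : Q 0 = Q N) {S : Set Plane}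
    (hS : IsPreconnected S) (h : Disjoint (pathTrace N Q) S) {x y : Plane} (hx : x ∈ S)
    (hy : y ∈ S) : pathParity N Q x = pathParity N Q y :=
  eq_of_eventually_eq hS
    (fun _ hz => pathParity_eventually_eq hQ (Set.disjoint_right.1 h hz)) hx hy

/-! ### The jump of the parity across an edge -/

/-- The determinant of two vectors of the plane. -/
def planeDet (d e : Plane) : ℝ := d.1 * e.2 - d.2 * e.1

theorem planeDet_smul_add (d e e' : Plane) (a b : ℝ) :
    planeDet d (a • e + b • e') = a * planeDet d e + b * planeDet d e' := by
  simp only [planeDet, Prod.fst_add, Prod.snd_add, Prod.smul_fst, Prod.smul_snd, smul_eq_mul]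
  ring

theorem convex_planeDet_lt (d y : Plane) : Convex ℝ {z : Plane | 0 < planeDet d (z - y)} := by
  intro z hz z' hz' a b ha hb hab
  have : a • z + b • z' - y = a • (z - y) + b • (z' - y) := by
    rw [smul_sub, smul_sub, sub_add_sub_comm, ← add_smul, hab, one_smul]
  simp only [Set.mem_ofPred_eq] at *
  rw [this, planeDet_smul_add]
  rcases eq_or_lt_of_le ha with rfl | ha
  · have : b = 1 := by linarith
    subst this
    linarith
  · have := mul_pos ha hz
    have := mul_nonneg hb hz'.le
    linarith

theorem planeDet_neg_left (d e : Plane) : planeDet (-d) e = - planeDet d e := by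
  simp only [planeDet, Prod.fst_neg, Prod.snd_neg]
  ring

theorem planeDet_eq_zero_of_mem_segment {p q y z : Plane} (hy : y ∈ segment ℝ p q)
    (hz : z ∈ segment ℝ p q) : planeDet (q - p) (z - y) = 0 := by
  obtain ⟨t, -, -, h1, h2⟩ := mem_segment_plane.1 hy
  obtain ⟨t', -, -, h1', h2'⟩ := mem_segment_plane.1 hz
  simp only [planeDet, Prod.fst_sub, Prod.snd_sub, h1, h2, h1', h2']
  ring

theorem abs_half_lt_self {r : ℝ} (hr : 0 < r) : |r / 2| < r := by
  rw [abs_of_pos (half_pos hr)]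
  exact _root_.half_lt_self hr

section Jump

variable {N : ℕ} {Q : ℕ → Plane} {k : ℕ} {y : Plane} {r : ℝ}

/-- The edges that miss the ball contribute equally at both points. Edge `k` lies to the right of
the left point and to the left of the right one. -/
theorem pathParity_jump_horizontal (hk : k < N) (hy : y ∈ openSegment ℝ (Q k) (Q (k + 1)))
    (hr : 0 < r) (hB : ∀ i < N, i ≠ k → Disjoint (segment ℝ (Q i) (Q (i + 1))) (Metric.ball y r))
    (hd : (Q k).2 ≠ (Q (k + 1)).2) :
    pathParity N Q (y.1 - r / 2, y.2) + pathParity N Q (y.1 + r / 2, y.2) = 1 := by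
  classical
  have hx : ((y.1 - r / 2, y.2) : Plane) ∈ Metric.ball y r := by
    rw [Metric.mem_ball, Prod.dist_eq, Real.dist_eq, Real.dist_eq, max_lt_iff]
    simpa [hr] using abs_half_lt_self hr
  have hx' : ((y.1 + r / 2, y.2) : Plane) ∈ Metric.ball y r := by
    rw [Metric.mem_ball, Prod.dist_eq, Real.dist_eq, Real.dist_eq, max_lt_iff]
    simpa [hr] using abs_half_lt_self hr
  unfold pathParity
  rw [← Finset.sum_add_distrib, Finset.sum_eq_single k]
  · obtain ⟨a, b, ha, hb, hab, hyy⟩ := hy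
    have hy2 : y.2 = a * (Q k).2 + b * (Q (k + 1)).2 := by rw [← hyy]; rfl
    have hb' : b = 1 - a := by linarith
    have hrange : (Q k).2 ≤ y.2 ∧ y.2 < (Q (k + 1)).2 ∨ (Q (k + 1)).2 ≤ y.2 ∧ y.2 < (Q k).2 := by
      rw [hy2]
      rcases lt_or_gt_of_ne hd with h | h
      · left
        subst hb'
        constructor <;> nlinarith
      · right
        subst hb'
        constructor <;> nlinarith
    have hym : y ∈ segment ℝ (Q k) (Q (k + 1)) := ⟨a, b, ha.le, hb.le, hab, hyy⟩
    rw [rayCross_of_mem (x := (y.1 - r / 2, y.2)) hrange hym rfl,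
      rayCross_of_mem (x := (y.1 + r / 2, y.2)) hrange hym rfl, if_pos (by simp [hr]),
      if_neg (by simp [(half_pos hr).le]), add_zero]
  · intro i hi hik
    rw [rayCross_horizontal (by linarith) ((hB i (Finset.mem_range.1 hi) hik).mono_right
      ((convex_ball y r).segment_subset hx hx')), zmod_two_add_self]
  · exact fun h => absurd (Finset.mem_range.2 hk) h

/-- A horizontal edge is never counted by the ray, yet exactly one of its ends lies in the box. The
box indicators telescope to zero over the whole polygon, so the missing contribution of edge `k` is
the jump. -/
theorem pathParity_jump_vertical (hQ : Q 0 = Q N) (hk : k < N)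
    (hy : y ∈ openSegment ℝ (Q k) (Q (k + 1)))
    (hr : 0 < r) (hB : ∀ i < N, i ≠ k → Disjoint (segment ℝ (Q i) (Q (i + 1))) (Metric.ball y r))
    (hd : (Q k).2 = (Q (k + 1)).2) (hne : (Q k).1 ≠ (Q (k + 1)).1) :
    pathParity N Q (y.1, y.2 - r / 2) + pathParity N Q (y.1, y.2 + r / 2) = 1 := by
  classical
  have hx : ((y.1, y.2 - r / 2) : Plane) ∈ Metric.ball y r := by
    rw [Metric.mem_ball, Prod.dist_eq, Real.dist_eq, Real.dist_eq, max_lt_iff]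
    simpa [hr] using abs_half_lt_self hr
  have hx' : ((y.1, y.2 + r / 2) : Plane) ∈ Metric.ball y r := by
    rw [Metric.mem_ball, Prod.dist_eq, Real.dist_eq, Real.dist_eq, max_lt_iff]
    simpa [hr] using abs_half_lt_self hr
  set a := y.1
  set b := y.2 - r / 2
  set b' := y.2 + r / 2
  have hbox : boxInd a b b' (Q k) + boxInd a b b' (Q (k + 1)) = 1 := by
    obtain ⟨α, β, hα, hβ, hab, hyy⟩ := hy
    have hy2 : y.2 = α * (Q k).2 + β * (Q (k + 1)).2 := by rw [← hyy]; rfl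
    have hy1 : y.1 = α * (Q k).1 + β * (Q (k + 1)).1 := by rw [← hyy]; rfl
    have hβ' : β = 1 - α := by linarith
    subst hβ'
    have e1 : (Q k).2 = y.2 := by rw [hy2, ← hd]; ring
    have e2 : (Q (k + 1)).2 = y.2 := by rw [← hd, e1]
    unfold boxInd
    have c1 : b < y.2 ∧ y.2 ≤ b' := ⟨by simp [b, hr], by simp [b', (half_pos hr).le]⟩
    simp only [e1, e2, c1, and_true]
    rcases lt_or_gt_of_ne hne with h | h
    · rw [if_neg (by simp only [a, hy1]; nlinarith), if_pos (by simp only [a, hy1]; nlinarith),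
        zero_add]
    · rw [if_pos (by simp only [a, hy1]; nlinarith), if_neg (by simp only [a, hy1]; nlinarith),
        add_zero]
  have hterm : ∀ i ∈ Finset.range N, rayCross (Q i) (Q (i + 1)) (a, b) +
      rayCross (Q i) (Q (i + 1)) (a, b') = (boxInd a b b' (Q i) + boxInd a b b' (Q (i + 1))) +
        if i = k then 1 else 0 := by
    intro i hi
    split_ifs with hik
    · subst hik
      rw [rayCross_eq_zero, rayCross_eq_zero, hbox]
      · decide
      · rw [hd]; rintro (h | h) <;> linarith [h.1, h.2]
      · rw [hd]; rintro (h | h) <;> linarith [h.1, h.2]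
    · rw [rayCross_vertical (by simp only [b, b']; linarith)
        ((hB i (Finset.mem_range.1 hi) hik).mono_right
        ((convex_ball y r).segment_subset hx hx')), add_zero]
  unfold pathParity
  rw [← Finset.sum_add_distrib, Finset.sum_congr rfl hterm, Finset.sum_add_distrib,
    sum_range_zmod_two (fun i => boxInd a b b' (Q i)), hQ, zmod_two_add_self, zero_add,
    Finset.sum_ite_eq' (Finset.range N) k, if_pos (Finset.mem_range.2 hk)]

/-- The parity of a closed polygon jumps across an interior point of an edge. -/
theorem pathParity_jump (hQ : Q 0 = Q N) (hk : k < N)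
    (hy : y ∈ openSegment ℝ (Q k) (Q (k + 1)))
    (hother : ∀ i < N, i ≠ k → y ∉ segment ℝ (Q i) (Q (i + 1))) {e : Plane}
    (he : planeDet (Q (k + 1) - Q k) e ≠ 0) :
    ∀ᶠ η in 𝓝[>] (0 : ℝ), pathParity N Q (y + η • e) + pathParity N Q (y - η • e) = 1 := by
  set d := Q (k + 1) - Q k with hd
  have hcl : IsClosed (⋃ i ∈ (Finset.range N).erase k, segment ℝ (Q i) (Q (i + 1))) :=
    isClosed_biUnion_finset fun _ _ => (isCompact_segment _ _).isClosed
  obtain ⟨r, hr, hrB⟩ := Metric.isOpen_iff.1 hcl.isOpen_compl y (by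
    simp only [Set.mem_compl_iff, Set.mem_iUnion, not_exists, Finset.mem_erase, Finset.mem_range]
    exact fun i hi => hother i hi.2 hi.1)
  have hB : ∀ i < N, i ≠ k → Disjoint (segment ℝ (Q i) (Q (i + 1))) (Metric.ball y r) := by
    intro i hi hik
    rw [Set.disjoint_left]
    intro z hz hzB
    refine hrB hzB ?_
    simp only [Set.mem_iUnion]
    exact ⟨i, Finset.mem_erase.2 ⟨hik, Finset.mem_range.2 hi⟩, hz⟩
  have hym := openSegment_subset_segment ℝ _ _ hy
  -- The two half discs beside edge `k` are convex and miss the polygon. It therefore suffices to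
  -- find one pair of points on opposite sides whose parities differ.
  have hside : ∀ d' : Plane, (d' = d ∨ d' = -d) → ∀ x ∈ Metric.ball y r, ∀ x' ∈ Metric.ball y r,
      0 < planeDet d' (x - y) → 0 < planeDet d' (x' - y) →
      pathParity N Q x = pathParity N Q x' := by
    intro d' hd' x hx x' hx' h h'
    refine pathParity_eq_of_isPreconnected hQ
      ((convex_ball y r).inter (convex_planeDet_lt d' y)).isPreconnected ?_ ⟨hx, h⟩ ⟨hx', h'⟩
    rw [Set.disjoint_left]
    rintro z hz ⟨hzB, hzd⟩
    simp only [pathTrace, Set.mem_iUnion, Finset.mem_range] at hz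
    obtain ⟨i, hi, hz⟩ := hz
    by_cases hik : i = k
    · subst hik
      have h0 := planeDet_eq_zero_of_mem_segment hym hz
      simp only [Set.mem_ofPred_eq] at hzd
      rcases hd' with rfl | rfl
      · exact hzd.ne' h0
      · rw [planeDet_neg_left] at hzd
        rw [← hd] at h0
        linarith
    · exact Set.disjoint_left.1 (hB i hi hik) hz hzB
  -- The sample points are displaced horizontally by half the radius, or vertically if edge `k` is
  -- horizontal.
  have key : ∃ x ∈ Metric.ball y r, ∃ x' ∈ Metric.ball y r, 0 < planeDet d (x - y) ∧
      0 < planeDet (-d) (x' - y) ∧ pathParity N Q x + pathParity N Q x' = 1 := by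
    have hm : ∀ u v : ℝ, |u| < r → |v| < r → ((y.1 + u, y.2 + v) : Plane) ∈ Metric.ball y r := by
      intro u v hu hv
      rw [Metric.mem_ball, Prod.dist_eq, Real.dist_eq, Real.dist_eq, max_lt_iff]
      simpa using ⟨hu, hv⟩
    have hr2 : |r / 2| < r := by rw [abs_of_pos (by linarith)]; linarith
    have hr2' : |-(r / 2)| < r := by rwa [abs_neg]
    have h0 : |(0 : ℝ)| < r := by simpa using hr
    by_cases h2 : (Q k).2 = (Q (k + 1)).2
    · have h1 : (Q k).1 ≠ (Q (k + 1)).1 := by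
        intro h1
        apply he
        simp [planeDet, hd, h1, h2]
      have hj := pathParity_jump_vertical hQ hk hy hr hB h2 h1
      have hd2 : d.2 = 0 := by simp [hd, h2]
      have m1 := hm 0 (r / 2) h0 hr2
      have m2 := hm 0 (-(r / 2)) h0 hr2'
      rw [add_zero] at m1 m2
      rw [← sub_eq_add_neg] at m2
      rcases lt_or_gt_of_ne h1 with h | h
      · have hd1 : 0 < d.1 := by simp [hd, h]
        refine ⟨_, m1, _, m2, ?_, ?_, by rw [add_comm, hj]⟩ <;>
        · simp [planeDet, hd2]
          positivity
      · have hd1 : d.1 < 0 := by simp [hd, h]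
        refine ⟨_, m2, _, m1, ?_, ?_, hj⟩ <;>
        · simp [planeDet, hd2]
          nlinarith
    · have hj := pathParity_jump_horizontal hk hy hr hB h2
      have m1 := hm (r / 2) 0 hr2 h0
      have m2 := hm (-(r / 2)) 0 hr2' h0
      rw [add_zero] at m1 m2
      rw [← sub_eq_add_neg] at m2
      rcases lt_or_gt_of_ne h2 with h | h
      · have hd1 : 0 < d.2 := by simp [hd, h]
        refine ⟨_, m2, _, m1, ?_, ?_, hj⟩ <;>
        · simp [planeDet]
          positivity
      · have hd1 : d.2 < 0 := by simp [hd, h]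
        refine ⟨_, m1, _, m2, ?_, ?_, by rw [add_comm, hj]⟩ <;>
        · simp [planeDet]
          nlinarith
  obtain ⟨x, hx, x', hx', hxd, hxd', hsum⟩ := key
  have ev : ∀ e' : Plane, ∀ᶠ η in 𝓝[>] (0 : ℝ), y + η • e' ∈ Metric.ball y r := by
    intro e'
    have hc : ContinuousAt (fun η : ℝ => y + η • e') 0 := by fun_prop
    have := hc.preimage_mem_nhds (t := Metric.ball y r) (by simpa using Metric.ball_mem_nhds y hr)
    exact mem_nhdsWithin_of_mem_nhds this
  have hdm : ∀ (d' e' : Plane) (η : ℝ), planeDet d' (y + η • e' - y) = η * planeDet d' e' := by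
    intro d' e' η
    simp [planeDet]
    ring
  have hneg : planeDet d (-e) = - planeDet d e := by
    simp [planeDet]
    ring
  filter_upwards [ev e, ev (-e), self_mem_nhdsWithin] with η h1 h2 h3
  have h3 : 0 < η := h3
  have hsub : y - η • e = y + η • (-e) := by rw [smul_neg, sub_eq_add_neg]
  rw [hsub]
  rcases lt_or_gt_of_ne he with h | h
  · rw [hside d (Or.inl rfl) _ h2 x hx (by rw [hdm, hneg]; nlinarith) hxd,
      hside (-d) (Or.inr rfl) _ h1 x' hx' (by rw [hdm, planeDet_neg_left]; nlinarith) hxd',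
      add_comm, hsum]
  · rw [hside d (Or.inl rfl) _ h1 x hx (by rw [hdm]; positivity) hxd,
      hside (-d) (Or.inr rfl) _ h2 x' hx' (by rw [hdm, planeDet_neg_left, hneg, neg_neg]; positivity)
        hxd', hsum]

end Jump

/-! ### The periodic parametrisation of a closed polygon -/

section Curve

variable {n : ℕ} (p : ZMod n → Plane)

/-- The parameter of the point reached at time `τ` when running along a closed polygon at unit
speed per edge. -/
noncomputable def timeParam (n : ℕ) (τ : ℝ) : Param n :=
  ((⌊τ⌋ : ℤ), ⟨Int.fract τ, Int.fract_nonneg τ, Int.fract_lt_one τ⟩)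

/-- The periodic parametrisation of a closed polygon. -/
noncomputable def curve (τ : ℝ) : Plane := point p (timeParam n τ)

/-- The direction vector of the edge which is run through at time `τ`. -/
noncomputable def dir (τ : ℝ) : Plane := p ((⌊τ⌋ : ℤ) + 1) - p (⌊τ⌋ : ℤ)

/-- The formula extends to the closed interval because the next edge starts where this one ends. -/
theorem curve_eq_of_mem {i : ℤ} {τ : ℝ} (h1 : (i : ℝ) ≤ τ) (h2 : τ ≤ i + 1) :
    curve p τ = p i + (τ - i) • (p (i + 1) - p i) := by
  rcases eq_or_lt_of_le h2 with h | h
  · subst h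
    have hf : ⌊(i : ℝ) + 1⌋ = i + 1 := by
      rw [Int.floor_eq_iff]
      push_cast
      constructor <;> linarith
    have hfr : Int.fract ((i : ℝ) + 1) = 0 := by
      rw [Int.fract, hf]
      push_cast
      ring
    simp [curve, point, timeParam, hf, hfr]
  · have hf : ⌊τ⌋ = i := Int.floor_eq_iff.2 ⟨h1, h⟩
    simp only [curve, point, timeParam, hf, Int.fract, AffineMap.lineMap_apply, vsub_eq_sub,
      vadd_eq_add]
    rw [add_comm]

/-- The curve is affine on each closed unit interval, and these intervals are a locally finite
closed cover of the line. -/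
theorem curve_continuous : Continuous (curve p) := by
  have hlf : LocallyFinite fun i : ℤ => Icc (i : ℝ) (i + 1) := by
    intro x
    refine ⟨Ioo (x - 1) (x + 1), Ioo_mem_nhds (by linarith) (by linarith), ?_⟩
    refine (Set.finite_Icc (⌊x⌋ - 2) (⌊x⌋ + 2)).subset ?_
    rintro i ⟨y, ⟨h1, h2⟩, h3, h4⟩
    have h5 := Int.floor_le x
    have h6 := Int.lt_floor_add_one x
    constructor
    · have : ((⌊x⌋ - 2 : ℤ) : ℝ) ≤ i := by push_cast; linarith
      exact_mod_cast this
    · have : (i : ℝ) ≤ ((⌊x⌋ + 2 : ℤ) : ℝ) := by push_cast; linarith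
      exact_mod_cast this
  refine hlf.continuous ?_ (fun _ => isClosed_Icc) fun i => ?_
  · refine Set.eq_univ_of_forall fun x => Set.mem_iUnion.2 ⟨⌊x⌋, Int.floor_le x, ?_⟩
    exact (Int.lt_floor_add_one x).le
  · refine ContinuousOn.congr (f := fun τ : ℝ => p i + (τ - i) • (p (i + 1) - p i)) (by fun_prop) ?_
    exact fun τ hτ => curve_eq_of_mem p hτ.1 hτ.2

theorem timeParam_add (τ : ℝ) (k : ℤ) : timeParam n (τ + k * n) = timeParam n τ := by
  have h : (k : ℝ) * n = ((k * n : ℤ) : ℝ) := by push_cast; ring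
  rw [h]
  ext
  · change ((⌊τ + ((k * n : ℤ) : ℝ)⌋ : ℤ) : ZMod n) = _
    rw [Int.floor_add_intCast]
    simp [timeParam]
  · exact Int.fract_add_intCast _ _

theorem curve_add (τ : ℝ) (k : ℤ) : curve p (τ + k * n) = curve p τ := by
  rw [curve, timeParam_add, curve]

theorem curve_add_period (τ : ℝ) : curve p (τ + n) = curve p τ := by
  simpa using curve_add p τ 1

theorem timeParam_eq_iff {σ τ : ℝ} :
    timeParam n σ = timeParam n τ ↔ ∃ k : ℤ, σ = τ + k * n := by
  constructor
  · intro h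
    have h1 : ((⌊σ⌋ : ℤ) : ZMod n) = ⌊τ⌋ := congrArg Prod.fst h
    have h2 : Int.fract σ = Int.fract τ := congrArg (fun x : Param n => (x.2 : ℝ)) h
    rw [ZMod.intCast_eq_intCast_iff_dvd_sub] at h1
    obtain ⟨k, hk⟩ := h1
    refine ⟨-k, ?_⟩
    have h3 : ((⌊τ⌋ - ⌊σ⌋ : ℤ) : ℝ) = ((n * k : ℤ) : ℝ) := by rw [hk]
    push_cast at h3 ⊢
    have h4 := Int.floor_add_fract σ
    have h5 := Int.floor_add_fract τ
    linarith
  · rintro ⟨k, rfl⟩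
    exact timeParam_add τ k

/-- Together with `eq_of_period_shift`, this makes half-open intervals of length `n` fundamental
domains, in which all passing times are compared. -/
theorem exists_period_shift (hn : 0 < n) (a σ : ℝ) :
    ∃ k : ℤ, a ≤ σ + k * n ∧ σ + k * n < a + n := by
  have hn' : (0 : ℝ) < n := Nat.cast_pos.2 hn
  refine ⟨-⌊(σ - a) / n⌋, ?_, ?_⟩
  · have := Int.floor_le ((σ - a) / n)
    rw [le_div_iff₀ hn'] at this
    push_cast
    linarith
  · have := Int.lt_floor_add_one ((σ - a) / n)
    rw [div_lt_iff₀ hn'] at this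
    push_cast
    linarith

theorem eq_of_period_shift {a σ τ : ℝ} {k : ℤ} (h : σ = τ + k * n) (h1 : a ≤ σ) (h2 : σ < a + n)
    (h3 : a ≤ τ) (h4 : τ < a + n) : σ = τ := by
  subst h
  have hk : k = 0 := by
    by_contra hk
    rcases lt_or_gt_of_ne hk with hk | hk
    · have : (k : ℝ) ≤ -1 := by exact_mod_cast Int.le_sub_one_of_lt hk
      have hn : (0 : ℝ) ≤ n := Nat.cast_nonneg n
      nlinarith
    · have : (1 : ℝ) ≤ k := by exact_mod_cast hk
      have hn : (0 : ℝ) ≤ n := Nat.cast_nonneg n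
      nlinarith
  simp [hk]

theorem timeParam_surjective (x : Param n) : ∃ τ, timeParam n τ = x := by
  obtain ⟨i, t, ht0, ht1⟩ := x
  obtain ⟨j, rfl⟩ := ZMod.intCast_surjective i
  refine ⟨j + t, ?_⟩
  have hf : ⌊(j : ℝ) + t⌋ = j := Int.floor_eq_iff.2 ⟨by linarith, by linarith⟩
  ext
  · simp [timeParam, hf]
  · simp [timeParam, Int.fract, hf]

theorem trace_eq_range_curve : trace p = range (curve p) := by
  ext q
  constructor
  · rintro ⟨x, rfl⟩
    obtain ⟨τ, rfl⟩ := timeParam_surjective x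
    exact ⟨τ, rfl⟩
  · rintro ⟨τ, rfl⟩
    exact ⟨_, rfl⟩

theorem exists_curve_eq (hn : 0 < n) (a σ : ℝ) :
    ∃ τ, a ≤ τ ∧ τ < a + n ∧ curve p τ = curve p σ := by
  obtain ⟨k, h1, h2⟩ := exists_period_shift hn a σ
  exact ⟨_, h1, h2, curve_add p σ k⟩

theorem isCompact_trace (hn : 0 < n) : IsCompact (trace p) := by
  have : trace p = curve p '' Icc (0 : ℝ) (0 + n) := by
    rw [trace_eq_range_curve]
    refine Subset.antisymm ?_ (image_subset_range _ _)
    rintro _ ⟨σ, rfl⟩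
    obtain ⟨τ, h1, h2, h3⟩ := exists_curve_eq p hn 0 σ
    exact ⟨τ, ⟨h1, h2.le⟩, h3⟩
  rw [this]
  exact isCompact_Icc.image (curve_continuous p)

/-- Points of the curve near `v` are run through at times near the times at which `v` is. -/
theorem curve_near_fiber (hn : 0 < n) (v : Plane) {δ : ℝ} (hδ : 0 < δ) :
    ∀ᶠ q in 𝓝 v, ∀ σ, curve p σ = q → ∃ τ, curve p τ = v ∧ |σ - τ| < δ := by
  -- The times within one period that are at least `δ` away from the whole fibre of `v` form a
  -- compact set, so their image is closed, and it misses `v`.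
  set A : Set ℝ := Icc (0 : ℝ) (0 + n) ∩ ⋂ τ ∈ {τ | curve p τ = v}, {σ | δ ≤ |σ - τ|} with hA
  have hAc : IsCompact A := by
    refine isCompact_Icc.inter_right (isClosed_biInter fun τ _ => ?_)
    exact isClosed_le continuous_const (by fun_prop)
  have hK := (hAc.image (curve_continuous p)).isClosed
  have hv : v ∉ curve p '' A := by
    rintro ⟨σ, ⟨-, h⟩, hσ⟩
    have := Set.mem_iInter₂.1 h σ hσ
    simp at this
    linarith
  filter_upwards [hK.isOpen_compl.mem_nhds hv] with q hq σ hσ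
  obtain ⟨k, h1, h2⟩ := exists_period_shift hn 0 σ
  by_contra hc
  push Not at hc
  refine hq ⟨σ + k * n, ⟨⟨h1, h2.le⟩, Set.mem_iInter₂.2 fun τ hτ => ?_⟩, by rw [curve_add, hσ]⟩
  have := hc (τ + (-k : ℤ) * n) (by rw [curve_add]; exact hτ)
  push_cast at this
  rw [show σ - (τ + -(k : ℝ) * n) = σ + k * n - τ by ring] at this
  exact this

theorem curve_add_of_le {τ h : ℝ} (h0 : (⌊τ⌋ : ℝ) ≤ τ + h) (h1 : τ + h ≤ ⌊τ⌋ + 1) :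
    curve p (τ + h) = curve p τ + h • dir p τ := by
  rw [curve_eq_of_mem p h0 h1,
    curve_eq_of_mem p (Int.floor_le τ) (Int.lt_floor_add_one τ).le, dir]
  module

end Curve

/-! ### Diagrams as periodic curves, and charts at crossings -/

namespace Diagram

variable (D : Diagram)

/-- The periodic parametrisation of the diagram. -/
noncomputable def φ (τ : ℝ) : Plane := curve D.vertex τ

/-- The direction vectors of the diagram. -/
noncomputable def dir (τ : ℝ) : Plane := PLKnot.dir D.vertex τ

theorem φ_continuous : Continuous D.φ := curve_continuous _

theorem graph_eq : D.graph = range D.φ := trace_eq_range_curve _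

theorem isClosed_graph : IsClosed D.graph := (isCompact_trace _ D.n_pos).isClosed

theorem φ_add (τ : ℝ) (k : ℤ) : D.φ (τ + k * D.n) = D.φ τ := curve_add _ _ _

theorem φ_add_period (τ : ℝ) : D.φ (τ + D.n) = D.φ τ := curve_add_period _ _

theorem φ_mem_graph (τ : ℝ) : D.φ τ ∈ D.graph := ⟨_, rfl⟩

theorem mem_crossings_iff {v : Plane} : v ∈ D.crossings ↔
    ∃ s t, D.φ s = v ∧ D.φ t = v ∧ ¬ ∃ k : ℤ, s = t + k * D.n := by
  constructor
  · rintro ⟨x, y, hxy, hx, hy⟩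
    obtain ⟨s, rfl⟩ := timeParam_surjective x
    obtain ⟨t, rfl⟩ := timeParam_surjective y
    exact ⟨s, t, hx, hy, fun h => hxy (timeParam_eq_iff.2 h)⟩
  · rintro ⟨s, t, hs, ht, h⟩
    exact ⟨timeParam D.n s, timeParam D.n t, fun h' => h (timeParam_eq_iff.1 h'), hs, ht⟩

theorem exists_shift_of_not_mem {σ τ : ℝ} (h : D.φ τ ∉ D.crossings) (hσ : D.φ σ = D.φ τ) :
    ∃ k : ℤ, σ = τ + k * D.n := by
  by_contra hc
  exact h (D.mem_crossings_iff.2 ⟨σ, τ, hσ, rfl, hc⟩)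

theorem planeDet_ne_zero {d e : Plane} (h : LinearIndependent ℝ ![d, e]) : planeDet d e ≠ 0 := by
  intro h0
  have hi := LinearIndependent.pair_iff.1 h
  unfold planeDet at h0
  have h1 := hi e.2 (-d.2) (Prod.ext (by simp; linarith) (by simp; ring))
  have h2 := hi e.1 (-d.1) (Prod.ext (by simp; ring) (by simp; linarith))
  have : d = 0 := Prod.ext (by simpa using h2.2) (by simpa using h1.2)
  have h3 := hi 1 0 (by simp [this])
  exact one_ne_zero h3.1

theorem planeDet_ne_zero_of_eq {s t : ℝ} (h : D.φ s = D.φ t) (hst : ¬ ∃ k : ℤ, s = t + k * D.n) :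
    planeDet (D.dir s) (D.dir t) ≠ 0 :=
  planeDet_ne_zero (D.transverse (timeParam D.n s) (timeParam D.n t)
    (fun h' => hst (timeParam_eq_iff.1 h')) h).2

theorem floor_lt_of_eq {s t : ℝ} (h : D.φ s = D.φ t) (hst : ¬ ∃ k : ℤ, s = t + k * D.n) :
    (⌊s⌋ : ℝ) < s := by
  have h1 := (D.transverse (timeParam D.n s) (timeParam D.n t)
    (fun h' => hst (timeParam_eq_iff.1 h')) h).1
  have h2 : 0 < Int.fract s := lt_of_le_of_ne (Int.fract_nonneg s) (Ne.symm h1)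
  have := Int.floor_add_fract s
  linarith

theorem shift_of_triple {s t τ : ℝ} (h : D.φ s = D.φ t) (hst : ¬ ∃ k : ℤ, s = t + k * D.n)
    (hτ : D.φ τ = D.φ s) : (∃ k : ℤ, τ = s + k * D.n) ∨ ∃ k : ℤ, τ = t + k * D.n := by
  rcases D.no_triple (timeParam D.n τ) (timeParam D.n s) (timeParam D.n t) hτ h with h' | h' | h'
  · exact Or.inl (timeParam_eq_iff.1 h')
  · exact absurd (timeParam_eq_iff.1 h') hst
  · exact Or.inr (timeParam_eq_iff.1 h')

/-- On a degenerate edge the start and the midpoint would be a double point whose two directions are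
both zero, against transversality. -/
theorem vertex_ne (i : ZMod D.n) : D.vertex i ≠ D.vertex (i + 1) := by
  intro h
  have := (D.transverse (i, ⟨1 / 2, by norm_num, by norm_num⟩) (i, ⟨0, by norm_num, by norm_num⟩)
    (fun h' => by
      have := congrArg (fun x : Param D.n => (x.2 : ℝ)) h'
      norm_num at this) (by simp [point, h])).2
  have h0 := planeDet_ne_zero this
  simp [planeDet, h] at h0

theorem dir_ne_zero (τ : ℝ) : D.dir τ ≠ 0 := by
  unfold dir PLKnot.dir
  exact sub_ne_zero.2 (D.vertex_ne _).symm

/-- A local chart at a crossing point: the parallelogram spanned by the two strands. -/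
structure IsChart (s t ε : ℝ) : Prop where
  pos : 0 < ε
  eq : D.φ s = D.φ t
  det : planeDet (D.dir s) (D.dir t) ≠ 0
  not_shift : ¬ ∃ k : ℤ, s = t + k * D.n
  left : ∀ a, |a| < ε → (⌊s⌋ : ℝ) < s + a ∧ s + a < ⌊s⌋ + 1
  right : ∀ a, |a| < ε → (⌊t⌋ : ℝ) < t + a ∧ t + a < ⌊t⌋ + 1
  mem_iff : ∀ a b, |a| < ε → |b| < ε →
    (D.φ s + a • D.dir s + b • D.dir t ∈ D.graph ↔ a = 0 ∨ b = 0)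

theorem IsChart.swap {D : Diagram} {s t ε : ℝ} (h : D.IsChart s t ε) : D.IsChart t s ε where
  pos := h.pos
  eq := h.eq.symm
  det := by
    have := h.det
    unfold planeDet at *
    intro h'
    apply this
    linarith
  not_shift := by
    rintro ⟨k, hk⟩
    exact h.not_shift ⟨-k, by push_cast; linarith⟩
  left := h.right
  right := h.left
  mem_iff := fun a b ha hb => by
    rw [← h.eq, add_right_comm, h.mem_iff b a hb ha, or_comm]

theorem IsChart.φ_left {D : Diagram} {s t ε : ℝ} (h : D.IsChart s t ε) {a : ℝ} (ha : |a| < ε) :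
    D.φ (s + a) = D.φ s + a • D.dir s :=
  curve_add_of_le _ (h.left a ha).1.le (h.left a ha).2.le

theorem exists_unit_radius {s : ℝ} (hs : (⌊s⌋ : ℝ) < s) :
    ∃ δ > 0, ∀ a, |a| < δ → (⌊s⌋ : ℝ) < s + a ∧ s + a < ⌊s⌋ + 1 := by
  have h1 := Int.lt_floor_add_one s
  refine ⟨min (s - ⌊s⌋) (⌊s⌋ + 1 - s), lt_min (by linarith) (by linarith), fun a ha => ?_⟩
  rw [abs_lt] at ha
  have h2 := min_le_left (s - ⌊s⌋) (⌊s⌋ + 1 - s)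
  have h3 := min_le_right (s - ⌊s⌋) (⌊s⌋ + 1 - s)
  constructor <;> linarith [ha.1, ha.2]

theorem smul_eq_zero_of_planeDet {d e : Plane} (h : planeDet d e ≠ 0) {a b : ℝ}
    (hab : a • d + b • e = 0) : a = 0 ∧ b = 0 := by
  have h1 : a * d.1 + b * e.1 = 0 := congrArg Prod.fst hab
  have h2 : a * d.2 + b * e.2 = 0 := congrArg Prod.snd hab
  unfold planeDet at h
  constructor
  · have : a * (d.1 * e.2 - d.2 * e.1) = 0 := by linear_combination e.2 * h1 - e.1 * h2
    exact (mul_eq_zero.1 this).resolve_right h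
  · have : b * (d.1 * e.2 - d.2 * e.1) = 0 := by linear_combination d.1 * h2 - d.2 * h1
    exact (mul_eq_zero.1 this).resolve_right h

/-- Near a crossing, graph points are passed only at times near the fibre, and without triple points
the fibre consists of the translates of `s` and `t`. A double point is not a vertex, so the curve is
straight at these times. Independence of the two directions then identifies the coordinate that
vanishes. -/
theorem exists_isChart {s t : ℝ} (h : D.φ s = D.φ t) (hst : ¬ ∃ k : ℤ, s = t + k * D.n) :
    ∃ ε, D.IsChart s t ε := by
  have hst' : ¬ ∃ k : ℤ, t = s + k * D.n := by
    rintro ⟨k, hk⟩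
    exact hst ⟨-k, by push_cast; linarith⟩
  have hdet := D.planeDet_ne_zero_of_eq h hst
  obtain ⟨δ₁, hδ₁, h1⟩ := exists_unit_radius (D.floor_lt_of_eq h hst)
  obtain ⟨δ₂, hδ₂, h2⟩ := exists_unit_radius (D.floor_lt_of_eq h.symm hst')
  have hnear := curve_near_fiber D.vertex D.n_pos (D.φ s) (lt_min hδ₁ hδ₂)
  have hcont : ContinuousAt (fun x : ℝ × ℝ => D.φ s + x.1 • D.dir s + x.2 • D.dir t) (0, 0) := by
    fun_prop
  have hev := hcont.eventually (p := fun q => ∀ σ, curve D.vertex σ = q →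
    ∃ τ, curve D.vertex τ = D.φ s ∧ |σ - τ| < min δ₁ δ₂) (by simpa using hnear)
  obtain ⟨r, hr, hrB⟩ := Metric.eventually_nhds_iff.1 hev
  refine ⟨min r (min δ₁ δ₂), lt_min hr (lt_min hδ₁ hδ₂), h, hdet, hst, fun a ha => h1 a ?_,
    fun a ha => h2 a ?_, fun a b ha hb => ⟨?_, ?_⟩⟩
  · exact ha.trans_le ((min_le_right _ _).trans (min_le_left _ _))
  · exact ha.trans_le ((min_le_right _ _).trans (min_le_right _ _))
  · rw [graph_eq]
    rintro ⟨σ, hσ⟩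
    obtain ⟨τ, hτ, hστ⟩ := hrB (y := (a, b)) (by
      rw [Prod.dist_eq, Real.dist_eq, Real.dist_eq, max_lt_iff]
      simpa using ⟨ha.trans_le (min_le_left _ _), hb.trans_le (min_le_left _ _)⟩) σ hσ
    rcases D.shift_of_triple h hst hτ with ⟨k, rfl⟩ | ⟨k, rfl⟩
    · have e : D.φ (s + (σ - (s + k * D.n))) = D.φ σ := by
        rw [← D.φ_add _ k]
        congr 1
        ring
      have hle := h1 _ (hστ.trans_le (min_le_left _ _))
      have e2 : D.φ (s + (σ - (s + k * D.n))) = _ := curve_add_of_le D.vertex hle.1.le hle.2.le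
      rw [e, hσ, add_assoc] at e2
      have e3 := add_left_cancel e2
      refine Or.inr (smul_eq_zero_of_planeDet hdet (a := a - (σ - (s + k * D.n))) ?_).2
      rw [sub_smul, sub_add_eq_add_sub, e3]
      exact sub_self _
    · have e : D.φ (t + (σ - (t + k * D.n))) = D.φ σ := by
        rw [← D.φ_add _ k]
        congr 1
        ring
      have hle := h2 _ (hστ.trans_le (min_le_right _ _))
      have e2 : D.φ (t + (σ - (t + k * D.n))) = D.φ t + _ :=
        curve_add_of_le D.vertex hle.1.le hle.2.le
      rw [e, hσ, add_assoc, h] at e2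
      have e3 := add_left_cancel e2
      refine Or.inl (smul_eq_zero_of_planeDet hdet (b := b - (σ - (t + k * D.n))) ?_).1
      rw [sub_smul, ← add_sub_assoc, e3]
      exact sub_self _
  · rw [graph_eq]
    rintro (rfl | rfl)
    · refine ⟨t + b, ?_⟩
      have hle := h2 b (hb.trans_le ((min_le_right _ _).trans (min_le_right _ _)))
      rw [zero_smul, add_zero, h]
      exact curve_add_of_le D.vertex hle.1.le hle.2.le
    · refine ⟨s + a, ?_⟩
      have hle := h1 a (ha.trans_le ((min_le_right _ _).trans (min_le_left _ _)))
      rw [zero_smul, add_zero]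
      exact curve_add_of_le D.vertex hle.1.le hle.2.le

/-- Two edges that cross have independent directions, so each pair of edges contributes at most one
crossing. -/
theorem finite_crossings : D.crossings.Finite := by
  have : NeZero D.n := ⟨D.n_pos.ne'⟩
  let A : ZMod D.n → ZMod D.n → Set Plane := fun i j =>
    {v | ∃ s t : Ico (0 : ℝ) 1, (i, s) ≠ (j, t) ∧ point D.vertex (i, s) = v ∧
      point D.vertex (j, t) = v}
  have hsub : D.crossings ⊆ ⋃ i, ⋃ j, A i j := by
    rintro v ⟨⟨i, s⟩, ⟨j, t⟩, hne, h1, h2⟩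
    exact Set.mem_iUnion₂.2 ⟨i, j, s, t, hne, h1, h2⟩
  refine (Set.finite_iUnion fun i => Set.finite_iUnion fun j => Set.Subsingleton.finite ?_).subset
    hsub
  rintro v ⟨s, t, hne, h1, h2⟩ w ⟨s', t', hne', h1', h2'⟩
  have hdet := planeDet_ne_zero (D.transverse _ _ hne (h1.trans h2.symm)).2
  have e1 : D.vertex i + (s : ℝ) • (D.vertex (i + 1) - D.vertex i) =
      D.vertex j + (t : ℝ) • (D.vertex (j + 1) - D.vertex j) := by
    have := h1.trans h2.symm
    simpa [point, AffineMap.lineMap_apply, add_comm] using this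
  have e2 : D.vertex i + (s' : ℝ) • (D.vertex (i + 1) - D.vertex i) =
      D.vertex j + (t' : ℝ) • (D.vertex (j + 1) - D.vertex j) := by
    have := h1'.trans h2'.symm
    simpa [point, AffineMap.lineMap_apply, add_comm] using this
  have e3 : ((s : ℝ) - s') • (D.vertex (i + 1) - D.vertex i) +
      ((t' : ℝ) - t) • (D.vertex (j + 1) - D.vertex j) = 0 := by
    have := congrArg₂ (· - ·) e1 e2
    rw [sub_smul, sub_smul]
    rw [add_sub_add_left_eq_sub, add_sub_add_left_eq_sub] at this
    rw [this]
    abel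
  have h0 := (smul_eq_zero_of_planeDet hdet e3).1
  have : s = s' := Subtype.ext (by linarith)
  rw [← h1, ← h1', this]

/-- The two times at which a crossing point is passed. -/
theorem exists_times {v : Plane} (hv : v ∈ D.crossings) {a : ℝ} (ha : D.φ a ∉ D.crossings) :
    ∃ s t, a < s ∧ s < t ∧ t < a + D.n ∧ D.φ s = v ∧ D.φ t = v := by
  obtain ⟨s, t, hs, ht, hst⟩ := D.mem_crossings_iff.1 hv
  obtain ⟨k, h1, h2⟩ := exists_period_shift D.n_pos a s
  obtain ⟨l, h3, h4⟩ := exists_period_shift D.n_pos a t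
  have e1 := D.φ_add s k
  have e2 := D.φ_add t l
  rw [hs] at e1
  rw [ht] at e2
  have hne : s + k * D.n ≠ t + l * D.n := by
    intro h
    exact hst ⟨l - k, by push_cast; linarith⟩
  have n1 : a ≠ s + k * D.n := by
    intro h
    rw [← h] at e1
    exact ha (e1 ▸ hv)
  have n2 : a ≠ t + l * D.n := by
    intro h
    rw [← h] at e2
    exact ha (e2 ▸ hv)
  rcases lt_or_gt_of_ne hne with h | h
  · exact ⟨_, _, lt_of_le_of_ne h1 n1, h, h4, e1, e2⟩
  · exact ⟨_, _, lt_of_le_of_ne h3 n2, h, h2, e2, e1⟩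

theorem not_shift_of_lt {s t : ℝ} (h1 : s < t) (h2 : t < s + D.n) :
    ¬ ∃ k : ℤ, s = t + k * D.n := by
  rintro ⟨k, hk⟩
  have := eq_of_period_shift (a := s) hk le_rfl (by linarith) h1.le h2
  linarith

end Diagram

/-! ### Functions which are locally constant off the diagram -/

/-- Proper affine subspaces are null sets for Haar measure. This serves both for the density of the
complement of a diagram and for choosing vertices off given planes in space. -/
theorem interior_iUnion_affineSubspace {E ι : Type*} [NormedAddCommGroup E] [NormedSpace ℝ E]
    [MeasurableSpace E] [BorelSpace E] [FiniteDimensional ℝ E] [Countable ι]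
    (A : ι → AffineSubspace ℝ E) (hA : ∀ i, A i ≠ ⊤) : interior (⋃ i, (A i : Set E)) = ∅ := by
  apply MeasureTheory.Measure.interior_eq_empty_of_null (μ := MeasureTheory.Measure.addHaar)
  rw [MeasureTheory.measure_iUnion_null_iff]
  exact fun i => MeasureTheory.Measure.addHaar_affineSubspace _ _ (hA i)

theorem affineSpan_pair_ne_top (p q : Plane) : affineSpan ℝ {p, q} ≠ ⊤ := by
  intro h
  have h1 := (collinear_iff_finrank_le_one.1 (collinear_pair ℝ p q))
  rw [← direction_affineSpan, h, AffineSubspace.direction_top, finrank_top] at h1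
  simp at h1

theorem interior_trace_eq_empty {n : ℕ} [NeZero n] (p : ZMod n → Plane) :
    interior (trace p) = ∅ := by
  have : trace p ⊆ ⋃ i : ZMod n, (affineSpan ℝ {p i, p (i + 1)} : Set Plane) := by
    rintro _ ⟨⟨i, t⟩, rfl⟩
    exact Set.mem_iUnion.2 ⟨i, AffineMap.lineMap_mem_affineSpan_pair _ _ _⟩
  rw [← Set.subset_empty_iff]
  refine (interior_mono this).trans ?_
  rw [interior_iUnion_affineSubspace _ fun i => affineSpan_pair_ne_top _ _]

namespace Diagram

variable (D : Diagram)

theorem dense_compl_graph : Dense D.graphᶜ := by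
  have : NeZero D.n := ⟨D.n_pos.ne'⟩
  exact interior_eq_empty_iff_dense_compl.1 (interior_trace_eq_empty D.vertex)

/-- `x` is locally constant off the diagram. -/
def IsColoring (x : Plane → ZMod 2) : Prop := ∀ q ∉ D.graph, ∀ᶠ q' in 𝓝 q, x q' = x q

/-- Off the diagram, `x` is constant near `q`. -/
def ConstNear (x : Plane → ZMod 2) (q : Plane) : Prop :=
  ∃ c, ∀ᶠ q' in 𝓝 q, q' ∉ D.graph → x q' = c

variable {D} {x : Plane → ZMod 2}

theorem IsColoring.eq_of_isPreconnected (hx : D.IsColoring x) {S : Set Plane}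
    (hS : IsPreconnected S) (h : ∀ q ∈ S, q ∉ D.graph) {q q' : Plane} (hq : q ∈ S) (hq' : q' ∈ S) :
    x q = x q' :=
  eq_of_eventually_eq hS (fun z hz => hx z (h z hz)) hq hq'

theorem IsColoring.constNear (hx : D.IsColoring x) {q : Plane} (hq : q ∉ D.graph) :
    D.ConstNear x q :=
  ⟨x q, (hx q hq).mono fun _ h _ => h⟩

theorem ConstNear.eventually {q : Plane} (h : D.ConstNear x q) :
    ∀ᶠ q' in 𝓝 q, D.ConstNear x q' := by
  obtain ⟨c, hc⟩ := h
  filter_upwards [hc.eventually_nhds] with q' hq'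
  exact ⟨c, hq'⟩

/-- Since the complement of the graph is dense, the value taken near a point is unique. The function
`y` recording it is locally constant on `U`, also at points of the graph. -/
theorem exists_const_of_constNear {U : Set Plane} (hU : IsPreconnected U)
    (h : ∀ q ∈ U, D.ConstNear x q) : ∃ c, ∀ q ∈ U, q ∉ D.graph → x q = c := by
  classical
  rcases U.eq_empty_or_nonempty with rfl | ⟨q₀, hq₀⟩
  · exact ⟨0, fun q hq => hq.elim⟩
  let y : Plane → ZMod 2 := fun q => if h : D.ConstNear x q then h.choose else 0
  have uniq : ∀ q c, (∀ᶠ q' in 𝓝 q, q' ∉ D.graph → x q' = c) → y q = c := by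
    intro q c hc
    have hq : D.ConstNear x q := ⟨c, hc⟩
    simp only [y, dif_pos hq]
    have := hq.choose_spec
    obtain ⟨q', hq', h1⟩ := (D.dense_compl_graph.inter_nhds_nonempty (hc.and this))
    rw [← h1.1 hq', h1.2 hq']
  have hloc : ∀ q ∈ U, ∀ᶠ q' in 𝓝 q, y q' = y q := by
    intro q hq
    obtain ⟨c, hc⟩ := h q hq
    rw [uniq q c hc]
    filter_upwards [hc.eventually_nhds] with q' hq'
    exact uniq q' c hq'
  refine ⟨y q₀, fun q hq hqG => ?_⟩
  rw [eq_of_eventually_eq hU hloc hq₀ hq]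
  obtain ⟨c, hc⟩ := h q hq
  rw [uniq q c hc]
  exact hc.self_of_nhds hqG

/-- A disc slit along a ray from its centre is connected. -/
theorem isPreconnected_slit_ball {c d : Plane} (hd : d ≠ 0) {r : ℝ} (hr : 0 < r) :
    IsPreconnected (Metric.ball c r \ {q | ∃ h : ℝ, 0 ≤ h ∧ q = c + h • d}) := by
  have hnd : 0 < ‖d‖ := norm_pos_iff.2 hd
  -- The disc without the ray is star-shaped about the point at distance `r / 2` from the centre on
  -- the opposite ray.
  set κ := r / (2 * ‖d‖) with hκ
  have hκ0 : 0 < κ := by positivity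
  have hstar : StarConvex ℝ (c - κ • d)
      (Metric.ball c r \ {q | ∃ h : ℝ, 0 ≤ h ∧ q = c + h • d}) := by
    rintro z ⟨hz, hzr⟩ a b ha hb hab
    refine ⟨convex_ball c r ?_ hz ha hb hab, ?_⟩
    · rw [Metric.mem_ball, dist_eq_norm, sub_sub_cancel_left, norm_neg, norm_smul,
        Real.norm_of_nonneg hκ0.le, hκ]
      field_simp
      linarith
    · rintro ⟨h, hh, he⟩
      have ha' : a = 1 - b := by linarith
      subst ha'
      have he' : b • (z - c) = (h + (1 - b) * κ) • d := by
        have : b • (z - c) = ((1 - b) • (c - κ • d) + b • z) - c + ((1 - b) * κ) • d := by module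
        rw [this, he]
        module
      rcases eq_or_lt_of_le hb with hb0 | hb0
      · subst hb0
        rw [zero_smul] at he'
        have := smul_eq_zero.1 he'.symm
        rcases this with h1 | h1
        · nlinarith
        · exact hd h1
      · refine hzr ⟨(h + (1 - b) * κ) / b, by positivity, ?_⟩
        have : z - c = b⁻¹ • (b • (z - c)) := by rw [smul_smul, inv_mul_cancel₀ hb0.ne', one_smul]
        rw [he', smul_smul] at this
        rw [div_eq_inv_mul, ← this]
        abel
  refine (hstar.isPathConnected ⟨?_, ?_⟩).isConnected.isPreconnected
  · rw [Metric.mem_ball, dist_eq_norm, sub_sub_cancel_left, norm_neg, norm_smul,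
      Real.norm_of_nonneg hκ0.le, hκ]
    field_simp
    linarith
  · rintro ⟨h, hh, he⟩
    have : (h + κ) • d = 0 := by
      have h2 := sub_eq_zero_of_eq he
      rw [← neg_eq_zero, ← h2]
      module
    rcases smul_eq_zero.1 this with h1 | h1
    · linarith
    · exact hd h1

/-- Constancy near the curve propagates forward through non-crossing points. -/
theorem ConstNear.of_left (hx : D.IsColoring x) {τ δ : ℝ} (hτ : D.φ τ ∉ D.crossings) (hδ : 0 < δ)
    (h : ∀ σ, τ - δ < σ → σ < τ → D.ConstNear x (D.φ σ)) : D.ConstNear x (D.φ τ) := by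
  have hfl := Int.lt_floor_add_one τ
  set δ' := min δ (⌊τ⌋ + 1 - τ) with hδ'
  have hδ'0 : 0 < δ' := lt_min hδ (by linarith)
  have hd := D.dir_ne_zero τ
  have hnd : 0 < ‖D.dir τ‖ := norm_pos_iff.2 hd
  obtain ⟨r₀, hr₀, hB⟩ := Metric.eventually_nhds_iff.1
    (curve_near_fiber D.vertex D.n_pos (D.φ τ) hδ'0)
  set r := min r₀ (δ' * ‖D.dir τ‖) with hr
  have hr0 : 0 < r := lt_min hr₀ (by positivity)
  have hforward : ∀ h, 0 ≤ h → h ≤ δ' → D.φ (τ + h) = D.φ τ + h • D.dir τ := fun h h0 h1 =>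
    curve_add_of_le _ (by linarith [Int.floor_le τ])
      (by linarith [min_le_right δ (⌊τ⌋ + 1 - τ)])
  -- Slit the disc along the forward direction. Up to the period, the remaining curve points near `φ
  -- τ` are passed before `τ`, where constancy is assumed.
  obtain ⟨c, hc⟩ := exists_const_of_constNear (x := x) (D := D)
    (isPreconnected_slit_ball (c := D.φ τ) hd hr0) (by
      rintro q ⟨hqB, hq⟩
      by_cases hqG : q ∈ D.graph
      · rw [graph_eq] at hqG
        obtain ⟨σ, rfl⟩ := hqG
        obtain ⟨τ', hτ', hστ⟩ := hB (lt_of_lt_of_le (Metric.mem_ball.1 hqB) (min_le_left _ _)) σ rfl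
        obtain ⟨k, rfl⟩ := D.exists_shift_of_not_mem hτ hτ'
        have e : D.φ σ = D.φ (τ + (σ - (τ + k * D.n))) := by
          rw [← D.φ_add (τ + _) k]
          congr 1
          ring
        rw [abs_lt] at hστ
        rw [e] at hq ⊢
        rcases le_or_gt 0 (σ - (τ + k * D.n)) with h0 | h0
        · exact absurd ⟨_, h0, hforward _ h0 hστ.2.le⟩ hq
        · exact h _ (by linarith [min_le_left δ (⌊τ⌋ + 1 - τ)]) (by linarith)
      · exact hx.constNear hqG)
  refine ⟨c, ?_⟩
  filter_upwards [Metric.ball_mem_nhds _ hr0] with q hq hqG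
  refine hc q ⟨hq, ?_⟩ hqG
  -- Within this radius the slit is part of the graph, so it carries no condition on `x`.
  rintro ⟨h, h0, rfl⟩
  refine hqG ?_
  rw [← hforward h h0 ?_]
  · exact D.φ_mem_graph _
  · rw [Metric.mem_ball, dist_eq_norm, add_sub_cancel_left, norm_smul, Real.norm_of_nonneg h0] at hq
    have := hq.trans_le (min_le_right _ _)
    exact (lt_of_mul_lt_mul_right this hnd.le).le

/-! ### Coordinates and corner sums at a crossing -/

variable (D) in
/-- The points of the chart at a crossing. -/
noncomputable def chart (s t a b : ℝ) : Plane := D.φ s + a • D.dir s + b • D.dir t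

variable {s t ε : ℝ}

theorem chart_comm (h : D.φ s = D.φ t) (a b : ℝ) : D.chart s t a b = D.chart t s b a := by
  rw [chart, chart, h, add_right_comm]

/-- This is Cramer's rule. The explicit coordinates are continuous in `q`, which `chart_eventually`
exploits. -/
theorem chart_coords (hdet : planeDet (D.dir s) (D.dir t) ≠ 0) (q : Plane) :
    q = D.chart s t (planeDet (q - D.φ s) (D.dir t) / planeDet (D.dir s) (D.dir t))
      (planeDet (D.dir s) (q - D.φ s) / planeDet (D.dir s) (D.dir t)) := by
  set d := D.dir s
  set e := D.dir t
  set Δ := planeDet d e with hΔ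
  have h1 : Δ * (q.1 - (D.φ s).1) = planeDet (q - D.φ s) e * d.1 + planeDet d (q - D.φ s) * e.1 := by
    simp only [hΔ, planeDet, Prod.fst_sub, Prod.snd_sub]
    ring
  have h2 : Δ * (q.2 - (D.φ s).2) = planeDet (q - D.φ s) e * d.2 + planeDet d (q - D.φ s) * e.2 := by
    simp only [hΔ, planeDet, Prod.fst_sub, Prod.snd_sub]
    ring
  unfold chart
  refine Prod.ext ?_ ?_
  · simp only [Prod.fst_add, Prod.smul_fst, smul_eq_mul]
    field_simp
    linarith
  · simp only [Prod.snd_add, Prod.smul_snd, smul_eq_mul]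
    field_simp
    linarith

theorem chart_eventually (hdet : planeDet (D.dir s) (D.dir t) ≠ 0) {a b : ℝ} {P : ℝ → ℝ → Prop}
    (h : ∀ᶠ z in 𝓝 (a, b), P z.1 z.2) :
    ∀ᶠ q in 𝓝 (D.chart s t a b), ∃ a' b', P a' b' ∧ q = D.chart s t a' b' := by
  set f : Plane → ℝ × ℝ := fun q =>
    (planeDet (q - D.φ s) (D.dir t) / planeDet (D.dir s) (D.dir t),
      planeDet (D.dir s) (q - D.φ s) / planeDet (D.dir s) (D.dir t)) with hf
  have hcont : Continuous f := by
    simp only [hf, planeDet]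
    fun_prop
  have hfab : f (D.chart s t a b) = (a, b) := by
    simp only [hf, chart]
    refine Prod.ext ?_ ?_ <;>
    · simp only
      rw [div_eq_iff hdet]
      simp only [planeDet, Prod.fst_add, Prod.snd_add, Prod.fst_sub, Prod.snd_sub, Prod.smul_fst,
        Prod.smul_snd, smul_eq_mul]
      ring
  have := (hcont.tendsto (D.chart s t a b)).eventually (p := fun z => P z.1 z.2) (by rwa [hfab])
  filter_upwards [this] with q hq
  exact ⟨_, _, hq, chart_coords hdet q⟩

variable (D) in
/-- The corner points at a crossing. -/
noncomputable def corner (s t ε σ₁ σ₂ : ℝ) : Plane := D.chart s t (σ₁ * (ε / 2)) (σ₂ * (ε / 2))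

theorem IsChart.quadrant_not_mem (h : D.IsChart s t ε) {σ₁ σ₂ a b : ℝ} (ha : |a| < ε)
    (hb : |b| < ε) (ha0 : 0 < σ₁ * a) (hb0 : 0 < σ₂ * b) : D.chart s t a b ∉ D.graph := by
  intro hm
  rcases (h.mem_iff a b ha hb).1 hm with rfl | rfl
  · simp at ha0
  · simp at hb0

theorem abs_combo_lt {a a' u v ε : ℝ} (ha : |a| < ε) (ha' : |a'| < ε) (hu : 0 ≤ u) (hv : 0 ≤ v)
    (huv : u + v = 1) : |u * a + v * a'| < ε := by
  rw [abs_lt] at *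
  have : v = 1 - u := by linarith
  subst this
  constructor
  · rcases eq_or_lt_of_le hu with rfl | hu <;> nlinarith
  · rcases eq_or_lt_of_le hu with rfl | hu <;> nlinarith

theorem combo_pos {a a' u v σ : ℝ} (ha : 0 < σ * a) (ha' : 0 < σ * a') (hu : 0 ≤ u) (hv : 0 ≤ v)
    (huv : u + v = 1) : 0 < σ * (u * a + v * a') := by
  have : v = 1 - u := by linarith
  subst this
  rcases eq_or_lt_of_le hu with rfl | hu
  · linarith
  · nlinarith [mul_pos hu ha, mul_nonneg hv ha'.le]

/-- The open quadrants of a chart are convex and miss both axes, which are all of the graph inside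
the chart. -/
theorem IsChart.quadrant_segment (h : D.IsChart s t ε) {σ₁ σ₂ a b a' b' : ℝ} (ha : |a| < ε)
    (hb : |b| < ε) (ha0 : 0 < σ₁ * a) (hb0 : 0 < σ₂ * b) (ha' : |a'| < ε)
    (hb' : |b'| < ε) (ha0' : 0 < σ₁ * a') (hb0' : 0 < σ₂ * b') :
    ∀ q ∈ segment ℝ (D.chart s t a b) (D.chart s t a' b'), q ∉ D.graph := by
  rintro _ ⟨u, v, hu, hv, huv, rfl⟩
  have e : u • D.chart s t a b + v • D.chart s t a' b' =
      D.chart s t (u * a + v * a') (u * b + v * b') := by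
    have : u = 1 - v := by linarith
    subst this
    simp only [chart]
    module
  rw [e]
  exact h.quadrant_not_mem (abs_combo_lt ha ha' hu hv huv) (abs_combo_lt hb hb' hu hv huv)
    (combo_pos ha0 ha0' hu hv huv) (combo_pos hb0 hb0' hu hv huv)

theorem IsChart.corner_not_mem (h : D.IsChart s t ε) {σ₁ σ₂ : ℝ} (h1 : |σ₁| = 1)
    (h2 : |σ₂| = 1) : D.corner s t ε σ₁ σ₂ ∉ D.graph := by
  have := h.pos
  refine h.quadrant_not_mem (σ₁ := σ₁) (σ₂ := σ₂) ?_ ?_ ?_ ?_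
  · rw [abs_mul, h1, one_mul]; exact abs_half_lt_self this
  · rw [abs_mul, h2, one_mul]; exact abs_half_lt_self this
  · rw [← mul_assoc, ← abs_mul_abs_self, h1]; linarith
  · rw [← mul_assoc, ← abs_mul_abs_self, h2]; linarith

theorem IsChart.segment_corner (h : D.IsChart s t ε) {σ₁ σ₂ a b : ℝ} (h1 : |σ₁| = 1)
    (h2 : |σ₂| = 1) (ha : |a| < ε) (hb : |b| < ε) (ha0 : 0 < σ₁ * a) (hb0 : 0 < σ₂ * b) :
    ∀ q ∈ segment ℝ (D.chart s t a b) (D.corner s t ε σ₁ σ₂), q ∉ D.graph := by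
  have := h.pos
  refine h.quadrant_segment (σ₁ := σ₁) (σ₂ := σ₂) ha hb ha0 hb0 ?_ ?_ ?_ ?_
  · rw [abs_mul, h1, one_mul]; exact abs_half_lt_self this
  · rw [abs_mul, h2, one_mul]; exact abs_half_lt_self this
  · rw [← mul_assoc, ← abs_mul_abs_self, h1]; linarith
  · rw [← mul_assoc, ← abs_mul_abs_self, h2]; linarith

theorem IsChart.coloring_eq (h : D.IsChart s t ε) (hx : D.IsColoring x) {σ₁ σ₂ a b : ℝ}
    (h1 : |σ₁| = 1) (h2 : |σ₂| = 1) (ha : |a| < ε) (hb : |b| < ε) (ha0 : 0 < σ₁ * a)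
    (hb0 : 0 < σ₂ * b) : x (D.chart s t a b) = x (D.corner s t ε σ₁ σ₂) :=
  hx.eq_of_isPreconnected (convex_segment _ _).isPreconnected
    (h.segment_corner h1 h2 ha hb ha0 hb0) (left_mem_segment _ _ _) (right_mem_segment _ _ _)

variable (D) in
/-- The sum of the values of `x` at the four corners of a crossing. -/
noncomputable def cornerSum (s t ε : ℝ) (x : Plane → ZMod 2) : ZMod 2 :=
  (x (D.corner s t ε 1 1) + x (D.corner s t ε 1 (-1))) +
    (x (D.corner s t ε (-1) 1) + x (D.corner s t ε (-1) (-1)))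

theorem IsChart.cornerSum_swap (h : D.IsChart s t ε) :
    D.cornerSum t s ε x = D.cornerSum s t ε x := by
  simp only [cornerSum, corner, chart_comm h.eq]
  ring

/-- Along a half strand of a crossing, constancy is the agreement of the adjacent corners. -/
theorem IsChart.constNear_iff (h : D.IsChart s t ε) (hx : D.IsColoring x) {σ a : ℝ} (hσ : |σ| = 1)
    (ha : |a| < ε) (ha0 : 0 < σ * a) : D.ConstNear x (D.φ (s + a)) ↔
      x (D.corner s t ε σ 1) + x (D.corner s t ε σ (-1)) = 0 := by
  have hφ : D.φ (s + a) = D.chart s t a 0 := by rw [h.φ_left ha, chart, zero_smul, add_zero]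
  have hε := h.pos
  rw [hφ]
  constructor
  · rintro ⟨c, hc⟩
    have hcont : ContinuousAt (fun b : ℝ => D.chart s t a b) 0 := by
      unfold chart
      fun_prop
    have hev := hcont.eventually hc
    obtain ⟨r, hr, hB⟩ := Metric.eventually_nhds_iff.1 hev
    have hm : 0 < min r ε := lt_min hr hε
    have hm2 := abs_half_lt_self hm
    have key : ∀ σ₂ : ℝ, |σ₂| = 1 → x (D.corner s t ε σ σ₂) = c := by
      intro σ₂ h2
      have hb : |σ₂ * (min r ε / 2)| < min r ε := by rwa [abs_mul, h2, one_mul]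
      have hb0 : 0 < σ₂ * (σ₂ * (min r ε / 2)) := by
        rw [← mul_assoc, ← abs_mul_abs_self, h2]; linarith
      have hbε := hb.trans_le (min_le_right _ _)
      rw [← h.coloring_eq hx hσ h2 ha hbε ha0 hb0]
      refine hB ?_ (h.quadrant_not_mem ha hbε ha0 hb0)
      rw [Real.dist_eq, sub_zero]
      exact hb.trans_le (min_le_left _ _)
    rw [key 1 (by simp), key (-1) (by simp), zmod_two_add_self]
  · intro he
    have he' := zmod_two_eq_of_add he
    refine ⟨x (D.corner s t ε σ 1), ?_⟩
    have hP : ∀ᶠ z : ℝ × ℝ in 𝓝 (a, 0), (|z.1| < ε ∧ 0 < σ * z.1) ∧ |z.2| < ε := by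
      have c1 : ContinuousAt (fun z : ℝ × ℝ => |z.1|) (a, 0) := by fun_prop
      have c2 : ContinuousAt (fun z : ℝ × ℝ => σ * z.1) (a, 0) := by fun_prop
      have c3 : ContinuousAt (fun z : ℝ × ℝ => |z.2|) (a, 0) := by fun_prop
      exact ((c1.eventually_lt continuousAt_const (by simpa using ha)).and
        (continuousAt_const.eventually_lt c2 (by simpa using ha0))).and
        (c3.eventually_lt continuousAt_const (by simpa using hε))
    filter_upwards [chart_eventually h.det (P := fun u v => (|u| < ε ∧ 0 < σ * u) ∧ |v| < ε) hP]
      with q hq hqG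
    obtain ⟨a', b', ⟨⟨h1, h2⟩, h3⟩, rfl⟩ := hq
    rcases lt_trichotomy b' 0 with hb | hb | hb
    · rw [he']
      exact h.coloring_eq hx hσ (by simp) h1 h3 h2 (by linarith)
    · subst hb
      exact absurd ((h.mem_iff a' 0 h1 h3).2 (Or.inr rfl)) hqG
    · exact h.coloring_eq hx hσ (by simp) h1 h3 h2 (by linarith)

theorem isClosed_crossings : IsClosed D.crossings := D.finite_crossings.isClosed

/-- Constancy near the curve propagates through a crossing with vanishing corner sum. -/
theorem IsChart.constNear_forward (h : D.IsChart s t ε) (hx : D.IsColoring x)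
    (hsum : D.cornerSum s t ε x = 0) {a a' : ℝ} (ha0 : a < 0) (ha : -ε < a) (ha0' : 0 < a')
    (ha' : a' < ε) (hc : D.ConstNear x (D.φ (s + a))) : D.ConstNear x (D.φ (s + a')) := by
  rw [h.constNear_iff hx (σ := -1) (by simp) (by rw [abs_lt]; constructor <;> linarith [h.pos])
    (by linarith)] at hc
  rw [h.constNear_iff hx (σ := 1) (by simp) (by rw [abs_lt]; constructor <;> linarith [h.pos])
    (by linarith)]
  -- The corner sum is the jump across the half strand ahead plus the jump across the half strand
  -- behind.
  rwa [cornerSum, hc, add_zero] at hsum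

theorem IsChart.eventually_not_mem_crossings (h : D.IsChart s t ε) :
    ∀ᶠ a in 𝓝 (0 : ℝ), a ≠ 0 → D.φ (s + a) ∉ D.crossings := by
  have hcl : IsClosed (D.crossings \ {D.φ s}) :=
    (D.finite_crossings.subset sdiff_subset).isClosed
  have hcont : ContinuousAt (fun a : ℝ => D.φ (s + a)) 0 :=
    (D.φ_continuous.comp (by fun_prop : Continuous fun a : ℝ => s + a)).continuousAt
  have := hcont.eventually (p := fun q => q ∈ (D.crossings \ {D.φ s})ᶜ)
    (hcl.isOpen_compl.mem_nhds (by simp))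
  filter_upwards [this, Metric.ball_mem_nhds (0 : ℝ) h.pos] with a ha haB ha0 hm
  refine ha ⟨hm, ?_⟩
  rw [Metric.mem_ball, Real.dist_eq, sub_zero] at haB
  rw [Set.mem_singleton_iff, h.φ_left haB]
  intro he
  have : a • D.dir s = 0 := by simpa using he
  exact (smul_eq_zero.1 this).elim ha0 (D.dir_ne_zero s)

/-- A colouring without corner sums which is constant near one point of the curve is constant. -/
theorem eq_of_cornerSum_eq_zero (hx : D.IsColoring x) {a : ℝ} (ha : D.φ a ∉ D.crossings)
    (hca : D.ConstNear x (D.φ a))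
    (H : ∀ v ∈ D.crossings, ∃ s t ε, a < s ∧ s < t ∧ t < a + D.n ∧ D.φ s = v ∧
      D.IsChart s t ε ∧ D.cornerSum s t ε x = 0) :
    ∀ q q', q ∉ D.graph → q' ∉ D.graph → x q = x q' := by
  -- The hypothesis provides a chart based at the first passage of a crossing. If `T` is the second
  -- passage, the swapped chart is used.
  have H' : ∀ T, a ≤ T → T ≤ a + D.n → D.φ T ∈ D.crossings →
      a < T ∧ ∃ t ε, D.IsChart T t ε ∧ D.cornerSum T t ε x = 0 := by
    intro T h1 h2 hT
    obtain ⟨s, t, ε, has, hst, hta, hs, hch, hsum⟩ := H _ hT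
    have h2' : T < a + D.n := by
      refine lt_of_le_of_ne h2 ?_
      rintro rfl
      rw [D.φ_add_period] at hT
      exact ha hT
    have h1' : a < T := by
      refine lt_of_le_of_ne h1 ?_
      rintro rfl
      exact ha hT
    refine ⟨h1', ?_⟩
    rcases D.shift_of_triple hch.eq hch.not_shift hs.symm with ⟨k, hk⟩ | ⟨k, hk⟩
    · have := eq_of_period_shift hk h1 h2' has.le (by linarith)
      subst this
      exact ⟨t, ε, hch, hsum⟩
    · have := eq_of_period_shift hk h1 h2' (by linarith) hta
      subst this
      exact ⟨s, ε, hch.swap, by rw [hch.cornerSum_swap, hsum]⟩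
  have hφe : ∀ {P : Plane → Prop} {T : ℝ}, (∀ᶠ q in 𝓝 (D.φ T), P q) →
      ∃ δ > 0, ∀ σ, |σ - T| < δ → P (D.φ σ) := by
    intro P T h
    exact Metric.eventually_nhds_iff.1 (D.φ_continuous.continuousAt.eventually h)
  -- Continuous induction along one period: the infimum `T` of the bad times is excluded by
  -- propagation through a crossing if `φ T` is one, and by `ConstNear.of_left` otherwise.
  have good : ∀ σ, a ≤ σ → σ ≤ a + D.n → D.φ σ ∉ D.crossings → D.ConstNear x (D.φ σ) := by
    by_contra hc
    push Not at hc
    set Bad : Set ℝ := {σ | a ≤ σ ∧ σ ≤ a + D.n ∧ D.φ σ ∉ D.crossings ∧ ¬ D.ConstNear x (D.φ σ)}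
      with hBad
    have hne : Bad.Nonempty := by
      obtain ⟨σ, h1, h2, h3, h4⟩ := hc
      exact ⟨σ, h1, h2, h3, h4⟩
    have hbdd : BddBelow Bad := ⟨a, fun σ hσ => hσ.1⟩
    set T := sInf Bad with hT
    have haT : a ≤ T := le_csInf hne fun σ hσ => hσ.1
    have hTn : T ≤ a + D.n := by
      obtain ⟨σ, hσ⟩ := hne
      exact (csInf_le hbdd hσ).trans hσ.2.1
    have below : ∀ σ, a ≤ σ → σ < T → D.φ σ ∉ D.crossings → D.ConstNear x (D.φ σ) := by
      intro σ h1 h2 h3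
      by_contra h4
      exact absurd (csInf_le hbdd (show σ ∈ Bad from ⟨h1, by linarith, h3, h4⟩)) (not_le.2 h2)
    have above : ∀ δ > 0, ∃ σ ∈ Bad, T ≤ σ ∧ σ < T + δ := by
      intro δ hδ
      obtain ⟨σ, hσ, hlt⟩ := exists_lt_of_csInf_lt hne (show sInf Bad < T + δ by linarith)
      exact ⟨σ, hσ, csInf_le hbdd hσ, hlt⟩
    by_cases hcr : D.φ T ∈ D.crossings
    · obtain ⟨haT', t, ε, hch, hsum⟩ := H' T haT hTn hcr
      obtain ⟨r, hr, hB⟩ := Metric.eventually_nhds_iff.1 hch.eventually_not_mem_crossings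
      obtain ⟨σ, hσ, hTσ, hσε⟩ := above ε hch.pos
      have hTσ' : T < σ := by
        refine lt_of_le_of_ne hTσ ?_
        rintro h
        rw [← h] at hσ
        exact hσ.2.2.1 hcr
      set m := min r (min ε (T - a)) with hm
      have hm0 : 0 < m := lt_min hr (lt_min hch.pos (by linarith))
      have m1 : m ≤ r := min_le_left _ _
      have m2 : m ≤ ε := (min_le_right _ _).trans (min_le_left _ _)
      have m3 : m ≤ T - a := (min_le_right _ _).trans (min_le_right _ _)
      have hcl : D.ConstNear x (D.φ (T + -(m / 2))) := by
        refine below _ (by linarith) (by linarith) (hB ?_ (by linarith))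
        rw [Real.dist_eq, sub_zero, abs_neg]
        exact (abs_half_lt_self hm0).trans_le m1
      have := hch.constNear_forward hx hsum (a := -(m / 2)) (a' := σ - T) (by linarith)
        (by linarith) (by linarith) (by linarith) hcl
      rw [add_sub_cancel] at this
      exact hσ.2.2.2 this
    · have hcT : D.ConstNear x (D.φ T) := by
        rcases eq_or_lt_of_le haT with h | h
        · rwa [← h]
        · obtain ⟨δ, hδ, hB⟩ := hφe (isClosed_crossings.isOpen_compl.mem_nhds hcr)
          refine ConstNear.of_left hx hcr (lt_min hδ (show 0 < T - a by linarith)) ?_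
          intro σ h1 h2
          have h3 := min_le_left δ (T - a)
          have h4 := min_le_right δ (T - a)
          refine below σ (by linarith) h2 (hB σ ?_)
          rw [abs_lt]
          constructor <;> linarith
      obtain ⟨δ, hδ, hB⟩ := hφe hcT.eventually
      obtain ⟨σ, hσ, h1, h2⟩ := above δ hδ
      exact hσ.2.2.2 (hB σ (by rw [abs_lt]; constructor <;> linarith))
  -- The plane without finitely many points is connected, and the colouring is now constant near
  -- each of its points, including those on the curve.
  have hconn : IsPreconnected D.crossingsᶜ :=
    (D.finite_crossings.countable.isPathConnected_compl_of_one_lt_rank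
      (by simp [one_add_one_eq_two])).isConnected.2
  obtain ⟨c, hc⟩ := exists_const_of_constNear (x := x) (D := D) hconn (by
    intro q hq
    by_cases hqG : q ∈ D.graph
    · rw [graph_eq] at hqG
      obtain ⟨σ, rfl⟩ := hqG
      obtain ⟨τ, h1, h2, h3⟩ := exists_curve_eq D.vertex D.n_pos a σ
      have h3 : D.φ τ = D.φ σ := h3
      rw [← h3] at hq ⊢
      exact good τ h1 h2.le hq
    · exact hx.constNear hqG)
  have hsub : ∀ q, q ∉ D.graph → q ∈ D.crossingsᶜ := by
    rintro q hq ⟨y, _, _, rfl, _⟩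
    exact hq ⟨y, rfl⟩
  intro q q' hq hq'
  rw [hc q (hsub q hq) hq, hc q' (hsub q' hq') hq']

end Diagram

namespace Diagram

variable {D : Diagram}

/-! ### The parity of an arc of the diagram -/

theorem φ_combo {i : ℤ} {u u' α β : ℝ} (h1 : (i : ℝ) ≤ u) (h2 : u ≤ u') (h3 : u' ≤ i + 1)
    (hα : 0 ≤ α) (hβ : 0 ≤ β) (hαβ : α + β = 1) :
    D.φ (α * u + β * u') = α • D.φ u + β • D.φ u' := by
  have e : β = 1 - α := by linarith
  subst e
  have e1 : D.φ u = _ := curve_eq_of_mem D.vertex h1 (h2.trans h3)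
  have e2 : D.φ u' = _ := curve_eq_of_mem D.vertex (h1.trans h2) h3
  have e3 : D.φ (α * u + (1 - α) * u') = _ :=
    curve_eq_of_mem D.vertex (i := i) (by nlinarith) (by nlinarith)
  rw [e1, e2, e3]
  module

theorem exists_of_mem_segment_φ {i : ℤ} {u u' : ℝ} (h1 : (i : ℝ) ≤ u) (h2 : u ≤ u')
    (h3 : u' ≤ i + 1) {z : Plane} (hz : z ∈ segment ℝ (D.φ u) (D.φ u')) :
    ∃ σ, u ≤ σ ∧ σ ≤ u' ∧ D.φ σ = z := by
  obtain ⟨α, β, hα, hβ, hαβ, rfl⟩ := hz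
  refine ⟨α * u + β * u', ?_, ?_, φ_combo h1 h2 h3 hα hβ hαβ⟩
  · have e : β = 1 - α := by linarith
    subst e
    nlinarith
  · have e : β = 1 - α := by linarith
    subst e
    nlinarith

theorem φ_mem_openSegment {i : ℤ} {u u' τ : ℝ} (h1 : (i : ℝ) ≤ u) (h2 : u < τ) (h2' : τ < u')
    (h3 : u' ≤ i + 1) : D.φ τ ∈ openSegment ℝ (D.φ u) (D.φ u') := by
  have h : 0 < u' - u := by linarith
  refine ⟨(u' - τ) / (u' - u), (τ - u) / (u' - u), div_pos (by linarith) h,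
    div_pos (by linarith) h, ?_, ?_⟩
  · field_simp
    ring
  · rw [← φ_combo h1 (h2.trans h2').le h3 (div_nonneg (by linarith) h.le)
      (div_nonneg (by linarith) h.le)]
    · congr 1
      field_simp
      ring
    · field_simp
      ring

variable (D) in
/-- The break points of the arc from time `s` to time `t`. -/
noncomputable def arcTime (s t : ℝ) (j : ℕ) : ℝ := max s (min t (⌊s⌋ + j))

variable (D) in
/-- The vertices of the arc from time `s` to time `t`. -/
noncomputable def arcVertex (s t : ℝ) (j : ℕ) : Plane := D.φ (arcTime s t j)

/-- The number of edges of the arc from time `s` to time `t`. -/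
noncomputable def arcLength (s t : ℝ) : ℕ := (⌈t⌉ - ⌊s⌋).toNat

variable (D) in
/-- The ray-crossing parity of the arc from time `s` to time `t`. -/
noncomputable def arcParity (s t : ℝ) : Plane → ZMod 2 :=
  pathParity (arcLength s t) (D.arcVertex s t)

variable {s t : ℝ}

theorem arcTime_mem (hst : s ≤ t) (j : ℕ) : s ≤ arcTime s t j ∧ arcTime s t j ≤ t :=
  ⟨le_max_left _ _, max_le hst (min_le_left _ _)⟩

theorem arcTime_le_succ (j : ℕ) : arcTime s t j ≤ arcTime s t (j + 1) := by
  unfold arcTime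
  push_cast
  gcongr
  linarith

theorem lt_of_lt_arcLength {j : ℕ} (hj : j < arcLength s t) : (⌊s⌋ : ℝ) + j < t := by
  unfold arcLength at hj
  have h : (⌊s⌋ + j : ℤ) < ⌈t⌉ := by omega
  have := Int.lt_ceil.1 h
  push_cast at this
  exact this

/-- Each edge of the arc lies on one edge of the diagram, so the curve is affine along it. -/
theorem arcTime_bounds {j : ℕ} (hj : j < arcLength s t) :
    ((⌊s⌋ + j : ℤ) : ℝ) ≤ arcTime s t j ∧ arcTime s t (j + 1) ≤ ((⌊s⌋ + j : ℤ) : ℝ) + 1 := by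
  have h := lt_of_lt_arcLength hj
  have h1 := Int.lt_floor_add_one s
  have h2 : (0 : ℝ) ≤ j := Nat.cast_nonneg j
  unfold arcTime
  push_cast
  constructor
  · exact le_max_of_le_right (le_min h.le le_rfl)
  · refine max_le (by linarith) ((min_le_right _ _).trans (by linarith))

theorem arcVertex_zero (hst : s ≤ t) : D.arcVertex s t 0 = D.φ s := by
  have h := Int.floor_le s
  unfold arcVertex arcTime
  congr 1
  rw [Nat.cast_zero, add_zero, min_eq_right (h.trans hst), max_eq_left h]

theorem arcVertex_last (hst : s ≤ t) : D.arcVertex s t (arcLength s t) = D.φ t := by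
  have h := Int.le_ceil t
  have h' : ⌊s⌋ ≤ ⌈t⌉ := by
    have : (⌊s⌋ : ℝ) ≤ ⌈t⌉ := (Int.floor_le s).trans (hst.trans h)
    exact_mod_cast this
  have e : ((arcLength s t : ℕ) : ℝ) = ⌈t⌉ - ⌊s⌋ := by
    have : ((arcLength s t : ℕ) : ℤ) = ⌈t⌉ - ⌊s⌋ := by unfold arcLength; omega
    exact_mod_cast this
  unfold arcVertex arcTime
  congr 1
  rw [e, add_sub_cancel, min_eq_left h, max_eq_right hst]

theorem exists_of_mem_arcEdge {j : ℕ} (hj : j < arcLength s t) {z : Plane}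
    (hz : z ∈ segment ℝ (D.arcVertex s t j) (D.arcVertex s t (j + 1))) :
    ∃ σ, arcTime s t j ≤ σ ∧ σ ≤ arcTime s t (j + 1) ∧ D.φ σ = z :=
  exists_of_mem_segment_φ (arcTime_bounds hj).1 (arcTime_le_succ j) (arcTime_bounds hj).2 hz

theorem exists_of_mem_arc (hst : s ≤ t) {z : Plane}
    (hz : z ∈ pathTrace (arcLength s t) (D.arcVertex s t)) :
    ∃ σ, s ≤ σ ∧ σ ≤ t ∧ D.φ σ = z := by
  simp only [pathTrace, Set.mem_iUnion, Finset.mem_range] at hz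
  obtain ⟨j, hj, hz⟩ := hz
  obtain ⟨σ, h1, h2, h3⟩ := exists_of_mem_arcEdge hj hz
  exact ⟨σ, (arcTime_mem hst j).1.trans h1, h2.trans (arcTime_mem hst _).2, h3⟩

theorem arc_closed (hst : s ≤ t) (h : D.φ s = D.φ t) :
    D.arcVertex s t 0 = D.arcVertex s t (arcLength s t) := by
  rw [arcVertex_zero hst, arcVertex_last hst, h]

theorem arcParity_eventually_eq (hst : s ≤ t) (h : D.φ s = D.φ t) {q : Plane}
    (hq : ∀ σ, s ≤ σ → σ ≤ t → D.φ σ ≠ q) :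
    ∀ᶠ q' in 𝓝 q, D.arcParity s t q' = D.arcParity s t q := by
  refine pathParity_eventually_eq (arc_closed hst h) fun hm => ?_
  obtain ⟨σ, h1, h2, h3⟩ := exists_of_mem_arc hst hm
  exact hq σ h1 h2 h3

theorem isColoring_arcParity (hst : s ≤ t) (h : D.φ s = D.φ t) :
    D.IsColoring (D.arcParity s t) := by
  intro q hq
  refine arcParity_eventually_eq hst h ?_
  rintro σ _ _ rfl
  exact hq (D.φ_mem_graph σ)

/-- This is `pathParity_jump` expressed in times: `τ` is interior to the arc edge with index `⌊τ⌋ -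
⌊s⌋`, and uniqueness of `τ` keeps the other arc edges away from `φ τ`. -/
theorem arcParity_jump (hst : s ≤ t) (h : D.φ s = D.φ t) {τ : ℝ} (hsτ : s < τ) (hτt : τ < t)
    (hτ : (⌊τ⌋ : ℝ) < τ) (huniq : ∀ σ, s ≤ σ → σ ≤ t → D.φ σ = D.φ τ → σ = τ) {e : Plane}
    (he : planeDet (D.dir τ) e ≠ 0) : ∀ᶠ η in 𝓝[>] (0 : ℝ),
      D.arcParity s t (D.φ τ + η • e) + D.arcParity s t (D.φ τ - η • e) = 1 := by
  have hfl : ⌊s⌋ ≤ ⌊τ⌋ := Int.floor_mono hsτ.le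
  set k := (⌊τ⌋ - ⌊s⌋).toNat with hk
  have hkz : (k : ℤ) = ⌊τ⌋ - ⌊s⌋ := by omega
  have hkr : (⌊s⌋ : ℝ) + k = ⌊τ⌋ := by
    have : (⌊s⌋ : ℤ) + k = ⌊τ⌋ := by omega
    exact_mod_cast this
  have hlt1 := Int.lt_floor_add_one τ
  have hkN : k < arcLength s t := by
    have : ⌊τ⌋ < ⌈t⌉ := Int.lt_ceil.2 (by linarith)
    unfold arcLength
    omega
  have hc1 : arcTime s t k < τ := by
    unfold arcTime
    rw [hkr]
    exact max_lt hsτ ((min_le_right _ _).trans_lt hτ)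
  have hc2 : τ < arcTime s t (k + 1) := by
    unfold arcTime
    push_cast
    rw [← add_assoc, hkr]
    exact lt_max_of_lt_right (lt_min hτt hlt1)
  have hb := arcTime_bounds hkN
  refine pathParity_jump (arc_closed hst h) hkN (φ_mem_openSegment hb.1 hc1 hc2 hb.2) ?_ ?_
  · intro i hi hik hm
    obtain ⟨σ, h1, h2, h3⟩ := exists_of_mem_arcEdge hi hm
    have := huniq σ ((arcTime_mem hst i).1.trans h1) (h2.trans (arcTime_mem hst _).2) h3
    subst this
    have hbi := arcTime_bounds hi
    -- The passing time is not an integer, so it cannot be the common end of two consecutive arc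
    -- edges.
    have hne : σ ≠ ((⌊s⌋ + i : ℤ) : ℝ) + 1 := by
      intro hσ
      have : ⌊σ⌋ = ⌊s⌋ + i + 1 := by
        rw [hσ, Int.floor_add_one, Int.floor_intCast]
      rw [this, hσ] at hτ
      push_cast at hτ
      linarith
    have : ⌊σ⌋ = ⌊s⌋ + i := Int.floor_eq_iff.2 ⟨hbi.1.trans h1,
      lt_of_le_of_ne (h2.trans hbi.2) hne⟩
    omega
  -- The arc edge is a positive multiple of `dir τ`, so both have the same transversal vectors.
  · have e1 : D.arcVertex s t (k + 1) = _ := curve_eq_of_mem D.vertex (i := ⌊s⌋ + k)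
      (hb.1.trans (arcTime_le_succ k)) hb.2
    have e2 : D.arcVertex s t k = _ := curve_eq_of_mem D.vertex (i := ⌊s⌋ + k)
      hb.1 ((arcTime_le_succ k).trans hb.2)
    have e3 : D.arcVertex s t (k + 1) - D.arcVertex s t k =
        (arcTime s t (k + 1) - arcTime s t k) • D.dir τ := by
      rw [e1, e2, dir, PLKnot.dir]
      have : (⌊s⌋ + k : ℤ) = ⌊τ⌋ := by omega
      rw [this]
      module
    rw [e3]
    have e4 : planeDet ((arcTime s t (k + 1) - arcTime s t k) • D.dir τ) e =
        (arcTime s t (k + 1) - arcTime s t k) * planeDet (D.dir τ) e := by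
      simp only [planeDet, Prod.smul_fst, Prod.smul_snd, smul_eq_mul]
      ring
    rw [e4]
    exact mul_ne_zero (by linarith) he

/-! ### Corner jumps of arc parities -/

section CornerJump

variable {s' t' ε a₀ σ : ℝ}

theorem IsChart.exists_small (h : D.IsChart s' t' ε) (h1 : a₀ < s') (h2 : s' < a₀ + D.n)
    (hσ : |σ| = 1) {P : ℝ → Prop} (hP : ∀ᶠ a in 𝓝[>] (0 : ℝ), P (s' + σ * a)) :
    ∃ a, |a| < ε ∧ 0 < σ * a ∧ P (s' + a) ∧ D.φ (s' + a) ∉ D.crossings ∧ a₀ < s' + a ∧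
      s' + a < a₀ + D.n := by
  have hcont : ContinuousAt (fun a : ℝ => σ * a) 0 := by fun_prop
  have e1 : ∀ᶠ a in 𝓝[>] (0 : ℝ), σ * a ≠ 0 → D.φ (s' + σ * a) ∉ D.crossings :=
    (hcont.eventually (p := fun a => a ≠ 0 → D.φ (s' + a) ∉ D.crossings)
      (by simpa using h.eventually_not_mem_crossings)).filter_mono nhdsWithin_le_nhds
  have e2 : ∀ᶠ a in 𝓝[>] (0 : ℝ), a < min ε (min (s' - a₀) (a₀ + D.n - s')) :=
    (gt_mem_nhds (lt_min h.pos (lt_min (by linarith) (by linarith)))).filter_mono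
      nhdsWithin_le_nhds
  obtain ⟨a, hPa, ha1, ha2, ha0⟩ := (hP.and (e1.and (e2.and self_mem_nhdsWithin))).exists
  have ha0 : 0 < a := ha0
  have hm : |σ * a| = a := by rw [abs_mul, hσ, one_mul, abs_of_pos ha0]
  have hlt := abs_le.1 (le_of_eq hm)
  rw [lt_min_iff, lt_min_iff] at ha2
  have hpos : 0 < σ * (σ * a) := by
    rw [← mul_assoc, ← abs_mul_abs_self, hσ]; linarith
  refine ⟨σ * a, by linarith [ha2.1], hpos, hPa, ha1 ?_, by linarith, by linarith⟩
  intro h0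
  rw [h0, mul_zero] at hpos
  exact lt_irrefl _ hpos

theorem dir_eq_of_chart (h : D.IsChart s' t' ε) {a : ℝ} (ha : |a| < ε) :
    D.dir (s' + a) = D.dir s' ∧ (⌊s' + a⌋ : ℝ) < s' + a := by
  have h1 := h.left a ha
  have : ⌊s' + a⌋ = ⌊s'⌋ := Int.floor_eq_iff.2 ⟨h1.1.le, h1.2⟩
  exact ⟨by rw [dir, dir, PLKnot.dir, this]; rfl, by rw [this]; exact h1.1⟩

/-- The half strand in direction `σ` belongs to the arc. A nearby non-crossing point of it is passed
once by the arc, so the two corners beside it have different parities. -/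
theorem IsChart.jump_one (h : D.IsChart s' t' ε) (h1 : a₀ < s') (h2 : s' < a₀ + D.n)
    (hσ : |σ| = 1) (has : a₀ ≤ s) (hst : s ≤ t) (hta : t ≤ a₀ + D.n) (hc : D.φ s = D.φ t)
    (hin : ∀ᶠ a in 𝓝[>] (0 : ℝ), s < s' + σ * a ∧ s' + σ * a < t) :
    D.arcParity s t (D.corner s' t' ε σ 1) + D.arcParity s t (D.corner s' t' ε σ (-1)) = 1 := by
  obtain ⟨a, ha, ha0, hP, hcr, hb1, hb2⟩ :=
    h.exists_small h1 h2 hσ (P := fun τ => s < τ ∧ τ < t) hin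
  obtain ⟨hdir, hfl⟩ := dir_eq_of_chart h ha
  have huniq : ∀ τ, s ≤ τ → τ ≤ t → D.φ τ = D.φ (s' + a) → τ = s' + a := by
    intro τ hτ1 hτ2 hτ
    obtain ⟨k, hk⟩ := D.exists_shift_of_not_mem hcr hτ
    -- If the arc is the full period, its closing time `a₀ + n` must be ruled out separately: it
    -- would make `s' + a` a translate of `a₀`, although it lies strictly inside the period.
    rcases eq_or_lt_of_le (hτ2.trans hta) with he | hlt
    · exfalso
      have := eq_of_period_shift (n := D.n) (a := a₀) (σ := a₀) (τ := s' + a) (k := k - 1)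
        (by push_cast; linarith) le_rfl (by
          have : (0 : ℝ) < D.n := Nat.cast_pos.2 D.n_pos
          linarith) hb1.le hb2
      linarith
    · exact eq_of_period_shift hk (has.trans hτ1) hlt hb1.le hb2
  have hj := arcParity_jump hst hc hP.1 hP.2 hfl huniq (e := D.dir t') (by rw [hdir]; exact h.det)
  have hε := h.pos
  have e2 : ∀ᶠ η in 𝓝[>] (0 : ℝ), η < ε :=
    (gt_mem_nhds hε).filter_mono nhdsWithin_le_nhds
  obtain ⟨η, hη, hηε, hη0⟩ := (hj.and (e2.and self_mem_nhdsWithin)).exists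
  have hη0 : 0 < η := hη0
  have hcol := isColoring_arcParity hst hc
  have c1 : D.φ (s' + a) + η • D.dir t' = D.chart s' t' a η := by rw [h.φ_left ha, chart]
  have c2 : D.φ (s' + a) - η • D.dir t' = D.chart s' t' a (-η) := by
    rw [h.φ_left ha, chart, neg_smul, sub_eq_add_neg]
  rw [c1, c2, h.coloring_eq hcol hσ (σ₂ := 1) (by simp) ha (by rwa [abs_of_pos hη0]) ha0
    (by linarith), h.coloring_eq hcol hσ (σ₂ := -1) (by simp) ha
    (by rwa [abs_neg, abs_of_pos hη0]) ha0 (by linarith)] at hη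
  exact hη

/-- The half strand lies outside the arc, so the parity is locally constant at a nearby non-crossing
point of it. Here `t` must stay strictly below `a₀ + n`, or the closing point could reappear at the
base time. -/
theorem IsChart.jump_zero (h : D.IsChart s' t' ε) (h1 : a₀ < s') (h2 : s' < a₀ + D.n)
    (hσ : |σ| = 1) (has : a₀ ≤ s) (hst : s ≤ t) (hta : t < a₀ + D.n) (hc : D.φ s = D.φ t)
    (hout : ∀ᶠ a in 𝓝[>] (0 : ℝ), s' + σ * a < s ∨ t < s' + σ * a) :
    D.arcParity s t (D.corner s' t' ε σ 1) + D.arcParity s t (D.corner s' t' ε σ (-1)) = 0 := by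
  obtain ⟨a, ha, ha0, hP, hcr, hb1, hb2⟩ :=
    h.exists_small h1 h2 hσ (P := fun τ => τ < s ∨ t < τ) hout
  have hcol := isColoring_arcParity hst hc
  rw [← h.constNear_iff hcol hσ ha ha0]
  refine ⟨D.arcParity s t (D.φ (s' + a)),
    (arcParity_eventually_eq hst hc ?_).mono fun _ hq _ => hq⟩
  intro τ hτ1 hτ2 hτ
  obtain ⟨k, hk⟩ := D.exists_shift_of_not_mem hcr hτ
  have := eq_of_period_shift hk (has.trans hτ1) (hτ2.trans_lt hta) hb1.le hb2
  rcases hP with hP | hP <;> linarith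

theorem eventually_lt_add {u v : ℝ} (h : u < v) : ∀ᶠ a in 𝓝[>] (0 : ℝ), u < v + σ * a := by
  have hc : ContinuousAt (fun a : ℝ => v + σ * a) 0 := by fun_prop
  exact (continuousAt_const.eventually_lt hc (by simpa using h)).filter_mono nhdsWithin_le_nhds

theorem eventually_add_lt {u v : ℝ} (h : u < v) : ∀ᶠ a in 𝓝[>] (0 : ℝ), u + σ * a < v := by
  have hc : ContinuousAt (fun a : ℝ => u + σ * a) 0 := by fun_prop
  exact (hc.eventually_lt continuousAt_const (by simpa using h)).filter_mono nhdsWithin_le_nhds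

theorem eventually_lt_add_pos (u : ℝ) : ∀ᶠ a in 𝓝[>] (0 : ℝ), u < u + 1 * a := by
  filter_upwards [self_mem_nhdsWithin] with a ha
  have ha : 0 < a := ha
  linarith

theorem eventually_add_neg_lt (u : ℝ) : ∀ᶠ a in 𝓝[>] (0 : ℝ), u + (-1) * a < u := by
  filter_upwards [self_mem_nhdsWithin] with a ha
  have ha : 0 < a := ha
  linarith

/-- The loop parity at a crossing has corner sum zero at every other crossing. -/
theorem IsChart.cornerSum_arc_of_ne (h : D.IsChart s' t' ε) (h1 : a₀ < s') (h2 : s' < a₀ + D.n)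
    (has : a₀ ≤ s) (hst : s ≤ t) (hta : t < a₀ + D.n) (hc : D.φ s = D.φ t)
    (hne : D.φ s' ≠ D.φ s) : D.cornerSum s' t' ε (D.arcParity s t) = 0 := by
  have hs : s' ≠ s := fun e => hne (by rw [e])
  have ht : s' ≠ t := fun e => hne (by rw [e, hc])
  unfold cornerSum
  -- The strand through `s'` runs inside the arc on both halves or on neither, so the two jumps are
  -- equal and cancel.
  by_cases hin : s < s' ∧ s' < t
  · rw [h.jump_one h1 h2 (by simp) has hst hta.le hc
      ((eventually_lt_add hin.1).and (eventually_add_lt hin.2)),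
      h.jump_one h1 h2 (by simp) has hst hta.le hc
      ((eventually_lt_add hin.1).and (eventually_add_lt hin.2))]
    decide
  · have hout : s' < s ∨ t < s' := by
      by_contra hcon
      push Not at hcon
      exact hin ⟨lt_of_le_of_ne hcon.1 hs.symm, lt_of_le_of_ne hcon.2 ht⟩
    have hev : ∀ σ : ℝ, ∀ᶠ a in 𝓝[>] (0 : ℝ), s' + σ * a < s ∨ t < s' + σ * a := by
      intro σ
      rcases hout with ho | ho
      · exact (eventually_add_lt ho).mono fun _ => Or.inl
      · exact (eventually_lt_add ho).mono fun _ => Or.inr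
    rw [h.jump_zero h1 h2 (by simp) has hst hta hc (hev _),
      h.jump_zero h1 h2 (by simp) has hst hta hc (hev _), add_zero]

variable (h : D.IsChart s t ε) (h1 : a₀ < s) (hst : s < t) (h2 : t < a₀ + D.n)
include h h1 hst h2

/-- The corner values of the loop parity at a crossing. -/
theorem IsChart.arcParity_corners :
    D.arcParity s t (D.corner s t ε 1 (-1)) ≠ D.arcParity s t (D.corner s t ε 1 1) ∧
    D.arcParity s t (D.corner s t ε (-1) 1) = D.arcParity s t (D.corner s t ε 1 1) ∧
    D.cornerSum s t ε (D.arcParity s t) = 1 := by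
  -- The loop leaves along the strand of `s` after time `s` and returns along the strand of `t`
  -- before time `t`. Only the corner between these two half strands has a value of its own.
  have e1 := h.jump_one (σ := 1) h1 (hst.trans h2) (by simp) h1.le hst.le h2.le h.eq
    ((eventually_lt_add_pos s).and (eventually_add_lt hst))
  have e2 := h.jump_zero (σ := -1) h1 (hst.trans h2) (by simp) h1.le hst.le h2 h.eq
    ((eventually_add_neg_lt s).mono fun _ => Or.inl)
  have e3 := h.swap.jump_zero (σ := 1) (h1.trans hst) h2 (by simp) h1.le hst.le h2 h.eq
    ((eventually_lt_add_pos t).mono fun _ => Or.inr)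
  simp only [corner, chart_comm h.eq.symm] at e3
  refine ⟨?_, (zmod_two_eq_of_add e3).symm, ?_⟩
  · intro e
    rw [e, zmod_two_add_self] at e1
    exact zero_ne_one e1
  · rw [cornerSum, e1, e2, add_zero]

/-- The checkerboard colouring takes different values at adjacent corners. -/
theorem IsChart.checkerboard_corners :
    D.arcParity a₀ (a₀ + D.n) (D.corner s t ε 1 (-1)) ≠
      D.arcParity a₀ (a₀ + D.n) (D.corner s t ε 1 1) ∧
    D.arcParity a₀ (a₀ + D.n) (D.corner s t ε (-1) 1) ≠
      D.arcParity a₀ (a₀ + D.n) (D.corner s t ε 1 1) ∧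
    D.arcParity a₀ (a₀ + D.n) (D.corner s t ε (-1) (-1)) =
      D.arcParity a₀ (a₀ + D.n) (D.corner s t ε 1 1) := by
  have hc : D.φ a₀ = D.φ (a₀ + D.n) := (D.φ_add_period a₀).symm
  -- Every half strand lies on the full period, so crossing any of them changes the value.
  have key : ∀ {s t : ℝ} (_ : D.IsChart s t ε) (_ : a₀ < s) (_ : s < a₀ + D.n) {σ : ℝ}
      (_ : |σ| = 1), D.arcParity a₀ (a₀ + D.n) (D.corner s t ε σ 1) +
        D.arcParity a₀ (a₀ + D.n) (D.corner s t ε σ (-1)) = 1 := by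
    intro s t h h1 h2 σ hσ
    exact h.jump_one h1 h2 hσ le_rfl (h1.trans h2).le le_rfl hc
      ((eventually_lt_add h1).and (eventually_add_lt h2))
  have e1 := key h h1 (hst.trans h2) (σ := 1) (by simp)
  have e2 := key h h1 (hst.trans h2) (σ := -1) (by simp)
  have e3 := key h.swap (h1.trans hst) h2 (σ := 1) (by simp)
  simp only [corner, chart_comm h.eq.symm] at e3
  have aux : ∀ A B : ZMod 2, A + B = 1 → B ≠ A := by decide
  have aux' : ∀ A B C : ZMod 2, A + B = 1 → B + C = 1 → C = A := by decide
  exact ⟨aux _ _ e1, aux _ _ e3, aux' _ _ _ e3 e2⟩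

end CornerJump

end Diagram

/-! ### Polygonal paths in open connected sets -/

/-- Balls are convex, so reachability by polygonal paths inside `U` is a locally constant property
of the end point. -/
theorem exists_polygonalPath {U : Set Plane} (hU : IsOpen U) (hc : IsPreconnected U) {a b : Plane}
    (ha : a ∈ U) (hb : b ∈ U) : ∃ (N : ℕ) (Q : ℕ → Plane), Q 0 = a ∧ Q N = b ∧
      ∀ i < N, segment ℝ (Q i) (Q (i + 1)) ⊆ U := by
  let f : Plane → Prop := fun b => ∃ (N : ℕ) (Q : ℕ → Plane), Q 0 = a ∧ Q N = b ∧
      ∀ i < N, segment ℝ (Q i) (Q (i + 1)) ⊆ U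
  have step : ∀ y z, f y → segment ℝ y z ⊆ U → f z := by
    rintro y z ⟨N, Q, h0, hN, h⟩ hyz
    refine ⟨N + 1, fun i => if i ≤ N then Q i else z, by simp [h0], by simp, fun i hi => ?_⟩
    rcases Nat.lt_succ_iff_lt_or_eq.1 hi with hi | rfl
    · simp only [if_pos hi.le, if_pos (Nat.succ_le_of_lt hi)]
      exact h i hi
    · simpa [hN] using hyz
  have hloc : ∀ y ∈ U, ∀ᶠ z in 𝓝 y, f z = f y := by
    intro y hy
    obtain ⟨r, hr, hB⟩ := Metric.isOpen_iff.1 hU y hy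
    filter_upwards [Metric.ball_mem_nhds y hr] with z hz
    have hs := ((convex_ball y r).segment_subset hz (Metric.mem_ball_self hr)).trans hB
    exact propext ⟨fun h => step _ _ h hs, fun h => step _ _ h (by rwa [segment_symm])⟩
  have hfa : f a := ⟨0, fun _ => a, rfl, rfl, fun i hi => absurd hi (Nat.not_lt_zero i)⟩
  have : f a = f b := eq_of_eventually_eq hc hloc ha hb
  exact this.mp hfa

/-! ### Regions and nugatory crossings -/

namespace Diagram

variable {D : Diagram}

variable (D) in
/-- The region containing a point off the diagram. -/
def comp (q : Plane) : Set Plane := connectedComponentIn D.graphᶜ q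

theorem isOpen_comp (q : Plane) : IsOpen (D.comp q) :=
  D.isClosed_graph.isOpen_compl.connectedComponentIn

theorem comp_subset (q : Plane) : D.comp q ⊆ D.graphᶜ := connectedComponentIn_subset _ _

theorem mem_comp_self {q : Plane} (hq : q ∉ D.graph) : q ∈ D.comp q := mem_connectedComponentIn hq

/-- At a nugatory crossing the two loops are disjoint. -/
theorem IsChart.loops_disjoint {s t ε : ℝ} (h : D.IsChart s t ε) (hst : s < t) (htn : t < s + D.n)
    (hnug : D.comp (D.corner s t ε 1 1) = D.comp (D.corner s t ε (-1) (-1))) {σ τ : ℝ}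
    (hσ1 : s < σ) (hσ2 : σ < t) (hτ1 : t < τ) (hτ2 : τ < s + D.n) : D.φ σ ≠ D.φ τ := by
  have hε := h.pos
  have hc1 := h.corner_not_mem (σ₁ := 1) (σ₂ := 1) (by simp) (by simp)
  have hc2 := h.corner_not_mem (σ₁ := -1) (σ₂ := -1) (by simp) (by simp)
  obtain ⟨N, Q, hQ0, hQN, hQ⟩ := exists_polygonalPath (D.isOpen_comp (D.corner s t ε 1 1))
    isPreconnected_connectedComponentIn (mem_comp_self hc1)
    (show D.corner s t ε (-1) (-1) ∈ _ by rw [hnug]; exact mem_comp_self hc2)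
  -- A path inside the common region joins the two opposite corners. Closing it by the diagonal
  -- through the crossing gives a polygon meeting the diagram in that crossing only.
  set γ : ℕ → Plane := fun i => if i ≤ N then Q i else Q 0 with hγ
  have hγN : γ N = D.corner s t ε (-1) (-1) := by simp [hγ, hQN]
  have hγN1 : γ (N + 1) = D.corner s t ε 1 1 := by simp [hγ, hQ0]
  have hγc : γ 0 = γ (N + 1) := by rw [hγN1]; simp [hγ, hQ0]
  have hγi : ∀ i < N, segment ℝ (γ i) (γ (i + 1)) ⊆ D.graphᶜ := by
    intro i hi
    simp only [hγ, if_pos hi.le, if_pos (Nat.succ_le_of_lt hi)]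
    exact (hQ i hi).trans (comp_subset _)
  have hmid : D.φ s ∈ openSegment ℝ (γ N) (γ (N + 1)) := by
    rw [hγN, hγN1]
    refine ⟨1 / 2, 1 / 2, by norm_num, by norm_num, by norm_num, ?_⟩
    simp only [corner, chart]
    module
  have hγG : ∀ q ∈ pathTrace (N + 1) γ, q ∈ D.graph → q = D.φ s := by
    intro q hq hqG
    simp only [pathTrace, Set.mem_iUnion, Finset.mem_range] at hq
    obtain ⟨i, hi, hq⟩ := hq
    rcases Nat.lt_succ_iff_lt_or_eq.1 hi with hi | rfl
    · exact absurd hqG (hγi i hi hq)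
    · rw [hγN, hγN1] at hq
      obtain ⟨u, v, hu, hv, huv, rfl⟩ := hq
      have e : u • D.corner s t ε (-1) (-1) + v • D.corner s t ε 1 1 =
          D.chart s t ((v - u) * (ε / 2)) ((v - u) * (ε / 2)) := by
        have : u = 1 - v := by linarith
        subst this
        simp only [corner, chart]
        module
      have hlt : |(v - u) * (ε / 2)| < ε := by
        rw [abs_lt]
        constructor <;> nlinarith
      rw [e] at hqG ⊢
      have := (h.mem_iff _ _ hlt hlt).1 hqG
      rw [or_self] at this
      rw [this, chart, zero_smul, zero_smul, add_zero, add_zero]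
  have hfib : ∀ τ, D.φ τ = D.φ s → (∃ k : ℤ, τ = s + k * D.n) ∨ ∃ k : ℤ, τ = t + k * D.n :=
    fun τ hτ => D.shift_of_triple h.eq h.not_shift hτ
  -- Each open loop is connected and misses `γ`, so the parity of `γ` is constant along it.
  have hpar : ∀ u v : ℝ, s ≤ u → v ≤ s + D.n → (v ≤ t ∨ t ≤ u) → ∀ σ τ, u < σ → σ < v → u < τ →
      τ < v → pathParity (N + 1) γ (D.φ σ) = pathParity (N + 1) γ (D.φ τ) := by
    intro u v hu hv huv σ τ h1 h2 h3 h4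
    refine pathParity_eq_of_isPreconnected hγc (S := D.φ '' Ioo u v)
      (isPreconnected_Ioo.image _ D.φ_continuous.continuousOn) ?_ ⟨σ, ⟨h1, h2⟩, rfl⟩
      ⟨τ, ⟨h3, h4⟩, rfl⟩
    rw [Set.disjoint_left]
    rintro _ hq ⟨ρ, ⟨hρ1, hρ2⟩, rfl⟩
    rcases hfib ρ (hγG _ hq (D.φ_mem_graph ρ)) with ⟨k, hk⟩ | ⟨k, hk⟩
    · have := eq_of_period_shift hk (hu.trans hρ1.le) (by linarith) le_rfl (by linarith)
      linarith
    · have := eq_of_period_shift hk (hu.trans hρ1.le) (by linarith) hst.le htn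
      rcases huv with h' | h' <;> linarith
  -- The two half strands of `s` leave the crossing on opposite sides of the diagonal and belong to
  -- different loops, so the loops have different parities.
  have hj := pathParity_jump hγc (Nat.lt_succ_self N) hmid (by
      intro i hi hiN hm
      exact hγi i (by omega) hm (D.φ_mem_graph s)) (e := D.dir s) (by
      rw [hγN, hγN1]
      have : planeDet (D.corner s t ε 1 1 - D.corner s t ε (-1) (-1)) (D.dir s) =
          -ε * planeDet (D.dir s) (D.dir t) := by
        simp only [corner, chart, planeDet, Prod.fst_sub, Prod.snd_sub, Prod.fst_add,
          Prod.snd_add, Prod.smul_fst, Prod.smul_snd, smul_eq_mul]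
        ring
      rw [this]
      exact mul_ne_zero (by linarith) h.det)
  have e2 : ∀ᶠ η in 𝓝[>] (0 : ℝ), η < min ε (min (t - s) (s + D.n - t)) :=
    (gt_mem_nhds (lt_min hε (lt_min (by linarith) (by linarith)))).filter_mono nhdsWithin_le_nhds
  obtain ⟨η, hη, hηε, hη0⟩ := (hj.and (e2.and self_mem_nhdsWithin)).exists
  have hη0 : 0 < η := hη0
  rw [lt_min_iff, lt_min_iff] at hηε
  have p1 : D.φ s + η • D.dir s = D.φ (s + η) :=
    (h.φ_left (by rw [abs_of_pos hη0]; exact hηε.1)).symm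
  have p2 : D.φ s - η • D.dir s = D.φ (s + D.n + -η) := by
    have := h.φ_left (a := -η) (by rw [abs_neg, abs_of_pos hη0]; exact hηε.1)
    rw [neg_smul, ← sub_eq_add_neg (D.φ s)] at this
    rw [← this, ← D.φ_add_period]
    congr 1
    ring
  rw [p1, p2, hpar s t le_rfl (by linarith) (Or.inl le_rfl) (s + η) σ (by linarith)
    (by linarith) hσ1 hσ2, hpar t (s + D.n) hst.le le_rfl (Or.inr le_rfl) (s + D.n + -η) τ
    (by linarith) (by linarith) hτ1 hτ2] at hη
  intro he
  rw [he, zmod_two_add_self] at hη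
  exact zero_ne_one hη

/-- At a nugatory crossing the parity of one loop is constant along the other one. -/
theorem IsChart.arcParity_const {s t ε : ℝ} (h : D.IsChart s t ε) (hst : s < t)
    (htn : t < s + D.n)
    (hnug : D.comp (D.corner s t ε 1 1) = D.comp (D.corner s t ε (-1) (-1))) :
    (∀ τ, t < τ → τ < s + D.n → ∀ᶠ q in 𝓝 (D.φ τ), D.arcParity s t q = D.arcParity s t (D.φ τ)) ∧
    ∀ τ τ', t < τ → τ < s + D.n → t < τ' → τ' < s + D.n →
      D.arcParity s t (D.φ τ) = D.arcParity s t (D.φ τ') := by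
  have hloc : ∀ τ, t < τ → τ < s + D.n →
      ∀ᶠ q in 𝓝 (D.φ τ), D.arcParity s t q = D.arcParity s t (D.φ τ) := by
    intro τ h1 h2
    refine arcParity_eventually_eq hst.le h.eq ?_
    intro σ hσ1 hσ2 he
    have aux : D.φ τ ≠ D.φ s := by
      intro h'
      rcases D.shift_of_triple h.eq h.not_shift h' with ⟨k, hk⟩ | ⟨k, hk⟩
      · have := eq_of_period_shift hk (hst.trans h1).le h2 le_rfl (by linarith)
        linarith
      · have := eq_of_period_shift hk (hst.trans h1).le h2 hst.le htn
        linarith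
    rcases eq_or_lt_of_le hσ1 with rfl | hσ1
    · exact aux he.symm
    rcases eq_or_lt_of_le hσ2 with rfl | hσ2
    · exact aux (he.symm.trans h.eq.symm)
    · exact h.loops_disjoint hst htn hnug hσ1 hσ2 h1 h2 he
  refine ⟨hloc, fun τ τ' h1 h2 h3 h4 => ?_⟩
  refine eq_of_eventually_eq (S := D.φ '' Ioo t (s + D.n))
    (isPreconnected_Ioo.image _ D.φ_continuous.continuousOn) ?_ ⟨τ, ⟨h1, h2⟩, rfl⟩
    ⟨τ', ⟨h3, h4⟩, rfl⟩
  rintro _ ⟨ρ, ⟨hρ1, hρ2⟩, rfl⟩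
  exact hloc ρ hρ1 hρ2

end Diagram

namespace Diagram

variable {D : Diagram}

/-! ### Base points -/

variable (D) in
/-- A time together with the radius of a disc which the diagram divides into two halves. -/
structure IsBase (a r : ℝ) : Prop where
  pos : 0 < r
  mem_iff : ∀ q ∈ Metric.ball (D.φ a) r, q ∈ D.graph ↔ planeDet (D.dir a) (q - D.φ a) = 0

/-- Near a point that is neither a crossing nor a vertex, all passing times are close to translates
of `a`, so the graph is a single straight line there. -/
theorem exists_isBase {a : ℝ} (ha : D.φ a ∉ D.crossings) (hfl : (⌊a⌋ : ℝ) < a) :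
    ∃ r, D.IsBase a r := by
  obtain ⟨δ, hδ, h⟩ := exists_unit_radius hfl
  obtain ⟨r₀, hr₀, hB⟩ := Metric.eventually_nhds_iff.1
    (curve_near_fiber D.vertex D.n_pos (D.φ a) hδ)
  have hd := D.dir_ne_zero a
  have hnd : 0 < ‖D.dir a‖ := norm_pos_iff.2 hd
  have hφ : ∀ b, |b| < δ → D.φ (a + b) = D.φ a + b • D.dir a := fun b hb =>
    curve_add_of_le _ (h b hb).1.le (h b hb).2.le
  refine ⟨min r₀ (δ * ‖D.dir a‖), lt_min hr₀ (by positivity), fun q hq => ⟨?_, ?_⟩⟩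
  · rw [graph_eq]
    rintro ⟨σ, rfl⟩
    obtain ⟨τ, hτ, hστ⟩ := hB (lt_of_lt_of_le (Metric.mem_ball.1 hq) (min_le_left _ _)) σ rfl
    obtain ⟨k, rfl⟩ := D.exists_shift_of_not_mem ha hτ
    have e : D.φ σ = D.φ (a + (σ - (a + k * D.n))) := by
      rw [← D.φ_add (a + _) k]
      congr 1
      ring
    rw [e, hφ _ hστ]
    simp only [planeDet, add_sub_cancel_left, Prod.smul_fst, Prod.smul_snd, smul_eq_mul]
    ring
  · intro hdet
    obtain ⟨b, hb⟩ : ∃ b : ℝ, q - D.φ a = b • D.dir a := by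
      unfold planeDet at hdet
      by_cases h1 : (D.dir a).1 = 0
      · have h2 : (D.dir a).2 ≠ 0 := fun h2 => hd (Prod.ext h1 h2)
        refine ⟨(q - D.φ a).2 / (D.dir a).2, Prod.ext ?_ ?_⟩
        · rw [h1, zero_mul, zero_sub, neg_eq_zero] at hdet
          rw [(mul_eq_zero.1 hdet).resolve_left h2]
          simp [h1]
        · rw [Prod.smul_snd, smul_eq_mul, div_mul_cancel₀ _ h2]
      · refine ⟨(q - D.φ a).1 / (D.dir a).1, Prod.ext ?_ ?_⟩
        · rw [Prod.smul_fst, smul_eq_mul, div_mul_cancel₀ _ h1]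
        · rw [Prod.smul_snd, smul_eq_mul]
          field_simp
          linarith
    have hbδ : |b| < δ := by
      rw [Metric.mem_ball, dist_eq_norm, hb, norm_smul, Real.norm_eq_abs] at hq
      exact lt_of_mul_lt_mul_right (hq.trans_le (min_le_right _ _)) hnd.le
    rw [sub_eq_iff_eq_add', ← hφ b hbδ] at hb
    rw [hb]
    exact D.φ_mem_graph _

theorem IsBase.side_eq {a r : ℝ} (h : D.IsBase a r) {x : Plane → ZMod 2} (hx : D.IsColoring x)
    {d : Plane} (hd : d = D.dir a ∨ d = -D.dir a) {z z' : Plane} (hz : z ∈ Metric.ball (D.φ a) r)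
    (hz' : z' ∈ Metric.ball (D.φ a) r) (h1 : 0 < planeDet d (z - D.φ a))
    (h2 : 0 < planeDet d (z' - D.φ a)) : x z = x z' := by
  refine hx.eq_of_isPreconnected
    ((convex_ball (D.φ a) r).inter (convex_planeDet_lt d (D.φ a))).isPreconnected ?_
    ⟨hz, h1⟩ ⟨hz', h2⟩
  rintro q ⟨hq, hq'⟩ hqG
  have h0 := (h.mem_iff q hq).1 hqG
  simp only [Set.mem_ofPred_eq] at hq'
  rcases hd with rfl | rfl
  · exact hq'.ne' h0
  · rw [planeDet_neg_left, h0, neg_zero] at hq'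
    exact lt_irrefl _ hq'

/-- There are two points next to a base point which control all colourings near it. -/
theorem IsBase.exists_sides {a r : ℝ} (h : D.IsBase a r) : ∃ z z', z ∉ D.graph ∧ z' ∉ D.graph ∧
    ∀ x, D.IsColoring x → x z = x z' → D.ConstNear x (D.φ a) := by
  set d := D.dir a with hd
  have hd0 := D.dir_ne_zero a
  set e : Plane := (-d.2, d.1) with he
  have hde : 0 < planeDet d e := by
    simp only [planeDet, he]
    rcases eq_or_ne d.1 0 with h1 | h1
    · have h2 : d.2 ≠ 0 := fun h2 => hd0 (Prod.ext h1 h2)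
      have := sq_nonneg d.1
      have := mul_self_pos.2 h2
      nlinarith
    · have := mul_self_pos.2 h1
      nlinarith [mul_self_nonneg d.2]
  have ev : ∀ e' : Plane, ∀ᶠ η in 𝓝[>] (0 : ℝ), D.φ a + η • e' ∈ Metric.ball (D.φ a) r := by
    intro e'
    have hc : ContinuousAt (fun η : ℝ => D.φ a + η • e') 0 := by fun_prop
    exact mem_nhdsWithin_of_mem_nhds (hc.preimage_mem_nhds (t := Metric.ball (D.φ a) r)
      (by simpa using Metric.ball_mem_nhds _ h.pos))
  obtain ⟨η, h1, h2, h3⟩ := ((ev e).and ((ev (-e)).and self_mem_nhdsWithin)).exists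
  have h3 : 0 < η := h3
  have d1 : 0 < planeDet d (D.φ a + η • e - D.φ a) := by
    have : planeDet d (D.φ a + η • e - D.φ a) = η * planeDet d e := by
      simp only [planeDet, add_sub_cancel_left, Prod.smul_fst, Prod.smul_snd, smul_eq_mul]
      ring
    rw [this]
    positivity
  have d2 : 0 < planeDet (-d) (D.φ a + η • (-e) - D.φ a) := by
    have : planeDet (-d) (D.φ a + η • (-e) - D.φ a) = η * planeDet d e := by
      simp only [planeDet, add_sub_cancel_left, Prod.smul_fst, Prod.smul_snd, smul_eq_mul,
        Prod.fst_neg, Prod.snd_neg]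
      ring
    rw [this]
    positivity
  refine ⟨D.φ a + η • e, D.φ a + η • (-e), ?_, ?_, fun x hx hxz => ⟨x (D.φ a + η • e), ?_⟩⟩
  · rw [h.mem_iff _ h1]
    exact d1.ne'
  · rw [h.mem_iff _ h2]
    rw [planeDet_neg_left] at d2
    intro h0
    rw [h0, neg_zero] at d2
    exact lt_irrefl _ d2
  · filter_upwards [Metric.ball_mem_nhds _ h.pos] with q hq hqG
    rw [h.mem_iff q hq] at hqG
    rcases lt_or_gt_of_ne hqG with hlt | hgt
    · rw [hxz]
      exact h.side_eq hx (Or.inr rfl) hq h2 (by rw [planeDet_neg_left]; linarith) d2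
    · exact h.side_eq hx (Or.inl rfl) hq h1 hgt d1

theorem comp_eq_of_mem {q q' : Plane} (h : q' ∈ D.comp q) : D.comp q' = D.comp q :=
  (connectedComponentIn_eq h).symm

/-- Every region is adjacent to a regular point of the diagram. -/
theorem exists_regular_of_region {R : Set Plane} (hR : R ∈ D.regions) :
    ∃ a, D.φ a ∉ D.crossings ∧ (⌊a⌋ : ℝ) < a ∧ D.φ a ∈ closure R := by
  have : NeZero D.n := ⟨D.n_pos.ne'⟩
  obtain ⟨q₀, hq₀, rfl⟩ := hR
  change ∃ a, D.φ a ∉ D.crossings ∧ (⌊a⌋ : ℝ) < a ∧ D.φ a ∈ closure (D.comp q₀)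
  by_contra hc
  push Not at hc
  -- If no regular point were adjacent to the region, the region would be open and closed in the
  -- complement of the finite set `Z`. That complement is connected and contains graph points.
  set Z : Set Plane := D.crossings ∪ range D.vertex with hZ
  have hZf : Z.Finite := D.finite_crossings.union (Set.finite_range _)
  have hZG : Z ⊆ D.graph := by
    rintro _ (⟨y, _, _, rfl, _⟩ | ⟨i, rfl⟩)
    · exact ⟨y, rfl⟩
    · exact ⟨(i, ⟨0, by norm_num, by norm_num⟩), by simp [point]⟩
  have hconn : IsPreconnected Zᶜ :=
    (hZf.countable.isPathConnected_compl_of_one_lt_rank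
      (by simp [one_add_one_eq_two])).isConnected.2
  have hnc : ∀ τ, D.φ τ ∉ Z → D.φ τ ∉ closure (D.comp q₀) := by
    intro τ hτ
    refine hc τ (fun h => hτ (Or.inl h)) ?_
    refine lt_of_le_of_ne (Int.floor_le τ) fun h => hτ (Or.inr ⟨((⌊τ⌋ : ℤ) : ZMod D.n), ?_⟩)
    have e : D.φ τ = _ := curve_eq_of_mem D.vertex (i := ⌊τ⌋) h.le (by linarith)
    rw [e, ← h]
    simp
  have hloc : ∀ q ∈ Zᶜ, ∀ᶠ q' in 𝓝 q, (q' ∈ D.comp q₀) = (q ∈ D.comp q₀) := by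
    intro q hq
    by_cases hqG : q ∈ D.graph
    · have hq1 : q ∉ closure (D.comp q₀) := by
        rw [graph_eq] at hqG
        obtain ⟨τ, rfl⟩ := hqG
        exact hnc τ hq
      filter_upwards [isClosed_closure.isOpen_compl.mem_nhds hq1] with q' hq'
      exact propext ⟨fun h => absurd (subset_closure h) hq', fun h => absurd (subset_closure h) hq1⟩
    · filter_upwards [(isOpen_comp q).mem_nhds (mem_comp_self hqG)] with q' hq'
      have e := comp_eq_of_mem hq'
      have hq'G : q' ∉ D.graph := comp_subset _ hq'
      refine propext ⟨fun h => ?_, fun h => ?_⟩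
      · rw [← comp_eq_of_mem h, e]
        exact mem_comp_self hqG
      · rw [← comp_eq_of_mem h]
        exact hq'
  -- An open edge is infinite, so it has a point outside the finite set `Z`.
  have hinf : (D.φ '' Ioo (0 : ℝ) 1).Infinite := by
    refine Set.Infinite.image ?_ (Ioo_infinite one_pos)
    intro u hu v hv huv
    have e1 : D.φ u = _ := curve_eq_of_mem D.vertex (i := 0) (by simpa using hu.1.le)
      (by simpa using hu.2.le)
    have e2 : D.φ v = _ := curve_eq_of_mem D.vertex (i := 0) (by simpa using hv.1.le)
      (by simpa using hv.2.le)
    rw [e1, e2] at huv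
    have h3 := add_left_cancel huv
    have h4 : (u - v) • (D.vertex ((0 : ℤ) + 1) - D.vertex (0 : ℤ)) = 0 := by
      rw [← sub_eq_zero_of_eq h3]
      module
    rcases smul_eq_zero.1 h4 with h5 | h5
    · linarith
    · exact absurd (sub_eq_zero.1 h5).symm (D.vertex_ne _)
  obtain ⟨_, ⟨τ, -, rfl⟩, hτZ⟩ := hinf.exists_notMem_finite hZf
  have h1 := eq_of_eventually_eq hconn hloc (x := q₀) (y := D.φ τ)
    (fun h => hq₀ (hZG h)) hτZ
  exact comp_subset _ (h1.mp (mem_comp_self hq₀)) (D.φ_mem_graph τ)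

/-! ### Functions on the set of regions -/

open Classical in
/-- The function on the plane given by a function on the regions. -/
noncomputable def pull (x : D.regions → ZMod 2) (q : Plane) : ZMod 2 :=
  if h : q ∈ D.graphᶜ then x ⟨D.comp q, q, h, rfl⟩ else 0

theorem pull_apply (x : D.regions → ZMod 2) {q : Plane} (h : q ∉ D.graph) :
    pull x q = x ⟨D.comp q, q, h, rfl⟩ := by
  unfold pull
  exact dif_pos h

theorem pull_add (x y : D.regions → ZMod 2) (q : Plane) : pull (x + y) q = pull x q + pull y q := by
  unfold pull
  split_ifs <;> simp

theorem isColoring_pull (x : D.regions → ZMod 2) : D.IsColoring (pull x) := by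
  intro q hq
  filter_upwards [(isOpen_comp q).mem_nhds (mem_comp_self hq)] with q' hq'
  rw [pull_apply x hq, pull_apply x (comp_subset _ hq')]
  congr 2
  exact comp_eq_of_mem hq'

theorem IsColoring.eq_of_comp_eq {f : Plane → ZMod 2} (hf : D.IsColoring f) {q q' : Plane}
    (hq : q ∉ D.graph) (hq' : q' ∉ D.graph) (h : D.comp q = D.comp q') : f q = f q' :=
  hf.eq_of_isPreconnected (S := D.comp q) isPreconnected_connectedComponentIn
    (fun _ hz => comp_subset _ hz) (mem_comp_self hq) (h ▸ mem_comp_self hq')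

/-- The function on the regions given by a colouring. -/
noncomputable def push (f : Plane → ZMod 2) (R : D.regions) : ZMod 2 := f R.2.choose

theorem push_comp {f : Plane → ZMod 2} (hf : D.IsColoring f) {q : Plane} (hq : q ∉ D.graph) :
    push f (⟨D.comp q, q, hq, rfl⟩ : D.regions) = f q := by
  have h : D.comp q ∈ D.regions := ⟨q, hq, rfl⟩
  have hs := h.choose_spec
  exact hf.eq_of_comp_eq hs.1 hq hs.2.symm

theorem pull_push {f : Plane → ZMod 2} (hf : D.IsColoring f) {q : Plane} (hq : q ∉ D.graph) :
    pull (push f : D.regions → ZMod 2) q = f q := by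
  rw [pull_apply _ hq, push_comp hf hq]

theorem push_eq_of_closure {f : Plane → ZMod 2} (hf : D.IsColoring f) (R : D.regions) {y : Plane}
    (hy : y ∈ closure (R : Set Plane)) {c : ZMod 2} (hc : ∀ᶠ q in 𝓝 y, f q = c) :
    push f R = c := by
  obtain ⟨R, q₀, hq₀, rfl⟩ := R
  obtain ⟨q, hq, hqR⟩ := mem_closure_iff_nhds.1 hy _ hc
  have : push f (⟨_, q₀, hq₀, rfl⟩ : D.regions) = f q₀ := push_comp hf hq₀
  rw [this]
  have hq : f q = c := hq
  rw [← hq]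
  exact hf.eq_of_comp_eq hq₀ (comp_subset _ hqR) (comp_eq_of_mem hqR).symm

variable (D) in
/-- A choice of passing times and charts for all crossings, relative to a base time. -/
structure Frame (a : ℝ) where
  s : D.crossings → ℝ
  t : D.crossings → ℝ
  ε : D.crossings → ℝ
  base_lt : ∀ v, a < s v
  lt : ∀ v, s v < t v
  lt_base : ∀ v, t v < a + D.n
  eq : ∀ v, D.φ (s v) = v
  isChart : ∀ v, D.IsChart (s v) (t v) (ε v)

theorem nonempty_frame {a : ℝ} (ha : D.φ a ∉ D.crossings) : Nonempty (D.Frame a) := by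
  have h : ∀ v : D.crossings, ∃ s t ε, a < s ∧ s < t ∧ t < a + D.n ∧ D.φ s = v ∧
      D.IsChart s t ε := by
    intro v
    obtain ⟨s, t, h1, h2, h3, h4, h5⟩ := D.exists_times v.2 ha
    obtain ⟨ε, hε⟩ := D.exists_isChart (h4.trans h5.symm) (D.not_shift_of_lt h2 (by linarith))
    exact ⟨s, t, ε, h1, h2, h3, h4, hε⟩
  choose s t ε h1 h2 h3 h4 h5 using h
  exact ⟨⟨s, t, ε, h1, h2, h3, h4, h5⟩⟩

section Frame

variable {a : ℝ} (F : D.Frame a)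

/-- The corner points of the crossings. -/
noncomputable def Frame.corner (v : D.crossings) (σ₁ σ₂ : ℝ) : Plane :=
  D.corner (F.s v) (F.t v) (F.ε v) σ₁ σ₂

/-- The corner sums of a function at the crossings. -/
noncomputable def Frame.sum (v : D.crossings) (x : Plane → ZMod 2) : ZMod 2 :=
  D.cornerSum (F.s v) (F.t v) (F.ε v) x

theorem Frame.corner_not_mem (v : D.crossings) {σ₁ σ₂ : ℝ} (h1 : |σ₁| = 1) (h2 : |σ₂| = 1) :
    F.corner v σ₁ σ₂ ∉ D.graph := (F.isChart v).corner_not_mem h1 h2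

theorem Frame.sum_add (v : D.crossings) (x y : Plane → ZMod 2) :
    F.sum v (fun q => x q + y q) = F.sum v x + F.sum v y := by
  simp only [Frame.sum, cornerSum]
  ring

theorem Frame.sum_congr (v : D.crossings) {x y : Plane → ZMod 2}
    (h : ∀ q, q ∉ D.graph → x q = y q) : F.sum v x = F.sum v y := by
  simp only [Frame.sum, cornerSum]
  have hc : ∀ σ₁ σ₂ : ℝ, |σ₁| = 1 → |σ₂| = 1 → x (D.corner (F.s v) (F.t v) (F.ε v) σ₁ σ₂) =
      y (D.corner (F.s v) (F.t v) (F.ε v) σ₁ σ₂) := fun _ _ h1 h2 => h _ (F.corner_not_mem v h1 h2)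
  rw [hc 1 1 (by simp) (by simp), hc 1 (-1) (by simp) (by simp), hc (-1) 1 (by simp) (by simp),
    hc (-1) (-1) (by simp) (by simp)]

theorem Frame.sum_const (v : D.crossings) (c : ZMod 2) : F.sum v (fun _ => c) = 0 := by
  simp only [Frame.sum, cornerSum, zmod_two_add_self]

/-- The sum `x + y` vanishes on both sides of the base point and has no corner sums, so
`eq_of_cornerSum_eq_zero` makes it constant with value zero. -/
theorem pull_injective_of_sides {z z' : Plane} (hz : z ∉ D.graph)
    (ha : D.φ a ∉ D.crossings)
    (hside : ∀ x, D.IsColoring x → x z = x z' → D.ConstNear x (D.φ a))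
    {x y : D.regions → ZMod 2} (h1 : pull x z = pull y z) (h2 : pull x z' = pull y z')
    (h3 : ∀ v, F.sum v (pull x) = F.sum v (pull y)) : x = y := by
  have hpull : ∀ q, pull (x + y) q = pull x q + pull y q := pull_add x y
  have hsum : ∀ v, F.sum v (pull (x + y)) = 0 := by
    intro v
    rw [show pull (x + y) = fun q => pull x q + pull y q from funext hpull, F.sum_add, h3,
      zmod_two_add_self]
  have hz0 : pull (x + y) z = 0 := by rw [hpull, h1, zmod_two_add_self]
  have hz0' : pull (x + y) z' = 0 := by rw [hpull, h2, zmod_two_add_self]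
  have hconst := eq_of_cornerSum_eq_zero (isColoring_pull (x + y)) ha
    (hside _ (isColoring_pull _) (hz0.trans hz0'.symm)) (fun v hv => ⟨F.s ⟨v, hv⟩, F.t ⟨v, hv⟩,
      F.ε ⟨v, hv⟩, F.base_lt _, F.lt _, F.lt_base _, F.eq _, F.isChart _, hsum ⟨v, hv⟩⟩)
  funext R
  obtain ⟨R, q, hq, rfl⟩ := R
  have := hconst q z hq hz
  rw [hz0, pull_apply _ hq] at this
  exact zmod_two_eq_of_add this

end Frame

/-! ### An upper bound for the number of regions -/

theorem exists_regular : ∃ a, D.φ a ∉ D.crossings ∧ (⌊a⌋ : ℝ) < a := by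
  obtain ⟨q, hq⟩ := D.dense_compl_graph.nonempty
  obtain ⟨a, h1, h2, -⟩ := exists_regular_of_region (D := D) ⟨q, hq, rfl⟩
  exact ⟨a, h1, h2⟩

/-- Functions on the regions inject into tuples of corner sums and two values beside a base point.
Comparing powers of two gives the bound, and Euler's formula is not needed. -/
theorem regions_bound : Finite D.regions ∧ Nat.card D.regions ≤ Nat.card D.crossings + 2 := by
  classical
  obtain ⟨a, ha, hfl⟩ := exists_regular (D := D)
  obtain ⟨r, hr⟩ := exists_isBase ha hfl
  obtain ⟨z, z', hz, hz', hside⟩ := hr.exists_sides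
  obtain ⟨F⟩ := nonempty_frame ha
  have : Finite D.crossings := D.finite_crossings
  let g : (D.regions → ZMod 2) → (D.crossings → ZMod 2) × ZMod 2 × ZMod 2 := fun x =>
    (fun v => F.sum v (pull x), pull x z, pull x z')
  have hg : Function.Injective g := by
    intro x y hxy
    simp only [g, Prod.mk.injEq] at hxy
    exact pull_injective_of_sides F hz ha hside hxy.2.1 hxy.2.2 (fun v => congrFun hxy.1 v)
  have hfin : Finite (D.regions → ZMod 2) := Finite.of_injective g hg
  -- Finiteness comes first from the function space, into which regions embed by their indicators.
  have hfinR : Finite D.regions := by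
    refine Finite.of_injective (fun R => (Pi.single R 1 : D.regions → ZMod 2)) ?_
    intro R R' h
    by_contra hne
    have := congrFun h R
    simp [Pi.single_eq_of_ne hne] at this
  refine ⟨hfinR, ?_⟩
  have hcard := Nat.card_le_card_of_injective g hg
  rw [Nat.card_prod, Nat.card_prod, Nat.card_fun, Nat.card_fun, Nat.card_zmod] at hcard
  have : 2 ^ Nat.card D.regions ≤ 2 ^ (Nat.card D.crossings + 2) := by
    rw [pow_add]
    exact hcard
  exact (Nat.pow_le_pow_iff_right (by norm_num)).1 this

end Diagram

namespace Diagram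

variable {D : Diagram}

/-! ### The effect of region crossing changes -/

theorem IsChart.mem_closure_comp {s t ε : ℝ} (h : D.IsChart s t ε) {σ₁ σ₂ : ℝ} (h1 : |σ₁| = 1)
    (h2 : |σ₂| = 1) : D.φ s ∈ closure (D.comp (D.corner s t ε σ₁ σ₂)) := by
  have hcont : ContinuousAt (fun η : ℝ => D.chart s t (σ₁ * η) (σ₂ * η)) 0 := by
    unfold chart
    fun_prop
  have h0 : D.chart s t (σ₁ * 0) (σ₂ * 0) = D.φ s := by simp [chart]
  rw [mem_closure_iff_nhds]
  intro U hU
  have e1 : ∀ᶠ η in 𝓝[>] (0 : ℝ), D.chart s t (σ₁ * η) (σ₂ * η) ∈ U :=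
    mem_nhdsWithin_of_mem_nhds (hcont.preimage_mem_nhds (by simpa only [h0] using hU))
  have e2 : ∀ᶠ η in 𝓝[>] (0 : ℝ), η < ε := (gt_mem_nhds h.pos).filter_mono nhdsWithin_le_nhds
  obtain ⟨η, hη, hηε, hη0⟩ := (e1.and (e2.and self_mem_nhdsWithin)).exists
  have hη0 : 0 < η := hη0
  refine ⟨_, hη, ?_⟩
  have a1 : |σ₁ * η| < ε := by rwa [abs_mul, h1, one_mul, abs_of_pos hη0]
  have a2 : |σ₂ * η| < ε := by rwa [abs_mul, h2, one_mul, abs_of_pos hη0]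
  have p1 : 0 < σ₁ * (σ₁ * η) := by rw [← mul_assoc, ← abs_mul_abs_self, h1]; linarith
  have p2 : 0 < σ₂ * (σ₂ * η) := by rw [← mul_assoc, ← abs_mul_abs_self, h2]; linarith
  have hseg := h.segment_corner h1 h2 a1 a2 p1 p2
  exact (convex_segment _ _).isPreconnected.subset_connectedComponentIn
    (right_mem_segment ℝ _ _) hseg (left_mem_segment ℝ _ _)

theorem exists_sign {a : ℝ} (ha : a ≠ 0) : ∃ σ : ℝ, (σ = 1 ∨ σ = -1) ∧ 0 < σ * a := by
  rcases lt_or_gt_of_ne ha with h | h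
  · exact ⟨-1, Or.inr rfl, by linarith⟩
  · exact ⟨1, Or.inl rfl, by linarith⟩

theorem abs_eq_one_of_sign {σ : ℝ} (h : σ = 1 ∨ σ = -1) : |σ| = 1 := by
  rcases h with rfl | rfl <;> simp

/-- The region has points inside the chart. They lie off both axes, so in an open quadrant, which is
connected to its corner without meeting the graph. -/
theorem IsChart.exists_corner_of_mem_closure {s t ε : ℝ} (h : D.IsChart s t ε) {q₀ : Plane}
    (hcl : D.φ s ∈ closure (D.comp q₀)) : ∃ σ₁ σ₂ : ℝ, (σ₁ = 1 ∨ σ₁ = -1) ∧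
      (σ₂ = 1 ∨ σ₂ = -1) ∧ D.comp q₀ = D.comp (D.corner s t ε σ₁ σ₂) := by
  have hP : ∀ᶠ z : ℝ × ℝ in 𝓝 (0, 0), |z.1| < ε ∧ |z.2| < ε := by
    have c1 : ContinuousAt (fun z : ℝ × ℝ => |z.1|) (0, 0) := by fun_prop
    have c3 : ContinuousAt (fun z : ℝ × ℝ => |z.2|) (0, 0) := by fun_prop
    exact (c1.eventually_lt continuousAt_const (by simpa using h.pos)).and
      (c3.eventually_lt continuousAt_const (by simpa using h.pos))
  have hev := chart_eventually h.det (P := fun u v => |u| < ε ∧ |v| < ε) hP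
  have h0 : D.chart s t 0 0 = D.φ s := by simp [chart]
  rw [h0] at hev
  obtain ⟨_, ⟨a, b, ⟨ha, hb⟩, rfl⟩, hq⟩ := mem_closure_iff_nhds.1 hcl _ hev
  have hG := comp_subset _ hq
  have hab : ¬ (a = 0 ∨ b = 0) := fun h' => hG ((h.mem_iff a b ha hb).2 h')
  push Not at hab
  obtain ⟨σ₁, hσ₁, p1⟩ := exists_sign hab.1
  obtain ⟨σ₂, hσ₂, p2⟩ := exists_sign hab.2
  refine ⟨σ₁, σ₂, hσ₁, hσ₂, ?_⟩
  have hseg := h.segment_corner (abs_eq_one_of_sign hσ₁) (abs_eq_one_of_sign hσ₂) ha hb p1 p2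
  have : D.chart s t a b ∈ D.comp (D.corner s t ε σ₁ σ₂) :=
    (convex_segment _ _).isPreconnected.subset_connectedComponentIn
      (right_mem_segment ℝ _ _) hseg (left_mem_segment ℝ _ _)
  rw [← comp_eq_of_mem hq, comp_eq_of_mem this]

theorem mem_frontier_comp_iff {v q : Plane} (hv : v ∈ D.graph) :
    v ∈ frontier (D.comp q) ↔ v ∈ closure (D.comp q) := by
  rw [(isOpen_comp q).frontier_eq, Set.mem_sdiff]
  exact ⟨fun h => h.1, fun h => ⟨h, fun h' => comp_subset _ h' hv⟩⟩

section Effect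

variable {a : ℝ} (F : D.Frame a)

/-- The region at a corner of a crossing. -/
noncomputable def Frame.region (v : D.crossings) (σ₁ σ₂ : ℝ) (h1 : |σ₁| = 1) (h2 : |σ₂| = 1) :
    D.regions := ⟨D.comp (F.corner v σ₁ σ₂), _, F.corner_not_mem v h1 h2, rfl⟩

/-- A crossing is nugatory if a region touches it at two opposite corners. -/
def Frame.Nugatory (v : D.crossings) : Prop :=
  D.comp (F.corner v 1 1) = D.comp (F.corner v (-1) (-1))

open Classical in
/-- The number of chosen regions at a crossing, modulo two. -/
noncomputable def effect [Fintype D.regions] (x : D.regions → ZMod 2) (v : D.crossings) : ZMod 2 :=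
  ∑ R : D.regions, if (v : Plane) ∈ frontier (R : Set Plane) then x R else 0

theorem Frame.mem_frontier_iff (v : D.crossings) (R : D.regions) :
    (v : Plane) ∈ frontier (R : Set Plane) ↔
      R = F.region v 1 1 (by simp) (by simp) ∨ R = F.region v 1 (-1) (by simp) (by simp) ∨
      R = F.region v (-1) 1 (by simp) (by simp) ∨
      R = F.region v (-1) (-1) (by simp) (by simp) := by
  obtain ⟨R, q₀, hq₀, rfl⟩ := R
  have hvG : (v : Plane) ∈ D.graph := F.eq v ▸ D.φ_mem_graph _
  change (v : Plane) ∈ frontier (D.comp q₀) ↔ _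
  rw [mem_frontier_comp_iff hvG]
  have key : ∀ σ₁ σ₂ : ℝ, ∀ (h1 : |σ₁| = 1) (h2 : |σ₂| = 1),
      (⟨connectedComponentIn D.graphᶜ q₀, q₀, hq₀, rfl⟩ : D.regions) = F.region v σ₁ σ₂ h1 h2 ↔
        D.comp q₀ = D.comp (D.corner (F.s v) (F.t v) (F.ε v) σ₁ σ₂) := fun σ₁ σ₂ h1 h2 =>
    Subtype.ext_iff
  rw [key, key, key, key]
  constructor
  · intro hcl
    rw [← F.eq v] at hcl
    obtain ⟨σ₁, σ₂, rfl | rfl, rfl | rfl, h⟩ := (F.isChart v).exists_corner_of_mem_closure hcl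
    · exact Or.inl h
    · exact Or.inr (Or.inl h)
    · exact Or.inr (Or.inr (Or.inl h))
    · exact Or.inr (Or.inr (Or.inr h))
  · rw [← F.eq v]
    rintro (h | h | h | h) <;> rw [h] <;>
      exact (F.isChart v).mem_closure_comp (by simp) (by simp)

/-- The checkerboard colouring separates adjacent corners, and the loop parity separates one pair of
opposite corners. The only coincidence left is between the corners `(1, 1)` and `(-1, -1)`, which is
the nugatory case. -/
theorem Frame.corner_values (v : D.crossings) :
    D.comp (F.corner v 1 1) ≠ D.comp (F.corner v 1 (-1)) ∧
    D.comp (F.corner v 1 1) ≠ D.comp (F.corner v (-1) 1) ∧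
    D.comp (F.corner v 1 (-1)) ≠ D.comp (F.corner v (-1) (-1)) ∧
    D.comp (F.corner v (-1) 1) ≠ D.comp (F.corner v (-1) (-1)) ∧
    D.comp (F.corner v 1 (-1)) ≠ D.comp (F.corner v (-1) 1) := by
  obtain ⟨h1, h2, h3⟩ := (F.isChart v).checkerboard_corners (F.base_lt v) (F.lt v) (F.lt_base v)
  obtain ⟨h4, h5, -⟩ := (F.isChart v).arcParity_corners (F.base_lt v) (F.lt v) (F.lt_base v)
  have hn : (0 : ℝ) < D.n := Nat.cast_pos.2 D.n_pos
  have hc1 := isColoring_arcParity (D := D) (s := a) (t := a + D.n) (by linarith)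
    (D.φ_add_period a).symm
  have hc2 := isColoring_arcParity (F.lt v).le (F.isChart v).eq
  have key : ∀ {f : Plane → ZMod 2} (_ : D.IsColoring f) {σ₁ σ₂ σ₃ σ₄ : ℝ} (_ : |σ₁| = 1)
      (_ : |σ₂| = 1) (_ : |σ₃| = 1) (_ : |σ₄| = 1)
      (_ : f (F.corner v σ₁ σ₂) ≠ f (F.corner v σ₃ σ₄)),
      D.comp (F.corner v σ₁ σ₂) ≠ D.comp (F.corner v σ₃ σ₄) := by
    intro f hf σ₁ σ₂ σ₃ σ₄ a1 a2 a3 a4 hne he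
    exact hne (hf.eq_of_comp_eq (F.corner_not_mem v a1 a2) (F.corner_not_mem v a3 a4) he)
  refine ⟨key hc1 (by simp) (by simp) (by simp) (by simp) h1.symm,
    key hc1 (by simp) (by simp) (by simp) (by simp) h2.symm,
    key hc1 (by simp) (by simp) (by simp) (by simp) ?_,
    key hc1 (by simp) (by simp) (by simp) (by simp) ?_,
    key hc2 (by simp) (by simp) (by simp) (by simp) ?_⟩
  · unfold Frame.corner
    rw [h3]
    exact h1
  · unfold Frame.corner
    rw [h3]
    exact h2
  · unfold Frame.corner
    rw [h5]
    exact h4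

-- A corner sum counts with multiplicity, while a region crossing change acts once. At a nugatory
-- crossing the repeated region cancels in the corner sum and has to be added back.
open Classical in
theorem Frame.effect_eq [Fintype D.regions] (x : D.regions → ZMod 2) (v : D.crossings) :
    effect x v = F.sum v (pull x) + if F.Nugatory v then pull x (F.corner v 1 1) else 0 := by
  unfold effect
  obtain ⟨h1, h2, h3, h4, h5⟩ := F.corner_values v
  set A := F.region v 1 1 (by simp) (by simp) with hA
  set B := F.region v 1 (-1) (by simp) (by simp) with hB
  set C := F.region v (-1) 1 (by simp) (by simp) with hC
  set E := F.region v (-1) (-1) (by simp) (by simp) with hE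
  have e : (Finset.univ.filter fun R : D.regions => (v : Plane) ∈ frontier (R : Set Plane)) =
      {A, B, C, E} := by
    ext R
    simp only [Finset.mem_filter, Finset.mem_univ, true_and, Finset.mem_insert,
      Finset.mem_singleton]
    exact F.mem_frontier_iff v R
  have hAB : A ≠ B := fun h => h1 (congrArg Subtype.val h)
  have hAC : A ≠ C := fun h => h2 (congrArg Subtype.val h)
  have hBE : B ≠ E := fun h => h3 (congrArg Subtype.val h)
  have hCE : C ≠ E := fun h => h4 (congrArg Subtype.val h)
  have hBC : B ≠ C := fun h => h5 (congrArg Subtype.val h)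
  have hAE : A = E ↔ F.Nugatory v := Subtype.ext_iff
  have p : ∀ σ₁ σ₂ : ℝ, ∀ (h1 : |σ₁| = 1) (h2 : |σ₂| = 1),
      pull x (F.corner v σ₁ σ₂) = x (F.region v σ₁ σ₂ h1 h2) := fun σ₁ σ₂ h1 h2 =>
    pull_apply x (F.corner_not_mem v h1 h2)
  have hs : F.sum v (pull x) = (x A + x B) + (x C + x E) := by
    unfold Frame.sum cornerSum
    rw [hA, hB, hC, hE, ← p, ← p, ← p, ← p]
    rfl
  rw [← Finset.sum_filter, e, hs, p 1 1 (by simp) (by simp), ← hA]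
  by_cases hn : A = E
  · rw [if_pos (hAE.1 hn), ← hn]
    have : ({A, B, C, A} : Finset D.regions) = {A, B, C} := by
      ext R
      simp only [Finset.mem_insert, Finset.mem_singleton]
      tauto
    rw [this, Finset.sum_insert (by simp [hAB, hAC]), Finset.sum_insert (by simp [hBC]),
      Finset.sum_singleton]
    linear_combination -zmod_two_add_self (x A)
  · rw [if_neg (fun h => hn (hAE.2 h)), Finset.sum_insert (by simp [hAB, hAC, hn]),
      Finset.sum_insert (by simp [hBC, hBE]), Finset.sum_insert (by simp [hCE]),
      Finset.sum_singleton]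
    ring

/-- The corner `(1, 1)` borders the half strand just after `s'`, which lies on the complementary
loop. By `arcParity_const` the parity is constant along that loop. The shift `k` moves `s'` into the
right period. -/
theorem IsChart.arcParity_corner_of_outside {s t ε s' t' ε' : ℝ} (h : D.IsChart s t ε)
    (hst : s < t) (htn : t < s + D.n)
    (hnug : D.comp (D.corner s t ε 1 1) = D.comp (D.corner s t ε (-1) (-1)))
    (h' : D.IsChart s' t' ε') {k : ℤ}
    (hout : ∀ᶠ a in 𝓝[>] (0 : ℝ), t < s' + 1 * a + k * D.n ∧ s' + 1 * a + k * D.n < s + D.n)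
    {τ : ℝ} (hτ1 : t < τ) (hτ2 : τ < s + D.n) :
    D.arcParity s t (D.corner s' t' ε' 1 1) = D.arcParity s t (D.φ τ) := by
  have e2 : ∀ᶠ a in 𝓝[>] (0 : ℝ), a < ε' := (gt_mem_nhds h'.pos).filter_mono nhdsWithin_le_nhds
  obtain ⟨b, ⟨hb1, hb2⟩, hbε, hb0⟩ := (hout.and (e2.and self_mem_nhdsWithin)).exists
  have hb0 : 0 < b := hb0
  rw [one_mul] at hb1 hb2
  obtain ⟨hloc, hconst⟩ := h.arcParity_const hst htn hnug
  rw [hconst τ _ hτ1 hτ2 hb1 hb2]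
  have hl := hloc _ hb1 hb2
  rw [D.φ_add] at hl ⊢
  have hbb : |b| < ε' := by rwa [abs_of_pos hb0]
  rw [h'.φ_left hbb] at hl ⊢
  have hcont : ContinuousAt (fun η : ℝ => D.chart s' t' b η) 0 := by
    unfold chart
    fun_prop
  have h0 : D.chart s' t' b 0 = D.φ s' + b • D.dir s' := by simp [chart]
  rw [← h0] at hl ⊢
  have e3 := (hcont.eventually hl).filter_mono (nhdsWithin_le_nhds (s := Ioi 0))
  obtain ⟨η, hη, hηε, hη0⟩ := (e3.and (e2.and self_mem_nhdsWithin)).exists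
  have hη0 : 0 < η := hη0
  rw [← hη]
  exact (h'.coloring_eq (isColoring_arcParity hst.le h.eq) (by simp) (by simp) hbb
    (by rwa [abs_of_pos hη0]) (by linarith) (by linarith)).symm

/-- The loop of `w` lies strictly inside the loop of `v`. -/
def Frame.Inside (w v : D.crossings) : Prop := F.s v < F.s w ∧ F.t w < F.t v

/-- The parity of the loop at `v`, normalised to vanish at the base point. -/
noncomputable def Frame.loop (v : D.crossings) (q : Plane) : ZMod 2 :=
  D.arcParity (F.s v) (F.t v) q + D.arcParity (F.s v) (F.t v) (D.φ a)

theorem isColoring_add_const {f : Plane → ZMod 2} (hf : D.IsColoring f) (c : ZMod 2) :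
    D.IsColoring fun q => f q + c := by
  intro q hq
  filter_upwards [hf q hq] with q' h
  rw [h]

theorem Frame.isColoring_loop (v : D.crossings) : D.IsColoring (F.loop v) :=
  isColoring_add_const (isColoring_arcParity (F.lt v).le (F.isChart v).eq) _

theorem Frame.loop_eventually (ha : D.φ a ∉ D.crossings) (v : D.crossings) :
    ∀ᶠ q in 𝓝 (D.φ a), F.loop v q = 0 := by
  have h := arcParity_eventually_eq (F.lt v).le (F.isChart v).eq (q := D.φ a) (by
    intro σ h1 h2 he
    obtain ⟨k, hk⟩ := D.exists_shift_of_not_mem ha he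
    have := eq_of_period_shift hk ((F.base_lt v).le.trans h1) (h2.trans_lt (F.lt_base v)) le_rfl
      (by linarith [F.base_lt v, F.lt v, F.lt_base v])
    linarith [F.base_lt v])
  filter_upwards [h] with q hq
  rw [Frame.loop, hq, zmod_two_add_self]

/-- The normalising constant has no corner sum, so the loop parities form a family dual to the
corner sums. -/
theorem Frame.sum_loop (v w : D.crossings) : F.sum w (F.loop v) = if w = v then 1 else 0 := by
  have e : F.sum w (F.loop v) = F.sum w (D.arcParity (F.s v) (F.t v)) := by
    rw [show F.loop v = fun q => D.arcParity (F.s v) (F.t v) q +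
      (fun _ => D.arcParity (F.s v) (F.t v) (D.φ a)) q from rfl, F.sum_add, F.sum_const, add_zero]
  rw [e]
  split_ifs with h
  · subst h
    exact ((F.isChart w).arcParity_corners (F.base_lt w) (F.lt w) (F.lt_base w)).2.2
  · refine (F.isChart w).cornerSum_arc_of_ne (F.base_lt w) ((F.lt w).trans (F.lt_base w))
      (F.base_lt v).le (F.lt v).le (F.lt_base v) (F.isChart v).eq ?_
    rw [F.eq, F.eq]
    exact fun h' => h (Subtype.ext h')

/-- Unless `w` is nested inside `v`, one of the two passages of `w` is followed by the complementary
loop of `v`, which contains the base point. The case `w = v` is included, since time just after `t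
v` is outside the loop. -/
theorem Frame.loop_corner_of_not_inside {v w : D.crossings} (hv : F.Nugatory v)
    (hin : ¬ F.Inside w v) : F.loop v (F.corner w 1 1) = 0 := by
  have b1 := F.base_lt v
  have b2 := F.lt v
  have b3 := F.lt_base v
  have c1 := F.base_lt w
  have c2 := F.lt w
  have c3 := F.lt_base w
  have hbase : D.φ a = D.φ (a + D.n) := (D.φ_add_period a).symm
  have key : ∀ {s' t' : ℝ} (_ : D.IsChart s' t' (F.ε w)) (k : ℤ)
      (_ : ∀ᶠ b in 𝓝[>] (0 : ℝ), F.t v < s' + 1 * b + k * D.n ∧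
        s' + 1 * b + k * D.n < F.s v + D.n),
      D.arcParity (F.s v) (F.t v) (D.corner s' t' (F.ε w) 1 1) =
        D.arcParity (F.s v) (F.t v) (D.φ a) := by
    intro s' t' h' k hk
    rw [hbase]
    exact (F.isChart v).arcParity_corner_of_outside b2 (by linarith) hv h' hk b3 (by linarith)
  have key2 : ∀ {s' t' : ℝ} (_ : D.IsChart s' t' (F.ε w)) (_ : a < s') (_ : s' < a + D.n)
      (_ : s' < F.s v ∨ F.t v ≤ s'),
      D.arcParity (F.s v) (F.t v) (D.corner s' t' (F.ε w) 1 1) =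
        D.arcParity (F.s v) (F.t v) (D.φ a) := by
    intro s' t' h' h1 h2 h3
    rcases h3 with h3 | h3
    · refine key h' 1 ?_
      filter_upwards [eventually_add_lt (σ := 1) h3, self_mem_nhdsWithin] with b hb hb0
      have hb0 : 0 < b := hb0
      push_cast
      constructor <;> linarith
    · refine key h' 0 ?_
      filter_upwards [eventually_add_lt (σ := 1) (show s' < F.s v + D.n by linarith),
        self_mem_nhdsWithin] with b hb hb0
      have hb0 : 0 < b := hb0
      push_cast
      constructor <;> linarith
  have hswap : F.corner w 1 1 = D.corner (F.t w) (F.s w) (F.ε w) 1 1 := by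
    unfold Frame.corner Diagram.corner
    rw [chart_comm (F.isChart w).eq]
  have main : D.arcParity (F.s v) (F.t v) (F.corner w 1 1) =
      D.arcParity (F.s v) (F.t v) (D.φ a) := by
    by_cases h1 : F.s w < F.s v
    · exact key2 (F.isChart w) c1 (by linarith) (Or.inl h1)
    by_cases h2 : F.t v ≤ F.t w
    · rw [hswap]
      exact key2 (F.isChart w).swap (by linarith) c3 (Or.inr h2)
    push Not at h1 h2
    rcases eq_or_lt_of_le h1 with h3 | h3
    · exfalso
      have hvw : v = w := Subtype.ext (by rw [← F.eq v, h3, F.eq w])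
      subst hvw
      exact lt_irrefl _ h2
    · exact absurd ⟨h3, h2⟩ hin
  rw [Frame.loop, main, zmod_two_add_self]

end Effect

end Diagram

namespace Diagram

variable {D : Diagram}

/-! ### Solving for region crossing changes -/

theorem sum_smul_single_mem [Fintype D.crossings] [DecidableEq D.crossings]
    {S : Submodule (ZMod 2) (D.crossings → ZMod 2)} (g : D.crossings → ZMod 2)
    (h : ∀ w, g w ≠ 0 → Pi.single w 1 ∈ S) : g ∈ S := by
  have : g = ∑ w, g w • (Pi.single w 1 : D.crossings → ZMod 2) := by
    rw [← pi_eq_sum_univ' g]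
  rw [this]
  refine Submodule.sum_mem _ fun w _ => ?_
  by_cases hw : g w = 0
  · rw [hw, zero_smul]
    exact Submodule.zero_mem _
  · exact Submodule.smul_mem _ _ (h w hw)

section Solve

variable [Fintype D.regions]

theorem effect_add (x y : D.regions → ZMod 2) (v : D.crossings) :
    effect (x + y) v = effect x v + effect y v := by
  unfold effect
  rw [← Finset.sum_add_distrib]
  refine Finset.sum_congr rfl fun R _ => ?_
  split_ifs <;> simp

theorem effect_smul (c : ZMod 2) (x : D.regions → ZMod 2) (v : D.crossings) :
    effect (c • x) v = c * effect x v := by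
  unfold effect
  rw [Finset.mul_sum]
  refine Finset.sum_congr rfl fun R _ => ?_
  split_ifs <;> simp

/-- The effects of those sets of regions which do not contain `R`. -/
noncomputable def effectSpace (R : D.regions) : Submodule (ZMod 2) (D.crossings → ZMod 2) where
  carrier := {y | ∃ x : D.regions → ZMod 2, x R = 0 ∧ effect x = y}
  add_mem' := by
    rintro _ _ ⟨x, hx, rfl⟩ ⟨y, hy, rfl⟩
    exact ⟨x + y, by simp [hx, hy], funext fun v => effect_add x y v⟩
  zero_mem' := ⟨0, rfl, funext fun v => by simp [effect]⟩
  smul_mem' := by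
    rintro c _ ⟨x, hx, rfl⟩
    exact ⟨c • x, by simp [hx], funext fun v => effect_smul c x v⟩

variable {a : ℝ} (F : D.Frame a) (ha : D.φ a ∉ D.crossings) (R : D.regions)
  (hR : D.φ a ∈ closure (R : Set Plane))
include F ha hR

-- The regions where the loop parity of `v` is one change `v` and possibly some nugatory crossings.
-- The normalised parity vanishes near the base point, which is adherent to `R`, so `R` is not used.
open Classical in
theorem Frame.effect_loop_mem (v : D.crossings) :
    (Pi.single v 1 + fun w => if F.Nugatory w then F.loop v (F.corner w 1 1) else 0) ∈
      effectSpace R := by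
  refine ⟨push (F.loop v), push_eq_of_closure (F.isColoring_loop v) R hR
    (F.loop_eventually ha v), ?_⟩
  funext w
  rw [F.effect_eq, F.sum_congr w (fun q hq => pull_push (F.isColoring_loop v) hq), F.sum_loop,
    pull_push (F.isColoring_loop v) (F.corner_not_mem w (by simp) (by simp)), Pi.add_apply,
    Pi.single_apply]

/-- Well-founded induction on nesting: for nugatory `v` the correction is supported on nugatory
crossings strictly inside `v`, whose unit vectors are already available. -/
theorem Frame.single_mem_of_nugatory [DecidableEq D.crossings] (v : D.crossings)
    (hv : F.Nugatory v) : Pi.single v 1 ∈ effectSpace R := by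
  classical
  have : Finite D.crossings := D.finite_crossings
  have := Fintype.ofFinite D.crossings
  have : IsTrans D.crossings F.Inside := ⟨fun u v w h h' => ⟨h'.1.trans h.1, h.2.trans h'.2⟩⟩
  have : Std.Irrefl F.Inside := ⟨fun u h => lt_irrefl _ h.1⟩
  have hwf : WellFounded F.Inside := Finite.wellFounded_of_trans_of_irrefl _
  induction v using hwf.induction with
  | _ v ih =>
    have h1 := F.effect_loop_mem ha R hR v
    have h2 : (fun w => if F.Nugatory w then F.loop v (F.corner w 1 1) else 0) ∈
        effectSpace R := by
      refine sum_smul_single_mem _ fun w hw => ?_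
      rw [ne_eq, ite_eq_right_iff, Classical.not_imp] at hw
      refine ih w ?_ hw.1
      by_contra hin
      exact hw.2 (F.loop_corner_of_not_inside hv hin)
    convert Submodule.sub_mem _ h1 h2 using 1
    rw [add_sub_cancel_right]
    congr
    exact Subsingleton.elim _ _

/-- For an arbitrary crossing the correction is still supported on nugatory ones, whose unit vectors
have been obtained. Hence all unit vectors are in the space. -/
theorem effectSpace_eq_top : effectSpace R = ⊤ := by
  classical
  have : Finite D.crossings := D.finite_crossings
  have := Fintype.ofFinite D.crossings
  rw [eq_top_iff]
  rintro g -
  refine sum_smul_single_mem g fun v _ => ?_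
  have h1 := F.effect_loop_mem ha R hR v
  have h2 : (fun w => if F.Nugatory w then F.loop v (F.corner w 1 1) else 0) ∈
      effectSpace R := by
    refine sum_smul_single_mem _ fun w hw => ?_
    rw [ne_eq, ite_eq_right_iff, Classical.not_imp] at hw
    exact F.single_mem_of_nugatory ha R hR w hw.1
  convert Submodule.sub_mem _ h1 h2 using 1
  rw [add_sub_cancel_right]

end Solve

variable [Fintype D.regions]

theorem exists_effect_eq (y : D.crossings → ZMod 2) (R : D.regions) :
    ∃ x : D.regions → ZMod 2, effect x = y ∧ x R = 0 := by
  obtain ⟨a, ha, -, hR⟩ := exists_regular_of_region R.2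
  obtain ⟨F⟩ := nonempty_frame ha
  have : y ∈ effectSpace R := by
    rw [effectSpace_eq_top F ha R hR]
    trivial
  obtain ⟨x, h1, h2⟩ := this
  exact ⟨x, h2, h1⟩

/-! ### Averaging over the solutions -/

/-- Every region belongs to a set of regions without effect. -/
theorem exists_effect_eq_zero (R : D.regions) :
    ∃ z : D.regions → ZMod 2, effect z = 0 ∧ z R = 1 := by
  -- Reproduce the effect of the set of all regions without using `R`, then add the two sets.
  obtain ⟨x, h1, h2⟩ := exists_effect_eq (effect fun _ : D.regions => 1) R
  refine ⟨(fun _ => 1) + x, funext fun v => ?_, by simp [h2]⟩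
  rw [effect_add, h1, zmod_two_add_self]
  rfl

open Classical in
/-- Every set of crossings is changed by at most half of the regions. -/
theorem exists_effect_eq_card_le (y : D.crossings → ZMod 2) :
    ∃ x : D.regions → ZMod 2, effect x = y ∧
      2 * (Finset.univ.filter fun R => x R = 1).card ≤ Fintype.card D.regions := by
  obtain ⟨q, hq⟩ := D.dense_compl_graph.nonempty
  obtain ⟨x₀, hx₀, -⟩ := exists_effect_eq y ⟨D.comp q, q, hq, rfl⟩
  set S : Finset (D.regions → ZMod 2) := Finset.univ.filter fun x => effect x = y with hS
  have hSne : S.Nonempty := ⟨x₀, by simp [hS, hx₀]⟩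
  -- Adding a set without effect that contains `R` is an involution of the solutions, and it toggles
  -- membership of `R`.
  have hhalf : ∀ R : D.regions, 2 * (S.filter fun x => x R = 1).card = S.card := by
    intro R
    obtain ⟨z, hz, hzR⟩ := exists_effect_eq_zero R
    have hadd : ∀ x ∈ S, x + z ∈ S := by
      intro x hx
      rw [hS, Finset.mem_filter] at hx ⊢
      refine ⟨Finset.mem_univ _, funext fun v => ?_⟩
      rw [effect_add, hx.2, hz]
      simp
    have hzz : ∀ x : D.regions → ZMod 2, x + z + z = x := by
      intro x
      funext R'
      simp only [Pi.add_apply]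
      rw [add_assoc, zmod_two_add_self, add_zero]
    have hflip : ∀ c : ZMod 2, c + 1 = 1 ↔ ¬ c = 1 := by decide
    have h1 : (S.filter fun x => x R = 1).card = (S.filter fun x => ¬ x R = 1).card := by
      refine Finset.card_bij (fun x _ => x + z) ?_ ?_ ?_
      · intro x hx
        rw [Finset.mem_filter] at hx ⊢
        refine ⟨hadd x hx.1, ?_⟩
        rw [Pi.add_apply, hzR, hflip, not_not]
        exact hx.2
      · intro x _ x' _ h
        exact add_right_cancel h
      · intro x hx
        rw [Finset.mem_filter] at hx
        refine ⟨x + z, Finset.mem_filter.2 ⟨hadd x hx.1, ?_⟩, hzz x⟩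
        rw [Pi.add_apply, hzR, hflip]
        exact hx.2
    rw [two_mul]
    nth_rewrite 2 [h1]
    exact Finset.card_filter_add_card_filter_not _
  -- Counting pairs of a solution and a region in it shows that the average solution has half of the
  -- regions. Some solution is no larger than the average.
  have hsum : ∑ x ∈ S, 2 * (Finset.univ.filter fun R => x R = 1).card =
      ∑ _x ∈ S, Fintype.card D.regions := by
    rw [← Finset.mul_sum, Finset.sum_const, smul_eq_mul]
    have : ∑ x ∈ S, (Finset.univ.filter fun R => x R = 1).card =
        ∑ R : D.regions, (S.filter fun x => x R = 1).card := by
      simp only [Finset.card_filter]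
      exact Finset.sum_comm
    rw [this, Finset.mul_sum, Finset.sum_congr rfl fun R _ => hhalf R, Finset.sum_const,
      smul_eq_mul, mul_comm]
    rfl
  obtain ⟨x, hx, hle⟩ := Finset.exists_le_of_sum_le hSne hsum.le
  exact ⟨x, (Finset.mem_filter.1 hx).2, hle⟩

end Diagram

namespace Diagram

variable {D : Diagram}

/-! ### Successive region crossing changes -/

theorem mk_congr {n : ℕ} {n_pos : 0 < n} {vertex : ZMod n → Plane} {h1 h2} {U V : Set (Param n)}
    (h : U = V) (hU hU' hV hV') : Diagram.mk n n_pos vertex h1 h2 U hU hU' =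
      Diagram.mk n n_pos vertex h1 h2 V hV hV' := by
  subst h
  rfl

theorem crossingChange_empty : D.crossingChange ∅ = D := by
  refine mk_congr ?_ _ _ D.upper_double D.upper_iff
  ext x
  simp only [Set.mem_ofPred_eq, Set.mem_empty_iff_false, not_false_eq_true, iff_true]
  exact ⟨fun h => h.2, fun h => ⟨D.upper_double x h, h⟩⟩

/-- Changing a crossing twice restores it, so changes compose by symmetric difference. What `U`
contains besides crossings is irrelevant. -/
theorem crossingChange_crossingChange {S T U : Set Plane}
    (h : ∀ v ∈ D.crossings, v ∈ U ↔ ¬ (v ∈ S ↔ v ∈ T)) :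
    (D.crossingChange S).crossingChange T = D.crossingChange U := by
  refine mk_congr ?_ _ _ _ _
  ext x
  refine and_congr_right fun hx => ?_
  have hv : point D.vertex x ∈ D.crossings := by
    obtain ⟨y, hy, hyx⟩ := hx
    exact ⟨x, y, hy.symm, rfl, hyx⟩
  have hmem : x ∈ (D.crossingChange S).upper ↔ (x ∈ D.upper ↔ point D.vertex x ∉ S) :=
    ⟨fun h => h.2, fun h => ⟨hx, h⟩⟩
  have := h _ hv
  change (x ∈ (D.crossingChange S).upper ↔ point D.vertex x ∉ T) ↔ (x ∈ D.upper ↔ _)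
  rw [hmem]
  tauto

open Classical in
/-- How often a point lies on the boundary of regions in a list, modulo two. -/
noncomputable def boundaryCount (P : List (Set Plane)) (v : Plane) : ZMod 2 :=
  (P.map fun R => if v ∈ frontier R then (1 : ZMod 2) else 0).sum

/-- Crossing changes leave the graph and its crossings unchanged, so each region contributes its
boundary independently of the previous steps. The initial `f` is kept general for the induction on
the list. -/
theorem foldl_regionCrossingChange (P : List (Set Plane)) (f : Plane → ZMod 2) :
    P.foldl regionCrossingChange (D.crossingChange {v | f v = 1}) =
      D.crossingChange {v | f v + boundaryCount P v = 1} := by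
  induction P generalizing f with
  | nil => simp [boundaryCount]
  | cons R P ih =>
    classical
    have e : regionCrossingChange (D.crossingChange {v | f v = 1}) R =
        D.crossingChange {v | f v + (if v ∈ frontier R then 1 else 0) = 1} := by
      refine crossingChange_crossingChange fun v hv => ?_
      have hv' : v ∈ (D.crossingChange {v | f v = 1}).crossings := hv
      simp only [Set.mem_ofPred_eq, Set.mem_inter_iff, hv', true_and]
      have h0 : ∀ c : ZMod 2, c + 1 = 1 ↔ ¬ c = 1 := by decide
      split_ifs with hR
      · simp [h0, hR]
      · simp [hR]
    rw [List.foldl_cons, e, ih]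
    congr 1
    ext v
    simp only [boundaryCount, List.map_cons, List.sum_cons, Set.mem_ofPred_eq, add_assoc]

/-- If the diagram can be trivialised by some crossing changes, then few region crossing changes
suffice. -/
theorem regionUnknottingNumber_le {S : Set Plane}
    (hS : ∀ T : Set Plane, (∀ v ∈ D.crossings, v ∈ T ↔ v ∈ S) →
      (D.crossingChange T).IsDiagramOfTrivial) :
    ∃ c u : ℕ, D.crossingNumber = c ∧ D.regionUnknottingNumber ≤ u ∧ 2 * u ≤ c + 2 := by
  classical
  obtain ⟨hfin, hcard⟩ := regions_bound (D := D)
  have := Fintype.ofFinite D.regions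
  obtain ⟨x, hx, hxc⟩ := exists_effect_eq_card_le (D := D)
    (fun v => if (v : Plane) ∈ S then 1 else 0)
  set A : Finset D.regions := Finset.univ.filter fun R => x R = 1 with hA
  refine ⟨Nat.card D.crossings, A.card, ?_, ?_, ?_⟩
  · rw [crossingNumber, ← D.finite_crossings.cast_ncard_eq]
    rfl
  · refine sInf_le ⟨A.toList.map Subtype.val, ?_, ?_, ?_, by simp⟩
    · exact (List.nodup_map_iff Subtype.val_injective).2 A.nodup_toList
    · intro R hR
      obtain ⟨R', -, rfl⟩ := List.mem_map.1 hR
      exact R'.2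
    · have e : D.crossingChange {v | (0 : Plane → ZMod 2) v = 1} = D := by
        have : {v | (0 : Plane → ZMod 2) v = 1} = ∅ := by
          ext v
          simp
        rw [this, crossingChange_empty]
      have hfold := foldl_regionCrossingChange (D := D) (A.toList.map Subtype.val) 0
      rw [e] at hfold
      rw [hfold]
      refine hS _ fun v hv => ?_
      have h1 : boundaryCount (A.toList.map Subtype.val) v = effect x ⟨v, hv⟩ := by
        unfold boundaryCount effect
        rw [List.map_map, Finset.sum_map_toList, hA, Finset.sum_filter]
        refine Finset.sum_congr rfl fun R _ => ?_
        have h2 : ∀ c : ZMod 2, c ≠ 1 → c = 0 := by decide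
        simp only [Function.comp]
        by_cases hR : x R = 1
        · rw [if_pos hR, hR]
        · rw [if_neg hR, h2 _ hR, ite_self]
      simp only [Set.mem_ofPred_eq, Pi.zero_apply, zero_add, h1, hx]
      split_ifs with h <;> simp [h]
  · rw [Fintype.card_eq_nat_card] at hxc
    omega

end Diagram

/-! ### Closed polygons indexed by natural numbers -/

section Loop

variable {E : Type*} [AddCommGroup E] [Module ℝ E]

/-- `F 0, …, F N` are the successive vertices of a simple closed polygon with `N` edges. -/
structure IsSimpleLoop (N : ℕ) (F : ℕ → E) : Prop where
  pos : 0 < N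
  closed : F N = F 0
  inj : ∀ i < N, ∀ j < N, ∀ s t : ℝ, 0 ≤ s → s < 1 → 0 ≤ t → t < 1 →
    AffineMap.lineMap (F i) (F (i + 1)) s = AffineMap.lineMap (F j) (F (j + 1)) t → i = j ∧ s = t

/-- The union of the first `N` edges of a polygonal path. -/
def pathSet (N : ℕ) (F : ℕ → E) : Set E := {x | ∃ i < N, x ∈ segment ℝ (F i) (F (i + 1))}

theorem mem_segment_iff_lineMap {a b x : E} : x ∈ segment ℝ a b ↔
    ∃ t : ℝ, 0 ≤ t ∧ t ≤ 1 ∧ AffineMap.lineMap a b t = x := by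
  rw [segment_eq_image_lineMap]
  constructor
  · rintro ⟨t, ⟨h0, h1⟩, h⟩
    exact ⟨t, h0, h1, h⟩
  · rintro ⟨t, h0, h1, h⟩
    exact ⟨t, ⟨h0, h1⟩, h⟩

theorem mem_segment_iff_half_open {a b x : E} : x ∈ segment ℝ a b ↔
    (∃ t : ℝ, 0 ≤ t ∧ t < 1 ∧ AffineMap.lineMap a b t = x) ∨ x = b := by
  rw [mem_segment_iff_lineMap]
  constructor
  · rintro ⟨t, h0, h1, h⟩
    rcases eq_or_lt_of_le h1 with rfl | h1
    · exact Or.inr (by simpa using h.symm)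
    · exact Or.inl ⟨t, h0, h1, h⟩
  · rintro (⟨t, h0, h1, h⟩ | rfl)
    · exact ⟨t, h0, h1.le, h⟩
    · exact ⟨1, zero_le_one, le_rfl, by simp⟩

section ZMod

variable {n : ℕ} [NeZero n]

theorem val_add_one_cases {X : Type*} {F : ℕ → X} (hF : F n = F 0) (i : ZMod n) :
    F (i + 1).val = F (i.val + 1) := by
  have hi := ZMod.val_lt i
  have h : (i + 1).val = (i.val + 1) % n := by
    conv_lhs => rw [← ZMod.natCast_zmod_val i]
    rw [← Nat.cast_succ, ZMod.val_natCast]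
  rcases Nat.lt_or_ge (i.val + 1) n with h1 | h1
  · rw [h, Nat.mod_eq_of_lt h1]
  · have h2 : i.val + 1 = n := by omega
    rw [h, h2, Nat.mod_self, hF]

theorem IsSimpleLoop.injective_point {F : ℕ → E} (h : IsSimpleLoop n F) :
    Function.Injective (point fun i : ZMod n => F i.val) := by
  rintro ⟨i, s⟩ ⟨j, t⟩ hst
  simp only [point, val_add_one_cases h.closed] at hst
  obtain ⟨h1, h2⟩ := h.inj _ (ZMod.val_lt i) _ (ZMod.val_lt j) s t s.2.1 s.2.2 t.2.1 t.2.2 hst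
  rw [ZMod.val_injective n h1, Subtype.ext h2]

theorem trace_eq_pathSet {F : ℕ → E} (hF : F n = F 0) :
    trace (fun i : ZMod n => F i.val) = pathSet n F := by
  have hn : 0 < n := Nat.pos_of_ne_zero (NeZero.ne n)
  ext x
  constructor
  · rintro ⟨⟨i, s⟩, rfl⟩
    refine ⟨i.val, ZMod.val_lt i, ?_⟩
    simp only [point, val_add_one_cases hF]
    exact mem_segment_iff_lineMap.2 ⟨s, s.2.1, s.2.2.le, rfl⟩
  · rintro ⟨i, hi, hx⟩
    rcases mem_segment_iff_half_open.1 hx with ⟨t, h0, h1, rfl⟩ | rfl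
    · refine ⟨((i : ZMod n), ⟨t, h0, h1⟩), ?_⟩
      simp only [point, val_add_one_cases hF, ZMod.val_natCast, Nat.mod_eq_of_lt hi]
    · rcases Nat.lt_or_ge (i + 1) n with h2 | h2
      · refine ⟨(((i + 1 : ℕ) : ZMod n), ⟨0, le_rfl, one_pos⟩), ?_⟩
        simp only [point, AffineMap.lineMap_apply_zero, ZMod.val_natCast, Nat.mod_eq_of_lt h2]
      · refine ⟨((0 : ZMod n), ⟨0, le_rfl, one_pos⟩), ?_⟩
        have h3 : i + 1 = n := by omega
        simp only [point, AffineMap.lineMap_apply_zero, ZMod.val_zero, h3, hF]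

theorem isSimpleLoop_of_injective {p : ZMod n → E} (h : Function.Injective (point p)) :
    IsSimpleLoop n fun i : ℕ => p i where
  pos := Nat.pos_of_ne_zero (NeZero.ne n)
  closed := by simp
  inj := by
    intro i hi j hj s t hs hs' ht ht' hst
    simp only [Nat.cast_succ] at hst
    have := h (a₁ := ((i : ZMod n), ⟨s, hs, hs'⟩)) (a₂ := ((j : ZMod n), ⟨t, ht, ht'⟩)) hst
    refine ⟨?_, congrArg (fun x : Param n => (x.2 : ℝ)) this⟩
    have h1 := congrArg (fun x : Param n => ZMod.val x.1) this
    simp only at h1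
    rwa [ZMod.val_natCast, ZMod.val_natCast, Nat.mod_eq_of_lt hi, Nat.mod_eq_of_lt hj] at h1

theorem pathSet_natCast (p : ZMod n → E) : pathSet n (fun i : ℕ => p i) = trace p := by
  rw [← trace_eq_pathSet (by simp)]
  simp only [ZMod.natCast_zmod_val]

end ZMod

/-- The closed polygon with vertices `V 0, …, V m`. -/
def closeUp {X : Type*} (m : ℕ) (V : ℕ → X) (i : ℕ) : X := if i ≤ m then V i else V 0

theorem closeUp_of_le {X : Type*} {m i : ℕ} (V : ℕ → X) (h : i ≤ m) : closeUp m V i = V i := if_pos h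

theorem closeUp_succ {X : Type*} (m : ℕ) (V : ℕ → X) : closeUp m V (m + 1) = V 0 := if_neg (by omega)

theorem pathSet_closeUp (m : ℕ) (V : ℕ → E) :
    pathSet (m + 1) (closeUp m V) = pathSet m V ∪ segment ℝ (V m) (V 0) := by
  ext x
  constructor
  · rintro ⟨i, hi, hx⟩
    rcases Nat.lt_succ_iff_lt_or_eq.1 hi with hi | rfl
    · rw [closeUp_of_le V hi.le, closeUp_of_le V hi] at hx
      exact Or.inl ⟨i, hi, hx⟩
    · rw [closeUp_of_le V le_rfl, closeUp_succ] at hx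
      exact Or.inr hx
  · rintro (⟨i, hi, hx⟩ | hx)
    · exact ⟨i, by omega, by rwa [closeUp_of_le V hi.le, closeUp_of_le V hi]⟩
    · exact ⟨m, by omega, by rwa [closeUp_of_le V le_rfl, closeUp_succ]⟩

theorem pathSet_succ (m : ℕ) (V : ℕ → E) :
    pathSet (m + 1) V = pathSet m V ∪ segment ℝ (V m) (V (m + 1)) := by
  ext x
  constructor
  · rintro ⟨i, hi, hx⟩
    rcases Nat.lt_succ_iff_lt_or_eq.1 hi with hi | rfl
    · exact Or.inl ⟨i, hi, hx⟩
    · exact Or.inr hx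
  · rintro (⟨i, hi, hx⟩ | hx)
    · exact ⟨i, by omega, hx⟩
    · exact ⟨m, by omega, hx⟩

/-- The closing edge of a simple polygon meets the other edges in its end points only. -/
theorem eq_or_eq_of_mem_closing {m : ℕ} {V : ℕ → E} (h : IsSimpleLoop (m + 1) (closeUp m V))
    {x : E} (hx : x ∈ pathSet m V) (hx' : x ∈ segment ℝ (V m) (V 0)) : x = V m ∨ x = V 0 := by
  obtain ⟨i, hi, hxi⟩ := hx
  rcases mem_segment_iff_half_open.1 hx' with ⟨t, ht0, ht1, ht⟩ | h'
  · left
    have e1 : AffineMap.lineMap (closeUp m V m) (closeUp m V (m + 1)) t = x := by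
      rwa [closeUp_of_le V le_rfl, closeUp_succ]
    rcases mem_segment_iff_half_open.1 hxi with ⟨s, hs0, hs1, hs⟩ | h'
    · have e2 : AffineMap.lineMap (closeUp m V i) (closeUp m V (i + 1)) s = x := by
        rwa [closeUp_of_le V hi.le, closeUp_of_le V hi]
      have := (h.inj i (by omega) m (by omega) s t hs0 hs1 ht0 ht1 (e2.trans e1.symm)).1
      omega
    · have e2 : AffineMap.lineMap (closeUp m V (i + 1)) (closeUp m V (i + 1 + 1)) (0 : ℝ) = x := by
        rw [AffineMap.lineMap_apply_zero, closeUp_of_le V hi, h']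
      have := (h.inj (i + 1) (by omega) m (by omega) 0 t le_rfl one_pos ht0 ht1
        (e2.trans e1.symm)).1
      rw [h', this]
  · exact Or.inr h'

/-! ### Triangles and triangle moves -/

theorem affineIndependent_triple {a b c : E} : AffineIndependent ℝ ![a, b, c] ↔
    ∀ x y : ℝ, x • (b - a) + y • (c - a) = 0 → x = 0 ∧ y = 0 := by
  rw [affineIndependent_iff_linearIndependent_vsub ℝ _ (0 : Fin 3)]
  rw [← LinearIndependent.pair_iff]
  rw [← linearIndependent_equiv (finSuccAboveEquiv (0 : Fin 3))]
  constructor <;> intro h <;> convert h using 1 <;> ext i <;> fin_cases i <;> rfl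

theorem mem_convexHull_triple {a b c x : E} : x ∈ convexHull ℝ {a, b, c} ↔
    ∃ β γ : ℝ, 0 ≤ β ∧ 0 ≤ γ ∧ β + γ ≤ 1 ∧ x = a + β • (b - a) + γ • (c - a) := by
  rw [convexHull_insert (by simp), convexHull_pair, mem_convexJoin]
  simp only [Set.mem_singleton_iff, exists_eq_left, segment_eq_image']
  constructor
  · rintro ⟨_, ⟨u, ⟨hu0, hu1⟩, rfl⟩, v, ⟨hv0, hv1⟩, rfl⟩
    refine ⟨v * (1 - u), v * u, by nlinarith, by positivity, by nlinarith, ?_⟩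
    module
  · rintro ⟨β, γ, hβ, hγ, hβγ, rfl⟩
    rcases eq_or_lt_of_le (add_nonneg hβ hγ) with h | h
    · have h1 : β = 0 := by linarith
      have h2 : γ = 0 := by linarith
      exact ⟨b, ⟨0, by simp, by simp⟩, 0, by simp, by simp [h1, h2]⟩
    · refine ⟨_, ⟨γ / (β + γ), ⟨by positivity, (div_le_one h).2 (by linarith)⟩, rfl⟩, β + γ,
        ⟨h.le, hβγ⟩, ?_⟩
      have e : b + (γ / (β + γ)) • (c - b) - a =
          (1 / (β + γ)) • (β • (b - a) + γ • (c - a)) := by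
        have : β = (β + γ) - γ := by ring
        have h3 : (1 / (β + γ)) * β = 1 - γ / (β + γ) := by
          field_simp
          ring
        rw [smul_add, smul_smul, smul_smul, h3, one_div, inv_mul_eq_div]
        module
      simp only [e, smul_smul, mul_one_div, div_self h.ne', one_smul]
      abel

theorem affine_coords_eq {a b c : E} (h : AffineIndependent ℝ ![a, b, c]) {x y x' y' : ℝ}
    (he : a + x • (b - a) + y • (c - a) = a + x' • (b - a) + y' • (c - a)) : x = x' ∧ y = y' := by
  have h0 : (x - x') • (b - a) + (y - y') • (c - a) = 0 := by
    rw [← sub_eq_zero_of_eq he]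
    module
  have := affineIndependent_triple.1 h _ _ h0
  exact ⟨by linarith [this.1], by linarith [this.2]⟩

/-- Replacing the closing edge of a simple polygon by two sides of a triangle. -/
theorem IsSimpleLoop.append {m : ℕ} {V : ℕ → E} (h : IsSimpleLoop (m + 1) (closeUp m V))
    (hind : AffineIndependent ℝ ![V m, V 0, V (m + 1)])
    (htri : ∀ x ∈ convexHull ℝ {V m, V 0, V (m + 1)}, x ∈ pathSet m V → x ∈ segment ℝ (V m) (V 0)) :
    IsSimpleLoop (m + 1 + 1) (closeUp (m + 1) V) := by
  set a := V m with ha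
  set b := V 0 with hb
  set c := V (m + 1) with hc
  have eac : ∀ t : ℝ, AffineMap.lineMap a c t = a + (0 : ℝ) • (b - a) + t • (c - a) := by
    intro t
    rw [AffineMap.lineMap_apply, vsub_eq_sub, vadd_eq_add]
    module
  have ecb : ∀ t : ℝ, AffineMap.lineMap c b t = a + t • (b - a) + (1 - t) • (c - a) := by
    intro t
    rw [AffineMap.lineMap_apply, vsub_eq_sub, vadd_eq_add]
    module
  have eab : ∀ t : ℝ, AffineMap.lineMap a b t = a + t • (b - a) + (0 : ℝ) • (c - a) := by
    intro t
    rw [AffineMap.lineMap_apply, vsub_eq_sub, vadd_eq_add]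
    module
  have old : ∀ i < m, ∀ s : ℝ, AffineMap.lineMap (closeUp (m + 1) V i)
      (closeUp (m + 1) V (i + 1)) s = AffineMap.lineMap (closeUp m V i) (closeUp m V (i + 1)) s := by
    intro i hi s
    rw [closeUp_of_le V (by omega : i ≤ m + 1), closeUp_of_le V (by omega : i + 1 ≤ m + 1),
      closeUp_of_le V hi.le, closeUp_of_le V hi]
  have new1 : ∀ s : ℝ, AffineMap.lineMap (closeUp (m + 1) V m) (closeUp (m + 1) V (m + 1)) s =
      AffineMap.lineMap a c s := by
    intro s
    rw [closeUp_of_le V (by omega : m ≤ m + 1), closeUp_of_le V le_rfl]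
  have new2 : ∀ s : ℝ, AffineMap.lineMap (closeUp (m + 1) V (m + 1))
      (closeUp (m + 1) V (m + 1 + 1)) s = AffineMap.lineMap c b s := by
    intro s
    rw [closeUp_of_le V le_rfl, closeUp_succ]
  -- In triangle coordinates, an old edge can meet the triangle only where the coordinate along `c -
  -- a` vanishes.
  have hmem : ∀ i < m, ∀ s : ℝ, 0 ≤ s → s < 1 → ∀ β γ : ℝ, 0 ≤ β → 0 ≤ γ → β + γ ≤ 1 →
      AffineMap.lineMap (closeUp m V i) (closeUp m V (i + 1)) s = a + β • (b - a) + γ • (c - a) →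
      ∃ u : ℝ, 0 ≤ u ∧ u ≤ 1 ∧ β = u ∧ γ = 0 := by
    intro i hi s hs0 hs1 β γ hβ hγ hβγ he
    have h1 := htri _ (mem_convexHull_triple.2 ⟨β, γ, hβ, hγ, hβγ, rfl⟩) (by
      rw [← he, closeUp_of_le V hi.le, closeUp_of_le V hi]
      exact ⟨i, hi, mem_segment_iff_lineMap.2 ⟨s, hs0, hs1.le, rfl⟩⟩)
    obtain ⟨u, hu0, hu1, hu⟩ := mem_segment_iff_lineMap.1 h1
    rw [eab] at hu
    have := affine_coords_eq hind hu.symm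
    exact ⟨u, hu0, hu1, this.1, this.2⟩
  -- On the side `ac` that leaves only the point `a`, where the closing edge of the old polygon
  -- starts, so simplicity of the old polygon applies.
  have no1 : ∀ i < m, ∀ s t : ℝ, 0 ≤ s → s < 1 → 0 ≤ t → t < 1 →
      AffineMap.lineMap (closeUp m V i) (closeUp m V (i + 1)) s ≠ AffineMap.lineMap a c t := by
    intro i hi s t hs0 hs1 ht0 ht1 he
    have he' := he
    rw [eac] at he'
    obtain ⟨u, -, -, -, h3⟩ := hmem i hi s hs0 hs1 0 t le_rfl ht0 (by linarith) he'
    rw [h3] at he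
    have : AffineMap.lineMap (closeUp m V m) (closeUp m V (m + 1)) (0 : ℝ) = a := by
      rw [AffineMap.lineMap_apply_zero, closeUp_of_le V le_rfl]
    rw [AffineMap.lineMap_apply_zero, ← this] at he
    have := (h.inj i (by omega) m (by omega) s 0 hs0 hs1 le_rfl one_pos he).1
    omega
  -- On the half-open side from `c` to `b` the coordinate `1 - t` is positive, so no meeting is
  -- possible.
  have no2 : ∀ i < m, ∀ s t : ℝ, 0 ≤ s → s < 1 → 0 ≤ t → t < 1 →
      AffineMap.lineMap (closeUp m V i) (closeUp m V (i + 1)) s ≠ AffineMap.lineMap c b t := by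
    intro i hi s t hs0 hs1 ht0 ht1 he
    rw [ecb] at he
    obtain ⟨u, -, -, -, h3⟩ := hmem i hi s hs0 hs1 t (1 - t) ht0 (by linarith) (by linarith) he
    linarith
  have cases : ∀ i < m + 1 + 1, i < m ∨ i = m ∨ i = m + 1 := fun i hi => by omega
  refine ⟨by omega, ?_, ?_⟩
  · rw [closeUp_succ, closeUp_of_le V (Nat.zero_le _)]
  intro i hi j hj s t hs0 hs1 ht0 ht1 he
  rcases cases i hi with hi | rfl | rfl
  · rw [old i hi] at he
    rcases cases j hj with hj | rfl | rfl
    · rw [old j hj] at he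
      exact h.inj i (by omega) j (by omega) s t hs0 hs1 ht0 ht1 he
    · rw [new1] at he
      exact absurd he (no1 i hi s t hs0 hs1 ht0 ht1)
    · rw [new2] at he
      exact absurd he (no2 i hi s t hs0 hs1 ht0 ht1)
  · rw [new1] at he
    rcases cases j hj with hj | rfl | rfl
    · rw [old j hj] at he
      exact absurd he.symm (no1 j hj t s ht0 ht1 hs0 hs1)
    · rw [new1, eac, eac] at he
      exact ⟨rfl, (affine_coords_eq hind he).2⟩
    · rw [new2, eac, ecb] at he
      have := affine_coords_eq hind he
      linarith [this.1, this.2]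
  · rw [new2] at he
    rcases cases j hj with hj | rfl | rfl
    · rw [old j hj] at he
      exact absurd he.symm (no2 j hj t s ht0 ht1 hs0 hs1)
    · rw [new1, eac, ecb] at he
      have := affine_coords_eq hind he
      linarith [this.1, this.2]
    · rw [new2, ecb, ecb] at he
      exact ⟨rfl, (affine_coords_eq hind he).1⟩

end Loop

/-- The knot given by a simple closed polygon. -/
def Knot.ofLoop {N : ℕ} {F : ℕ → Space} (h : IsSimpleLoop N F) : Knot where
  carrier := pathSet N F
  isPolygon := by
    have : NeZero N := ⟨h.pos.ne'⟩
    exact ⟨N, fun i => F i.val, h.pos, h.injective_point, (trace_eq_pathSet h.closed).symm⟩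

/-- Appending a vertex to a simple closed polygon is a triangle move. -/
theorem triangleMove_append {m : ℕ} {V : ℕ → Space} (h : IsSimpleLoop (m + 1) (closeUp m V))
    (hind : AffineIndependent ℝ ![V m, V 0, V (m + 1)])
    (htri : ∀ x ∈ convexHull ℝ {V m, V 0, V (m + 1)}, x ∈ pathSet m V → x ∈ segment ℝ (V m) (V 0)) :
    (Knot.ofLoop h).TriangleMove (Knot.ofLoop (h.append hind htri)) := by
  have hs : segment ℝ (V m) (V 0) ⊆ convexHull ℝ {V m, V 0, V (m + 1)} := by
    rw [← convexHull_pair]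
    exact convexHull_mono (by
      intro x hx
      simp only [Set.mem_insert_iff, Set.mem_singleton_iff] at hx ⊢
      tauto)
  refine ⟨V m, V 0, V (m + 1), hind, ?_, ?_⟩
  · change _ ∩ pathSet (m + 1) (closeUp m V) = _
    rw [pathSet_closeUp]
    refine Subset.antisymm ?_ fun x hx => ⟨hs hx, Or.inr hx⟩
    rintro x ⟨hx, hx' | hx'⟩
    · exact htri x hx hx'
    · exact hx'
  · change pathSet (m + 1 + 1) (closeUp (m + 1) V) = (pathSet (m + 1) (closeUp m V) \ _) ∪ _
    rw [pathSet_closeUp, pathSet_closeUp, pathSet_succ]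
    ext x
    constructor
    · rintro ((hx | hx) | hx)
      -- Removing the closing segment also removes its end points from the remaining path. The two
      -- new sides put them back.
      · by_cases hx' : x ∈ segment ℝ (V m) (V 0)
        · right
          rcases eq_or_eq_of_mem_closing h hx hx' with rfl | rfl
          · exact Or.inl (left_mem_segment _ _ _)
          · exact Or.inr (right_mem_segment _ _ _)
        · exact Or.inl ⟨Or.inl hx, hx'⟩
      · exact Or.inr (Or.inl hx)
      · exact Or.inr (Or.inr hx)
    · rintro (⟨hx | hx, hx'⟩ | hx | hx)
      · exact Or.inl (Or.inl hx)
      · exact absurd hx hx'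
      · exact Or.inl (Or.inr hx)
      · exact Or.inr hx

/-! ### Every diagram can be lifted to a trivial knot -/

theorem Knot.IsTrivial.of_triangleMove {K K' : Knot} (h : K.IsTrivial) (hK : K.TriangleMove K') :
    K'.IsTrivial := by
  obtain ⟨T, hT, hT'⟩ := h
  exact ⟨T, .trans _ _ _ (.symm _ _ (.rel _ _ hK)) hT, hT'⟩

theorem isSimpleLoop_triangle {E : Type*} [AddCommGroup E] [Module ℝ E] {V : ℕ → E}
    (hind : AffineIndependent ℝ ![V 1, V 0, V 2]) : IsSimpleLoop 3 (closeUp 2 V) := by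
  set a := V 1 with ha
  set b := V 0 with hb
  set c := V 2 with hc
  have e0 : ∀ t : ℝ, AffineMap.lineMap (closeUp 2 V 0) (closeUp 2 V (0 + 1)) t =
      a + (1 - t) • (b - a) + (0 : ℝ) • (c - a) := by
    intro t
    rw [closeUp_of_le V (by omega), closeUp_of_le V (by omega), AffineMap.lineMap_apply,
      vsub_eq_sub, vadd_eq_add, zero_add, ← ha, ← hb]
    module
  have e1 : ∀ t : ℝ, AffineMap.lineMap (closeUp 2 V 1) (closeUp 2 V (1 + 1)) t =
      a + (0 : ℝ) • (b - a) + t • (c - a) := by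
    intro t
    rw [closeUp_of_le V (by omega), closeUp_of_le V (by omega), AffineMap.lineMap_apply,
      vsub_eq_sub, vadd_eq_add, one_add_one_eq_two, ← ha, ← hc]
    module
  have e2 : ∀ t : ℝ, AffineMap.lineMap (closeUp 2 V 2) (closeUp 2 V (2 + 1)) t =
      a + t • (b - a) + (1 - t) • (c - a) := by
    intro t
    rw [closeUp_of_le V (by omega), closeUp_succ, AffineMap.lineMap_apply,
      vsub_eq_sub, vadd_eq_add, ← hb, ← hc]
    module
  refine ⟨by omega, ?_, ?_⟩
  · rw [closeUp_succ, closeUp_of_le V (by omega)]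
  intro i hi j hj s t hs0 hs1 ht0 ht1 he
  have key : ∀ {x y x' y' : ℝ}, a + x • (b - a) + y • (c - a) = a + x' • (b - a) + y' • (c - a) →
    x = x' ∧ y = y' := affine_coords_eq hind
  interval_cases i <;> interval_cases j <;>
    simp only [e0, e1, e2] at he <;> have h := key he <;>
    first
    | exact ⟨rfl, by linarith [h.1, h.2]⟩
    | (exfalso; linarith [h.1, h.2])

/-! ### Polygons with geometrically growing heights -/

/-- The vertices of a polygon over the plane whose heights grow geometrically, except that the
initial vertex has height zero. -/
def spiral (v : ℕ → Plane) (ρ : ℝ) (i : ℕ) : Space := (v i, if i = 0 then 0 else ρ ^ i)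

section Spiral

variable {v : ℕ → Plane} {ρ M : ℝ} {n : ℕ}

theorem spiral_zero : spiral v ρ 0 = (v 0, 0) := by simp [spiral]

theorem spiral_pos {i : ℕ} (hi : i ≠ 0) : spiral v ρ i = (v i, ρ ^ i) := by simp [spiral, hi]

/-- The growth condition: seen from the initial vertex, the edges are not too close. -/
def IsSteep (v : ℕ → Plane) (ρ M : ℝ) (n : ℕ) : Prop :=
  1 < ρ ∧ (∀ i, i < n → ‖v i - v 0‖ ≤ M) ∧ ∀ i, 1 ≤ i → i + 1 < n → ∀ a b : ℝ, 0 ≤ a → 0 ≤ b →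
    ρ * ‖a • (v i - v 0) + b • (v (i + 1) - v 0)‖ ≤ M * (a + b) → a + b = 0

/-- The heights force any nontrivial relation to say that `v (m + 1) - v 0` is `ρ` times `v m - v
0`. Steepness makes this too long for the bound `M`. -/
theorem IsSteep.affineIndependent (h : IsSteep v ρ M n) {m : ℕ} (hm : 1 ≤ m) (hmn : m + 1 < n) :
    AffineIndependent ℝ ![spiral v ρ m, spiral v ρ 0, spiral v ρ (m + 1)] := by
  obtain ⟨h1, hM, H⟩ := h
  have hρ : 0 < ρ := by linarith
  rw [affineIndependent_triple]
  intro x y hxy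
  rw [spiral_zero, spiral_pos (by omega), spiral_pos (by omega)] at hxy
  have e1 := congrArg Prod.fst hxy
  have e2 := congrArg Prod.snd hxy
  simp only [Prod.fst_add, Prod.snd_add, Prod.smul_fst, Prod.smul_snd, Prod.fst_sub, Prod.snd_sub,
    Prod.fst_zero, Prod.snd_zero, smul_eq_mul] at e1 e2
  have hpm : 0 < ρ ^ m := by positivity
  have e3 : x = y * (ρ - 1) := by
    have : ρ ^ m * (x - y * (ρ - 1)) = 0 := by
      rw [pow_succ] at e2
      linarith
    rcases mul_eq_zero.1 this with h | h
    · exact absurd h hpm.ne'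
    · linarith
  have e4 : y • (v (m + 1) - v 0) = (y * ρ) • (v m - v 0) := by
    rw [← sub_eq_zero, ← e1, e3]
    module
  have hy : y = 0 := by
    by_contra hy
    have e5 : v (m + 1) - v 0 = ρ • (v m - v 0) := by
      rw [mul_smul] at e4
      exact smul_right_injective _ hy e4
    have := H m hm hmn 1 0 zero_le_one le_rfl (by
      have := hM (m + 1) hmn
      rw [e5, norm_smul, Real.norm_of_nonneg hρ.le] at this
      simpa using this)
    norm_num at this
  exact ⟨by rw [e3, hy, zero_mul], hy⟩

/-- Let `α` and `γ` be the weights of the vertices `m` and `m + 1` at a point of the triangle. Its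
planar offset from `v 0` is at most `M * (α + γ)` and its height at least `ρ ^ m * (α + γ)`. If the
point is also on an earlier, lower edge, then `α + γ` is small, and the offset is too short for a
steep polygon. The first edge, which starts at `v 0`, and the edge ending at vertex `m` need
separate estimates. -/
theorem IsSteep.htri (h : IsSteep v ρ M n) {m : ℕ} (hm : 2 ≤ m) (hmn : m + 1 < n) {x : Space}
    (hx : x ∈ convexHull ℝ {spiral v ρ m, spiral v ρ 0, spiral v ρ (m + 1)})
    (hx' : x ∈ pathSet m (spiral v ρ)) : x ∈ segment ℝ (spiral v ρ m) (spiral v ρ 0) := by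
  obtain ⟨h1, hM, H⟩ := h
  have hρ : 0 < ρ := by linarith
  have hM0 : 0 ≤ M := (norm_nonneg _).trans (hM m (by omega))
  obtain ⟨β, γ, hβ, hγ, hβγ, rfl⟩ := mem_convexHull_triple.1 hx
  obtain ⟨i, hi, hxi⟩ := hx'
  obtain ⟨s, hs0, hs1, hs⟩ := mem_segment_iff_lineMap.1 hxi
  have hpm : 0 < ρ ^ m := by positivity
  set α := 1 - β - γ with hα
  have hα0 : 0 ≤ α := by linarith
  have nrm : ‖α • (v m - v 0) + γ • (v (m + 1) - v 0)‖ ≤ M * (α + γ) := by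
    refine (norm_add_le _ _).trans ?_
    rw [norm_smul, norm_smul, Real.norm_of_nonneg hα0, Real.norm_of_nonneg hγ]
    nlinarith [hM m (by omega), hM (m + 1) hmn]
  have conclude : γ = 0 → spiral v ρ m + β • (spiral v ρ 0 - spiral v ρ m) +
      γ • (spiral v ρ (m + 1) - spiral v ρ m) ∈ segment ℝ (spiral v ρ m) (spiral v ρ 0) := by
    intro h
    refine mem_segment_iff_lineMap.2 ⟨β, hβ, by linarith, ?_⟩
    rw [AffineMap.lineMap_apply, vsub_eq_sub, vadd_eq_add, h]
    module
  rw [AffineMap.lineMap_apply, vsub_eq_sub, vadd_eq_add, spiral_pos (show m ≠ 0 by omega),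
    spiral_pos (show m + 1 ≠ 0 by omega), spiral_zero, spiral_pos (show i + 1 ≠ 0 by omega)] at hs
  have e1 := congrArg Prod.fst hs
  have e2 := congrArg Prod.snd hs
  rcases Nat.eq_zero_or_pos i with rfl | hi0
  · rw [spiral_zero] at e1 e2
    simp only [Prod.fst_add, Prod.snd_add, Prod.smul_fst, Prod.smul_snd, Prod.fst_sub,
      Prod.snd_sub, smul_eq_mul, zero_add, pow_one] at e1 e2
    have e3 : s • (v 1 - v 0) = α • (v m - v 0) + γ • (v (m + 1) - v 0) := by
      rw [eq_sub_of_add_eq e1, hα]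
      module
    have e4 : ρ * (α + γ) ≤ s := by
      have h2 : s * ρ = ρ ^ m * (α + γ * ρ) := by
        rw [pow_succ] at e2
        rw [hα]
        linarith
      have h3 : ρ ^ 2 ≤ ρ ^ m := pow_le_pow_right₀ h1.le hm
      have h4 : ρ ^ 2 * (α + γ) ≤ s * ρ := by
        rw [h2]
        refine mul_le_mul h3 ?_ (by positivity) hpm.le
        nlinarith
      have h5 : ρ * (ρ * (α + γ)) ≤ ρ * s := by linarith [sq ρ]
      exact le_of_mul_le_mul_left h5 hρ
    have h6 := H 1 le_rfl (by omega) s 0 hs0 le_rfl (by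
      rw [zero_smul, add_zero, e3, add_zero]
      calc ρ * ‖α • (v m - v 0) + γ • (v (m + 1) - v 0)‖ ≤ ρ * (M * (α + γ)) := by gcongr
        _ = M * (ρ * (α + γ)) := by ring
        _ ≤ M * s := by gcongr)
    exact conclude (by nlinarith)
  · rw [spiral_pos (show i ≠ 0 by omega)] at e1 e2
    simp only [Prod.fst_add, Prod.snd_add, Prod.smul_fst, Prod.smul_snd, Prod.fst_sub,
      Prod.snd_sub, smul_eq_mul] at e1 e2
    have e3 : (1 - s) • (v i - v 0) + s • (v (i + 1) - v 0) =
        α • (v m - v 0) + γ • (v (m + 1) - v 0) := by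
      have : (1 - s) • (v i - v 0) + s • (v (i + 1) - v 0) = s • (v (i + 1) - v i) + v i - v 0 := by
        module
      rw [this, e1, hα]
      module
    have e4 : (1 - s) * ρ ^ i + s * ρ ^ (i + 1) = ρ ^ m * (α + γ * ρ) := by
      rw [pow_succ ρ m] at e2
      rw [hα]
      linarith
    rcases Nat.lt_or_ge (i + 1) m with him | him
    · exfalso
      have h2 : (1 - s) * ρ ^ i + s * ρ ^ (i + 1) ≤ ρ ^ (i + 1) := by
        have : ρ ^ i ≤ ρ ^ (i + 1) := pow_le_pow_right₀ h1.le (by omega)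
        nlinarith
      have h3 : ρ * ρ ^ (i + 1) ≤ ρ ^ m := by
        rw [← pow_succ']
        exact pow_le_pow_right₀ h1.le (by omega)
      have hp : 0 < ρ ^ (i + 1) := by positivity
      have h4 : ρ * (α + γ) ≤ 1 := by
        have h5 : ρ ^ (i + 1) * (ρ * (α + γ)) ≤ ρ ^ (i + 1) * 1 := by
          calc ρ ^ (i + 1) * (ρ * (α + γ)) = (ρ * ρ ^ (i + 1)) * (α + γ) := by ring
            _ ≤ ρ ^ m * (α + γ * ρ) := by
              refine mul_le_mul h3 ?_ (by positivity) hpm.le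
              nlinarith
            _ ≤ ρ ^ (i + 1) * 1 := by rw [← e4, mul_one]; exact h2
        exact le_of_mul_le_mul_left h5 hp
      have := H i hi0 (by omega) (1 - s) s (by linarith) hs0 (by
        rw [e3]
        calc ρ * ‖α • (v m - v 0) + γ • (v (m + 1) - v 0)‖ ≤ ρ * (M * (α + γ)) := by gcongr
          _ = M * (ρ * (α + γ)) := by ring
          _ ≤ M * 1 := by gcongr
          _ = M * (1 - s + s) := by ring)
      linarith
    · obtain rfl : m = i + 1 := by omega
      have e5 : (1 - s) + s * ρ = ρ * (α + γ * ρ) := by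
        have hp : 0 < ρ ^ i := by positivity
        have : ρ ^ i * ((1 - s) + s * ρ) = ρ ^ i * (ρ * (α + γ * ρ)) := by
          rw [pow_succ] at e4
          linarith
        exact mul_left_cancel₀ hp.ne' this
      -- On the edge ending at vertex `m`, eliminating `α` between the planar and the height
      -- equation puts the relation in the form to which steepness applies.
      have e6 : ρ • ((1 - s) • (v i - v 0) + (γ * ρ) • (v (i + 1) - v 0)) =
          (γ * ρ) • (v (i + 1 + 1) - v 0) + (1 - s) • (v (i + 1) - v 0) := by
        have h7 : (1 - s) • (v i - v 0) = α • (v (i + 1) - v 0) + γ • (v (i + 1 + 1) - v 0) -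
          s • (v (i + 1) - v 0) := by rw [← e3]; abel
        have h8 : 1 - s = ρ * (α + γ * ρ) - s * ρ := by linarith
        rw [h7, h8]
        module
      have h9 := H i hi0 (by omega) (1 - s) (γ * ρ) (by linarith) (by positivity) (by
        rw [← Real.norm_of_nonneg hρ.le, ← norm_smul, Real.norm_of_nonneg hρ.le, e6]
        refine (norm_add_le _ _).trans ?_
        have hs' : 0 ≤ 1 - s := by linarith
        have hγ' : 0 ≤ γ * ρ := by positivity
        rw [norm_smul, norm_smul, Real.norm_of_nonneg hs', Real.norm_of_nonneg hγ']
        nlinarith [hM (i + 1) (by omega), hM (i + 1 + 1) hmn])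
      have h10 : γ * ρ = 0 := by nlinarith [mul_nonneg hγ hρ.le]
      exact conclude ((mul_eq_zero.1 h10).resolve_right hρ.ne')

/-- Start from the triangle on the first three vertices and append the others one at a time. By
`IsSteep.htri` each step is a triangle move. -/
theorem IsSteep.exists_isTrivial (h : IsSteep v ρ M n) {m : ℕ} (hm : 2 ≤ m) (hmn : m < n) :
    ∃ hl : IsSimpleLoop (m + 1) (closeUp m (spiral v ρ)), (Knot.ofLoop hl).IsTrivial := by
  induction m, hm using Nat.le_induction with
  | base =>
    have hind := h.affineIndependent le_rfl (by omega : 1 + 1 < n)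
    refine ⟨isSimpleLoop_triangle hind, _, .refl _, _, _, _, hind, ?_⟩
    change pathSet 3 (closeUp 2 (spiral v ρ)) = _
    rw [pathSet_closeUp, pathSet_succ, pathSet_succ]
    have : pathSet 0 (spiral v ρ) = ∅ := by
      ext x
      simp [pathSet]
    rw [this, empty_union, segment_symm ℝ (spiral v ρ 0) (spiral v ρ (0 + 1)),
      segment_symm ℝ (spiral v ρ (0 + 1)) (spiral v ρ (1 + 1)), segment_symm ℝ (spiral v ρ 2)
        (spiral v ρ 0)]
    ext x
    simp only [Set.mem_union, zero_add, one_add_one_eq_two]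
    tauto
  | succ m hm ih =>
    obtain ⟨hl, ht⟩ := ih (by omega)
    have hind := h.affineIndependent (by omega) hmn
    exact ⟨hl.append hind fun x hx hx' => h.htri hm hmn hx hx',
      ht.of_triangleMove
      (triangleMove_append hl hind fun x hx hx' => h.htri hm hmn hx hx')⟩

/-- The initial vertex is off the compact edges in question, hence at positive distance from each,
and a large `ρ` beats these finitely many distances. The sum of the distances to the initial vertex
serves as `M`. -/
theorem exists_isSteep (hv : ∀ i, 1 ≤ i → i + 1 < n → v 0 ∉ segment ℝ (v i) (v (i + 1))) :
    ∃ ρ M, IsSteep v ρ M n := by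
  set M := ∑ i ∈ Finset.range n, ‖v i - v 0‖ with hM
  have key : ∀ i ∈ Finset.range n, ∀ᶠ ρ : ℝ in atTop, 1 ≤ i → i + 1 < n →
      ∀ s ∈ Icc (0 : ℝ) 1, M < ρ * ‖(1 - s) • (v i - v 0) + s • (v (i + 1) - v 0)‖ := by
    intro i _
    by_cases hi : 1 ≤ i ∧ i + 1 < n
    swap
    · exact Eventually.of_forall fun ρ h1 h2 => absurd ⟨h1, h2⟩ hi
    obtain ⟨s₀, hs₀, hmin⟩ := isCompact_Icc.exists_isMinOn (nonempty_Icc.2 zero_le_one)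
      (f := fun s : ℝ => ‖(1 - s) • (v i - v 0) + s • (v (i + 1) - v 0)‖)
      (by fun_prop : Continuous _).continuousOn
    have hpos : 0 < ‖(1 - s₀) • (v i - v 0) + s₀ • (v (i + 1) - v 0)‖ := by
      refine norm_pos_iff.2 fun h0 => hv i hi.1 hi.2 ?_
      refine mem_segment_iff_lineMap.2 ⟨s₀, hs₀.1, hs₀.2, ?_⟩
      rw [AffineMap.lineMap_apply, vsub_eq_sub, vadd_eq_add, ← sub_eq_zero, ← h0]
      module
    filter_upwards [(tendsto_id.atTop_mul_const hpos).eventually_gt_atTop M,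
      eventually_ge_atTop 0] with ρ h1 h2 _ _ s hs
    exact lt_of_lt_of_le h1 (mul_le_mul_of_nonneg_left (hmin hs) h2)
  obtain ⟨ρ, hρ, h1⟩ := (((Finset.eventually_all _).2 key).and (eventually_gt_atTop 1)).exists
  refine ⟨ρ, M, h1, fun i hi => ?_, fun i hi hin a b ha hb hab => ?_⟩
  · exact Finset.single_le_sum (f := fun i => ‖v i - v 0‖) (fun _ _ => norm_nonneg _)
      (Finset.mem_range.2 hi)
  · by_contra hne
    have hpos : 0 < a + b := lt_of_le_of_ne (by positivity) (Ne.symm hne)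
    have h2 := hρ i (Finset.mem_range.2 (by omega)) hi hin (b / (a + b))
      ⟨by positivity, (div_le_one hpos).2 (by linarith)⟩
    -- The condition is homogeneous in `a` and `b`, so it reduces to points of the edge itself.
    have h3 : a • (v i - v 0) + b • (v (i + 1) - v 0) =
        (a + b) • ((1 - b / (a + b)) • (v i - v 0) + (b / (a + b)) • (v (i + 1) - v 0)) := by
      rw [smul_add, smul_smul, smul_smul, mul_sub, mul_div_cancel₀ _ hne, mul_one,
        add_sub_cancel_right]
    rw [h3, norm_smul, Real.norm_of_nonneg hpos.le] at hab
    nlinarith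

end Spiral

theorem Diagram.isLift_of_eq_trace {D : Diagram} {K : Knot} (q : ZMod D.n → Space)
    (hq : ∀ i, (q i).1 = D.vertex i)
    (hup : ∀ x y : Param D.n, x ≠ y → point D.vertex x = point D.vertex y → x ∈ D.upper →
      (point q y).2 < (point q x).2) (hK : K.carrier = trace q) : D.IsLift K := by
  have hfst : ∀ x, (point q x).1 = point D.vertex x := by
    intro x
    simp [point, AffineMap.lineMap_apply, hq]
  have hsnd : ∀ x, (point q x).2 = AffineMap.lineMap (q x.1).2 (q (x.1 + 1)).2 (x.2 : ℝ) := by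
    intro x
    simp [point, AffineMap.lineMap_apply]
  refine ⟨fun i t => AffineMap.lineMap (q i).2 (q (i + 1)).2 t, fun i => ?_, fun i => ?_, ?_, ?_⟩
  · exact (by fun_prop : Continuous _).continuousOn
  · simp
  · intro x y hxy h hx
    simpa only [hsnd] using hup x y hxy h hx
  · rw [hK, trace]
    congr 1
    ext1 x
    exact Prod.ext (hfst x) (hsnd x)

/-! ### Choosing crossings that trivialise a diagram -/

namespace Diagram

variable (D : Diagram)

theorem eq_of_point_eq_vertex {i : ZMod D.n} {y : Param D.n}
    (h : point D.vertex y = D.vertex i) : y = (i, ⟨0, le_rfl, one_pos⟩) := by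
  by_contra hne
  exact (D.transverse (i, ⟨0, le_rfl, one_pos⟩) y (Ne.symm hne)
    (by rw [h]; simp [point])).1 rfl

/-- With two vertices both edges run along one segment in opposite directions, so their common
midpoint is a double point with dependent directions. With a single vertex the edge is degenerate.
-/
theorem three_le_n : 3 ≤ D.n := by
  have hpos := D.n_pos
  have h0 := D.vertex_ne 0
  by_contra hlt
  have hn : (2 : ZMod D.n) = 0 := by
    have h : D.n ∣ 2 := by
      rcases (by omega : D.n = 1 ∨ D.n = 2) with h | h <;> rw [h]
      exact one_dvd _
    exact_mod_cast (ZMod.natCast_eq_zero_iff 2 D.n).2 h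
  have h1 : (1 : ZMod D.n) + 1 = 0 := by rw [one_add_one_eq_two, hn]
  have half : (1 / 2 : ℝ) ∈ Ico (0 : ℝ) 1 := by norm_num
  have hne : ((0 : ZMod D.n), (⟨1 / 2, half⟩ : Ico (0 : ℝ) 1)) ≠ (1, ⟨1 / 2, half⟩) := by
    intro h
    have h2 : (0 : ZMod D.n) = 1 := congrArg Prod.fst h
    exact h0 (by rw [← h2, add_zero])
  have hli := (D.transverse _ _ hne (by
    simp only [point, h1, zero_add, AffineMap.lineMap_apply, vsub_eq_sub, vadd_eq_add]
    module)).2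
  simp only [h1, zero_add] at hli
  have := (LinearIndependent.pair_iff.1 hli) 1 1 (by module)
  exact one_ne_zero this.1

/-- Every diagram becomes a diagram of the trivial knot by suitable crossing changes. -/
theorem exists_isDiagramOfTrivial : ∃ S : Set Plane,
    ∀ T : Set Plane, (∀ v ∈ D.crossings, v ∈ T ↔ v ∈ S) → (D.crossingChange T).IsDiagramOfTrivial := by
  have : NeZero D.n := ⟨D.n_pos.ne'⟩
  have h3 := D.three_le_n
  set v : ℕ → Plane := fun i => D.vertex i with hv
  have hcast : ∀ {i : ℕ}, 1 ≤ i → i < D.n → (i : ZMod D.n) ≠ 0 := by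
    intro i h1 h2 h
    have := congrArg ZMod.val h
    rw [ZMod.val_natCast, Nat.mod_eq_of_lt h2, ZMod.val_zero] at this
    omega
  -- A vertex of a diagram is never a double point, so the initial vertex is not on any of these
  -- edges.
  have hv0 : ∀ i, 1 ≤ i → i + 1 < D.n → v 0 ∉ segment ℝ (v i) (v (i + 1)) := by
    intro i hi hin hmem
    rcases mem_segment_iff_half_open.1 hmem with ⟨t, ht0, ht1, ht⟩ | h
    · have := D.eq_of_point_eq_vertex (i := 0) (y := ((i : ZMod D.n), ⟨t, ht0, ht1⟩)) (by
        simpa [point, hv] using ht)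
      exact hcast hi (by omega) (congrArg Prod.fst this)
    · have := D.eq_of_point_eq_vertex (i := 0)
        (y := (((i + 1 : ℕ) : ZMod D.n), ⟨0, le_rfl, one_pos⟩)) (by
        simpa [point, hv] using h.symm)
      exact hcast (by omega) hin (congrArg Prod.fst this)
  obtain ⟨ρ, M, hs⟩ := exists_isSteep hv0
  obtain ⟨hl, ht⟩ := hs.exists_isTrivial (m := D.n - 1) (by omega) (by omega)
  have hn : D.n - 1 + 1 = D.n := by omega
  set F := closeUp (D.n - 1) (spiral v ρ) with hF
  set K := Knot.ofLoop hl with hK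
  have hl' : IsSimpleLoop D.n F := by rwa [hn] at hl
  set q : ZMod D.n → Space := fun i => F i.val with hq
  have hq1 : ∀ i, (q i).1 = D.vertex i := by
    intro i
    have hi := ZMod.val_lt i
    simp only [hq, hF]
    rw [closeUp_of_le _ (by omega)]
    simp [spiral, hv]
  have hKq : K.carrier = trace q := by
    rw [hq, trace_eq_pathSet hl'.closed]
    change pathSet (D.n - 1 + 1) F = _
    rw [hn]
  have hinj : Function.Injective (point q) := hl'.injective_point
  have hfst : ∀ x, (point q x).1 = point D.vertex x := by
    intro x
    simp [point, AffineMap.lineMap_apply, hq1]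
  have hne : ∀ x y : Param D.n, x ≠ y → point D.vertex x = point D.vertex y →
      (point q x).2 ≠ (point q y).2 := by
    intro x y hxy h h'
    exact hxy (hinj (Prod.ext (by rw [hfst, hfst, h]) h'))
  -- The crossings to change are those where the strand marked as upper is the lower one on the
  -- spiral polygon.
  refine ⟨{w | ∃ x y : Param D.n, x ≠ y ∧ point D.vertex x = w ∧ point D.vertex y = w ∧
    x ∈ D.upper ∧ (point q x).2 < (point q y).2}, fun T hT => ⟨K, ht, K, ?_, .refl _⟩⟩
  refine Diagram.isLift_of_eq_trace (D := D.crossingChange T) q hq1 ?_ hKq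
  rintro x y hxy h ⟨-, hx⟩
  change point D.vertex x = point D.vertex y at h
  have hT' := hT (point D.vertex x) ⟨x, y, hxy, rfl, h.symm⟩
  by_cases hxu : x ∈ D.upper
  · have h1 := fun h' => (hx.1 hxu) (hT'.2 h')
    refine lt_of_le_of_ne (not_lt.1 fun hlt => h1 ⟨x, y, hxy, rfl, h.symm, hxu, hlt⟩)
      (hne y x hxy.symm h.symm)
  · obtain ⟨x', y', hxy', e1, e2, hu, hlt⟩ := hT'.1 (by
      by_contra h'
      exact hxu (hx.2 h'))
    have hx' : x' = y := by
      rcases D.no_triple x' y x (e1.trans h) h.symm with h | h | h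
      · exact h
      · exact absurd h.symm hxy
      · exact absurd (h ▸ hu) hxu
    have hy' : y' = x := by
      rcases D.no_triple y' x y e2 h with h | h | h
      · exact h
      · exact absurd h hxy
      · exact absurd (hx'.trans h.symm) hxy'
    rwa [hx', hy'] at hlt

end Diagram

/-! ### Small perturbations of a simple polygon -/

section Simple

variable {E : Type*} [AddCommGroup E] [Module ℝ E]

theorem ne_of_injective_point {n : ℕ} {p : ZMod n → E} (h : Function.Injective (point p))
    (i : ZMod n) : p i ≠ p (i + 1) := by
  intro he
  have := @h (i, ⟨0, le_rfl, one_pos⟩) (i, ⟨1 / 2, by norm_num⟩) (by simp [point, he])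
  have h2 := congrArg (fun x : Param n => (x.2 : ℝ)) this
  norm_num at h2

/-- A polygon is simple if and only if non-adjacent edges are disjoint and adjacent edges do not
point in opposite directions. -/
theorem injective_point_iff {n : ℕ} {p : ZMod n → E} : Function.Injective (point p) ↔
    (∀ i j, j ≠ i ∧ j ≠ i + 1 ∧ i ≠ j + 1 → ∀ z ∈ Icc (0 : ℝ) 1 ×ˢ Icc (0 : ℝ) 1,
      AffineMap.lineMap (p i) (p (i + 1)) z.1 - AffineMap.lineMap (p j) (p (j + 1)) z.2 ≠ 0) ∧
    ∀ i, ∀ s ∈ Icc (0 : ℝ) 1, (1 - s) • (p i - p (i + 1)) + s • (p (i + 1) - p (i + 1 + 1)) ≠ 0 := by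
  constructor
  · intro h
    have hv : ∀ i, point p (i, ⟨0, le_rfl, one_pos⟩) = p i := fun i => by simp [point]
    constructor
    · rintro i j ⟨hij, hij1, hji1⟩ ⟨s, t⟩ ⟨⟨hs0, hs1⟩, ht0, ht1⟩ he
      rw [sub_eq_zero] at he
      simp only at hs0 hs1 ht0 ht1 he
      rcases eq_or_lt_of_le hs1 with rfl | hs1 <;> rcases eq_or_lt_of_le ht1 with rfl | ht1
      · rw [AffineMap.lineMap_apply_one, AffineMap.lineMap_apply_one, ← hv, ← hv] at he
        exact hij (add_right_cancel (congrArg Prod.fst (h he))).symm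
      · rw [AffineMap.lineMap_apply_one, ← hv] at he
        exact hij1 (congrArg Prod.fst (@h _ (j, ⟨t, ht0, ht1⟩) he)).symm
      · rw [AffineMap.lineMap_apply_one, ← hv (j + 1)] at he
        exact hji1 (congrArg Prod.fst (@h (i, ⟨s, hs0, hs1⟩) _ he))
      · exact hij (congrArg Prod.fst (@h (i, ⟨s, hs0, hs1⟩) (j, ⟨t, ht0, ht1⟩) he)).symm
    · rintro i s ⟨hs0, hs1⟩ he
      rcases eq_or_lt_of_le hs1 with rfl | hs1
      · refine ne_of_injective_point h (i + 1) ?_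
        simpa [sub_eq_zero] using he
      · have h1 := @h (i, ⟨s, hs0, hs1⟩) (i + 1, ⟨s, hs0, hs1⟩) (by
          simp only [point, AffineMap.lineMap_apply, vsub_eq_sub, vadd_eq_add]
          rw [← sub_eq_zero, ← he]
          module)
        have h2 : i = i + 1 := congrArg Prod.fst h1
        exact ne_of_injective_point h i (by rw [← h2])
  · rintro ⟨h1, h2⟩
    have adj : ∀ (i : ZMod n) (s t : ℝ), s < 1 → 0 ≤ t →
        AffineMap.lineMap (p i) (p (i + 1)) s ≠ AffineMap.lineMap (p (i + 1)) (p (i + 1 + 1)) t := by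
      intro i s t hs ht he
      have hpos : 0 < 1 - s + t := by linarith
      refine h2 i (t / (1 - s + t)) ⟨by positivity, (div_le_one hpos).2 (by linarith)⟩ ?_
      have e : 1 - t / (1 - s + t) = (1 - s + t)⁻¹ * (1 - s) := by
        field_simp
        ring
      rw [e, div_eq_inv_mul, mul_smul, mul_smul, ← smul_add]
      simp only [AffineMap.lineMap_apply, vsub_eq_sub, vadd_eq_add] at he
      rw [← sub_eq_zero] at he
      have e2 : (1 - s) • (p i - p (i + 1)) + t • (p (i + 1) - p (i + 1 + 1)) = 0 := by
        rw [← he]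
        module
      rw [e2, smul_zero]
    rintro ⟨i, s, hs0, hs1⟩ ⟨j, t, ht0, ht1⟩ he
    simp only [point] at he
    by_cases hij : j = i
    · subst hij
      have hne : p j ≠ p (j + 1) := by
        intro h
        exact h2 j 0 (by simp) (by simp [h])
      have := AffineMap.lineMap_injective ℝ hne he
      subst this
      rfl
    · by_cases hij1 : j = i + 1
      · subst hij1
        exact absurd he (adj i s t hs1 ht0)
      · by_cases hji1 : i = j + 1
        · subst hji1
          exact absurd he.symm (adj j t s ht1 hs0)
        · exact absurd (sub_eq_zero.2 he)
            (h1 i j ⟨hij, hij1, hji1⟩ (s, t) ⟨⟨hs0, hs1.le⟩, ht0, ht1.le⟩)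

theorem ne_add_two_of_injective_point {n : ℕ} {p : ZMod n → E} (h : Function.Injective (point p))
    (i : ZMod n) : i ≠ i + 1 + 1 := by
  intro he
  refine (injective_point_iff.1 h).2 i (1 / 2) (by norm_num) ?_
  rw [← he]
  module

end Simple

/-- By `injective_point_iff`, simplicity is a finite list of non-vanishing conditions over compact
parameter sets, and such conditions are open. -/
theorem eventually_injective_point {n : ℕ} [NeZero n] {p : ZMod n → Space}
    (h : Function.Injective (point p)) : ∀ᶠ q in 𝓝 p, Function.Injective (point q) := by
  simp only [injective_point_iff, eventually_and, eventually_all]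
  obtain ⟨h1, h2⟩ := injective_point_iff.1 h
  constructor
  · intro i j hij
    refine (isCompact_Icc.prod isCompact_Icc).eventually_forall_of_forall_eventually fun z hz => ?_
    have hc : Continuous fun a : (ZMod n → Space) × (ℝ × ℝ) =>
        AffineMap.lineMap (a.1 i) (a.1 (i + 1)) a.2.1 -
          AffineMap.lineMap (a.1 j) (a.1 (j + 1)) a.2.2 := by
      simp only [AffineMap.lineMap_apply, vsub_eq_sub, vadd_eq_add]
      fun_prop
    exact hc.continuousAt.eventually_ne (h1 i j hij z hz)
  · intro i
    refine isCompact_Icc.eventually_forall_of_forall_eventually fun s hs => ?_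
    have hc : Continuous fun a : (ZMod n → Space) × ℝ =>
        (1 - a.2) • (a.1 i - a.1 (i + 1)) + a.2 • (a.1 (i + 1) - a.1 (i + 1 + 1)) := by
      fun_prop
    exact hc.continuousAt.eventually_ne (h2 i s hs)

section Loop

variable {E : Type*} [AddCommGroup E] [Module ℝ E]

theorem IsSimpleLoop.congr {N : ℕ} {F G : ℕ → E} (h : IsSimpleLoop N F) (hFG : ∀ i ≤ N, F i = G i) :
    IsSimpleLoop N G where
  pos := h.pos
  closed := by rw [← hFG N le_rfl, ← hFG 0 (Nat.zero_le _), h.closed]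
  inj i hi j hj := by
    rw [← hFG i hi.le, ← hFG j hj.le, ← hFG (i + 1) hi, ← hFG (j + 1) hj]
    exact h.inj i hi j hj

theorem pathSet_congr {N : ℕ} {F G : ℕ → E} (hFG : ∀ i ≤ N, F i = G i) :
    pathSet N F = pathSet N G := by
  ext x
  constructor <;> rintro ⟨i, hi, hx⟩ <;> refine ⟨i, hi, ?_⟩
  · rwa [← hFG i hi.le, ← hFG (i + 1) hi]
  · rwa [hFG i hi.le, hFG (i + 1) hi]

theorem pathSet_succ' (m : ℕ) (V : ℕ → E) :
    pathSet (m + 1) V = segment ℝ (V 0) (V 1) ∪ pathSet m fun i => V (i + 1) := by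
  ext x
  constructor
  · rintro ⟨i, hi, hx⟩
    rcases i with _ | i
    · exact Or.inl hx
    · exact Or.inr ⟨i, by omega, hx⟩
  · rintro (hx | ⟨i, hi, hx⟩)
    · exact ⟨0, by omega, hx⟩
    · exact ⟨i + 1, by omega, hx⟩

theorem IsSimpleLoop.ne {N : ℕ} {F : ℕ → E} (h : IsSimpleLoop N F) {i : ℕ} (hi : i < N) :
    F i ≠ F (i + 1) := by
  intro he
  have := (h.inj i hi i hi 0 (1 / 2) le_rfl one_pos (by norm_num) (by norm_num) (by simp [he])).2
  norm_num at this

/-- Two edges of a simple closed polygon meet in a common end point only. -/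
theorem IsSimpleLoop.edge_inter {N : ℕ} {F : ℕ → E} (h : IsSimpleLoop N F) {i j : ℕ} (hij : i < j)
    (hj : j < N) {x : E} (hi : x ∈ segment ℝ (F i) (F (i + 1)))
    (hx : x ∈ segment ℝ (F j) (F (j + 1))) :
    (j = i + 1 ∧ x = F j) ∨ (i = 0 ∧ j + 1 = N ∧ x = F 0) := by
  have start : ∀ k, AffineMap.lineMap (F k) (F (k + 1)) (0 : ℝ) = F k := fun k => by simp
  have inj0 : ∀ {k l : ℕ} {s : ℝ}, k < N → l < N → 0 ≤ s → s < 1 →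
      AffineMap.lineMap (F k) (F (k + 1)) s = F l → k = l := by
    intro k l s hk hl hs0 hs1 he
    exact (h.inj k hk l hl s 0 hs0 hs1 le_rfl one_pos (he.trans (start l).symm)).1
  have last : j + 1 < N ∨ j + 1 = N := by omega
  rcases mem_segment_iff_half_open.1 hi with ⟨s, hs0, hs1, hs⟩ | h1 <;>
    rcases mem_segment_iff_half_open.1 hx with ⟨t, ht0, ht1, ht⟩ | h2
  · have := (h.inj i (by omega) j hj s t hs0 hs1 ht0 ht1 (hs.trans ht.symm)).1
    omega
  · rcases last with hl | hl
    · have := inj0 (by omega) hl hs0 hs1 (hs.trans h2)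
      omega
    · rw [hl, h.closed] at h2
      exact Or.inr ⟨inj0 (by omega) h.pos hs0 hs1 (hs.trans h2), hl, h2⟩
  · have := inj0 hj (by omega) ht0 ht1 (ht.trans h1)
    exact Or.inl ⟨this, by rw [h1, this]⟩
  · have e := h1.symm.trans h2
    rcases last with hl | hl
    · rw [← start] at e
      have := inj0 (by omega) hl le_rfl one_pos e
      omega
    · rw [hl, h.closed, ← start] at e
      have := inj0 (by omega) h.pos le_rfl one_pos e
      omega

end Loop

/-- The knot given by a simple polygon. -/
def Knot.ofPolygon {n : ℕ} [NeZero n] {p : ZMod n → Space} (h : Function.Injective (point p)) :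
    Knot where
  carrier := trace p
  isPolygon := ⟨n, p, Nat.pos_of_ne_zero (NeZero.ne n), h, rfl⟩

theorem injective_point_rotate {E : Type*} [AddCommGroup E] [Module ℝ E] {n : ℕ} {p : ZMod n → E}
    (h : Function.Injective (point p)) (i : ZMod n) : Function.Injective (point fun j => p (i + j)) := by
  rintro ⟨j, s⟩ ⟨k, t⟩ he
  simp only [point, ← add_assoc] at he
  have := @h (i + j, s) (i + k, t) he
  rw [Prod.mk.injEq] at this
  rw [add_left_cancel this.1, this.2]

theorem trace_rotate {E : Type*} [AddCommGroup E] [Module ℝ E] {n : ℕ} (p : ZMod n → E)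
    (i : ZMod n) : trace (fun j => p (i + j)) = trace p := by
  ext x
  constructor
  · rintro ⟨⟨j, s⟩, rfl⟩
    exact ⟨(i + j, s), by simp only [point, add_assoc]⟩
  · rintro ⟨⟨j, s⟩, rfl⟩
    exact ⟨(j - i, s), by simp only [point, ← add_assoc, add_sub_cancel]⟩

theorem coeff_eq_zero_of_notMem_affineSpan {a b c d : Space} (h : d ∉ affineSpan ℝ {a, b, c})
    {x y w : ℝ} (he : x • (b - a) + y • (c - a) + w • (d - a) = 0) : w = 0 := by
  by_contra hw
  refine h ?_
  have ha : a ∈ affineSpan ℝ {a, b, c} := subset_affineSpan _ _ (by simp)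
  have hb : b ∈ affineSpan ℝ {a, b, c} := subset_affineSpan _ _ (by simp)
  have hc : c ∈ affineSpan ℝ {a, b, c} := subset_affineSpan _ _ (by simp)
  have h1 := AffineSubspace.smul_vsub_vadd_mem _ (-(x / w)) hb ha
    (AffineSubspace.smul_vsub_vadd_mem _ (-(y / w)) hc ha ha)
  convert h1 using 1
  simp only [vsub_eq_sub, vadd_eq_add]
  have h2 : d - a = -(x / w) • (b - a) + -(y / w) • (c - a) := by
    have : w • (d - a) = -(x • (b - a) + y • (c - a)) := by
      rw [eq_neg_iff_add_eq_zero, ← he]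
      abel
    rw [← inv_smul_smul₀ hw (d - a), this, smul_neg, smul_add, smul_smul, smul_smul,
      div_eq_inv_mul, div_eq_inv_mul]
    module
  rw [← add_assoc, ← h2]
  abel

/-! ### Moving one vertex of a simple polygon -/

theorem exists_mem_segment_of_mem_convexHull {a b c x : Space} (h : x ∈ convexHull ℝ {a, b, c}) :
    ∃ t ∈ Icc (0 : ℝ) 1, x ∈ segment ℝ a (AffineMap.lineMap b c t) := by
  rw [convexHull_insert (by simp), convexHull_pair, mem_convexJoin] at h
  obtain ⟨_, rfl, y, hy, hx⟩ := h
  obtain ⟨t, h0, h1, rfl⟩ := mem_segment_iff_lineMap.1 hy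
  exact ⟨t, ⟨h0, h1⟩, hx⟩

/-- Both polygons become the one running through `a`, `b`, `b'`, `c` by a single triangle move, so
they are equivalent. The triangles are swept out by the edges at the moving vertex, so simplicity of
the intermediate polygons keeps the rest of the knot away. That `b'` lies off the span of `a`, `b`,
`c` makes the triangles non-degenerate and controls the one remaining edge. -/
theorem Knot.equivalent_of_vertex_move {k : ℕ} (hk : 0 < k) {U : ℕ → Space} {b b' : Space}
    (hs : ∀ t ∈ Icc (0 : ℝ) 1, IsSimpleLoop (k + 2)
      (closeUp (k + 1) fun j => if j ≤ k then U j else AffineMap.lineMap b b' t))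
    (hs' : IsSimpleLoop (k + 2)
      (closeUp (k + 1) fun j => if j = 0 then b' else U (j - 1)))
    (hb' : b' ∉ affineSpan ℝ {U k, b, U 0}) {K K' : Knot}
    (hK : K.carrier = pathSet k U ∪ segment ℝ (U k) b ∪ segment ℝ b (U 0))
    (hK' : K'.carrier = pathSet k U ∪ segment ℝ (U k) b' ∪ segment ℝ b' (U 0)) :
    K.Equivalent K' := by
  set a := U k with ha
  set c := U 0 with hc
  have L1 : ∀ t : ℝ, closeUp (k + 1) (fun j => if j ≤ k then U j else AffineMap.lineMap b b' t) (k + 1) =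
      AffineMap.lineMap b b' t := fun t => by
    rw [closeUp_of_le _ le_rfl, if_neg (by omega)]
  have L2 : ∀ (t : ℝ) (j : ℕ), j ≤ k →
      closeUp (k + 1) (fun j => if j ≤ k then U j else AffineMap.lineMap b b' t) j = U j :=
    fun t j hj => by rw [closeUp_of_le _ (by omega), if_pos hj]
  have L3 : ∀ t : ℝ, closeUp (k + 1) (fun j => if j ≤ k then U j else AffineMap.lineMap b b' t)
      (k + 1 + 1) = c := fun t => by
    rw [closeUp_succ, if_pos (Nat.zero_le _)]
  have h0 := hs 0 (by simp)
  have hbc : b ≠ c := by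
    have := h0.ne (show k + 1 < k + 2 by omega)
    rwa [L1, L3, AffineMap.lineMap_apply_zero] at this
  have hab : a ≠ b := by
    have := h0.ne (show k < k + 2 by omega)
    rwa [L1, L2 _ _ le_rfl, AffineMap.lineMap_apply_zero] at this
  have hcab : c ∉ segment ℝ a b := by
    intro hmem
    rcases h0.edge_inter (Nat.lt_succ_self k) (show k + 1 < k + 2 by omega) (x := c)
      (by rwa [L1, L2 _ _ le_rfl, AffineMap.lineMap_apply_zero])
      (by rw [L1, L3]; exact right_mem_segment _ _ _) with ⟨-, h⟩ | ⟨h, -⟩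
    · rw [L1, AffineMap.lineMap_apply_zero] at h
      exact hbc h.symm
    · omega
  have hspan : ∀ {x y w : ℝ}, x • (b - a) + y • (c - a) + w • (b' - a) = 0 → w = 0 :=
    fun he => coeff_eq_zero_of_notMem_affineSpan hb' he
  -- the first triangle
  let V : ℕ → Space := fun j => if j ≤ k then U j else if j = k + 1 then b else b'
  have V1 : ∀ j ≤ k, V j = U j := fun j hj => if_pos hj
  have V2 : V (k + 1) = b := by simp [V]
  have V3 : V (k + 2) = b' := by simp [V]
  have V0 : V 0 = c := V1 0 (Nat.zero_le _)
  have hV : IsSimpleLoop (k + 1 + 1) (closeUp (k + 1) V) := by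
    refine h0.congr fun i hi => ?_
    rcases (by omega : i ≤ k ∨ i = k + 1 ∨ i = k + 1 + 1) with h | rfl | rfl
    · rw [L2 _ _ h, closeUp_of_le _ (by omega), V1 _ h]
    · rw [L1, closeUp_of_le _ le_rfl, V2, AffineMap.lineMap_apply_zero]
    · rw [L3, closeUp_succ, V0]
  have hVset : pathSet (k + 1) V = pathSet k U ∪ segment ℝ a b := by
    rw [pathSet_succ, V1 k le_rfl, V2, pathSet_congr V1]
  have ind1 : AffineIndependent ℝ ![V (k + 1), V 0, V (k + 1 + 1)] := by
    rw [V2, V0, V3, affineIndependent_triple]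
    intro x y hxy
    have hy : y = 0 := hspan (x := -x - y) (y := x) (w := y) (by rw [← hxy]; module)
    rw [hy, zero_smul, add_zero, smul_eq_zero, sub_eq_zero] at hxy
    exact ⟨hxy.resolve_right hbc.symm, hy⟩
  have tri1 : ∀ x ∈ convexHull ℝ {V (k + 1), V 0, V (k + 1 + 1)}, x ∈ pathSet (k + 1) V →
      x ∈ segment ℝ (V (k + 1)) (V 0) := by
    rw [V2, V0, V3, hVset, Set.insert_comm]
    intro x hx hx'
    -- Any point of the triangle lies on the edge to `c` of the polygon at some intermediate time
    -- `t`.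
    obtain ⟨t, ht, hxt⟩ := exists_mem_segment_of_mem_convexHull hx
    rw [segment_symm] at hxt
    rcases hx' with ⟨i, hi, hxi⟩ | hx'
    · rcases (hs t ht).edge_inter (show i < k + 1 by omega) (show k + 1 < k + 2 by omega) (x := x)
        (by rwa [L2 _ _ hi.le, L2 _ _ hi]) (by rwa [L1, L3]) with ⟨h, -⟩ | ⟨-, -, h⟩
      · omega
      · rw [L2 _ _ (Nat.zero_le _)] at h
        rw [h]
        exact right_mem_segment _ _ _
    · obtain ⟨u, hu0, hu1, hu⟩ := mem_segment_iff_lineMap.1 hx'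
      obtain ⟨s, hs0, hs1, hs⟩ := mem_segment_iff_lineMap.1 hxt
      have e := hs.trans hu.symm
      simp only [AffineMap.lineMap_apply, vsub_eq_sub, vadd_eq_add] at e
      have hw := hspan (x := (1 - s) * (1 - t) - u) (y := s) (w := (1 - s) * t) (by
        rw [← sub_eq_zero_of_eq e]
        module)
      rcases mul_eq_zero.1 hw with h | h
      · obtain rfl : s = 1 := by linarith
        rw [← hs, AffineMap.lineMap_apply_one]
        exact right_mem_segment _ _ _
      · rwa [h, AffineMap.lineMap_apply_zero] at hxt
  -- the second triangle
  let W : ℕ → Space := fun j => if j = 0 then b' else if j ≤ k + 1 then U (j - 1) else b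
  have W0 : W 0 = b' := if_pos rfl
  have W1 : ∀ j ≤ k, W (j + 1) = U j := by
    intro j hj
    simp [W, hj]
  have W2 : W (k + 1 + 1) = b := by simp [W]
  have hW : IsSimpleLoop (k + 1 + 1) (closeUp (k + 1) W) := by
    refine hs'.congr fun i hi => ?_
    rcases (by omega : i ≤ k + 1 ∨ i = k + 1 + 1) with h | rfl
    · rw [closeUp_of_le _ h, closeUp_of_le _ h]
      simp [W, h]
    · rw [closeUp_succ, closeUp_succ, W0, if_pos rfl]
  have hWset : pathSet (k + 1) W = segment ℝ b' c ∪ pathSet k U := by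
    rw [pathSet_succ', W0, W1 0 (Nat.zero_le _), pathSet_congr W1]
  have ind2 : AffineIndependent ℝ ![W (k + 1), W 0, W (k + 1 + 1)] := by
    rw [W1 k le_rfl, W0, W2, affineIndependent_triple]
    intro x y hxy
    have hx : x = 0 := hspan (x := y) (y := 0) (w := x) (by rw [← hxy]; module)
    rw [hx, zero_smul, zero_add, smul_eq_zero, sub_eq_zero] at hxy
    exact ⟨hx, hxy.resolve_right hab.symm⟩
  have tri2 : ∀ x ∈ convexHull ℝ {W (k + 1), W 0, W (k + 1 + 1)}, x ∈ pathSet (k + 1) W →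
      x ∈ segment ℝ (W (k + 1)) (W 0) := by
    rw [W1 k le_rfl, W0, W2, hWset, Set.pair_comm]
    intro x hx hx'
    obtain ⟨t, ht, hxt⟩ := exists_mem_segment_of_mem_convexHull hx
    rcases hx' with hx' | ⟨i, hi, hxi⟩
    · obtain ⟨u, hu0, hu1, hu⟩ := mem_segment_iff_lineMap.1 hx'
      obtain ⟨s, hs0, hs1, hs⟩ := mem_segment_iff_lineMap.1 hxt
      have e := hs.trans hu.symm
      simp only [AffineMap.lineMap_apply, vsub_eq_sub, vadd_eq_add] at e
      have hw := hspan (x := s * (1 - t)) (y := -u) (w := s * t - (1 - u)) (by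
        rw [← sub_eq_zero_of_eq e]
        module)
      rcases eq_or_lt_of_le hu0 with rfl | hu0
      · rw [← hu, AffineMap.lineMap_apply_zero]
        exact right_mem_segment _ _ _
      -- A second meeting point with the edge from `b'` to `c` would place `c` on the segment from
      -- `a` to `b`.
      · exfalso
        have hst : 0 ≤ s * (1 - t) := mul_nonneg hs0 (by linarith [ht.2])
        refine hcab (mem_segment_iff_lineMap.2 ⟨s * (1 - t) / u, by positivity,
          (div_le_one hu0).2 (by linarith), ?_⟩)
        have e2 : u • (c - a) = (s * (1 - t)) • (b - a) := by
          have h3 : u = 1 - s * t := by linarith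
          rw [← sub_eq_zero, ← neg_eq_zero, ← sub_eq_zero_of_eq e, h3]
          module
        rw [AffineMap.lineMap_apply, vsub_eq_sub, vadd_eq_add, div_eq_inv_mul, mul_smul, ← e2,
          inv_smul_smul₀ hu0.ne', sub_add_cancel]
    · rcases (hs t ht).edge_inter hi (show k < k + 2 by omega) (x := x)
        (by rwa [L2 _ _ hi.le, L2 _ _ hi]) (by rwa [L1, L2 _ _ le_rfl]) with ⟨-, h⟩ | ⟨-, h, -⟩
      · rw [h, L2 _ _ le_rfl]
        exact left_mem_segment _ _ _
      · omega
  have m1 := triangleMove_append hV ind1 tri1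
  have m2 := triangleMove_append hW ind2 tri2
  have e1 : Knot.ofLoop hV = K := Knot.ext (by
    change pathSet (k + 1 + 1) (closeUp (k + 1) V) = _
    rw [pathSet_closeUp, hVset, hK, V2, V0])
  have e2 : Knot.ofLoop hW = K' := Knot.ext (by
    change pathSet (k + 1 + 1) (closeUp (k + 1) W) = _
    rw [pathSet_closeUp, hWset, hK', W1 k le_rfl, W0]
    ext x
    simp only [Set.mem_union]
    tauto)
  have e3 : Knot.ofLoop (hV.append ind1 tri1) = Knot.ofLoop (hW.append ind2 tri2) := Knot.ext (by
    change pathSet (k + 1 + 1 + 1) (closeUp (k + 1 + 1) V) =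
      pathSet (k + 1 + 1 + 1) (closeUp (k + 1 + 1) W)
    rw [pathSet_closeUp, pathSet_closeUp, pathSet_succ, pathSet_succ (k + 1) W, hVset, hWset, V2, V0,
      V3, W1 k le_rfl, W0, W2]
    ext x
    simp only [Set.mem_union]
    tauto)
  rw [e1] at m1
  rw [e2, ← e3] at m2
  exact .trans _ _ _ (.rel _ _ m1) (.symm _ _ (.rel _ _ m2))

theorem Knot.equivalent_update {n : ℕ} [NeZero n] {p : ZMod n → Space} (i : ZMod n) {b' : Space}
    (hp : ∀ t ∈ Icc (0 : ℝ) 1,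
      Function.Injective (point (Function.update p i (AffineMap.lineMap (p i) b' t))))
    (hb' : b' ∉ affineSpan ℝ {p (i - 1), p i, p (i + 1)}) (h : Function.Injective (point p))
    (h' : Function.Injective (point (Function.update p i b'))) :
    (Knot.ofPolygon h).Equivalent (Knot.ofPolygon h') := by
  have h1 : i ≠ i + 1 := fun he => ne_of_injective_point h i (by rw [← he])
  have h2 := ne_add_two_of_injective_point h i
  obtain ⟨k, rfl⟩ : ∃ k, n = k + 2 := by
    refine ⟨n - 2, ?_⟩
    have := NeZero.ne n
    have : n ≠ 1 := by
      rintro rfl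
      exact h1 (Subsingleton.elim _ _)
    omega
  have hk : 0 < k := by
    refine Nat.pos_of_ne_zero ?_
    rintro rfl
    refine h2 ?_
    have : (1 : ZMod 2) + 1 = 0 := rfl
    rw [add_assoc, this, add_zero]
  set U : ℕ → Space := fun j => p (i + 1 + j) with hU
  have cast_ne : ∀ j : ℕ, j ≤ k → i + 1 + j ≠ i := by
    intro j hj he
    rw [add_assoc, add_eq_left] at he
    have h3 : ((1 + j : ℕ) : ZMod (k + 2)) = 0 := by exact_mod_cast he
    have h4 := congrArg ZMod.val h3
    rw [ZMod.val_natCast, Nat.mod_eq_of_lt (by omega), ZMod.val_zero] at h4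
    omega
  have cast_last : i + 1 + ((k + 1 : ℕ) : ZMod (k + 2)) = i := by
    rw [add_assoc, add_eq_left]
    have := ZMod.natCast_self (k + 2)
    push_cast at this ⊢
    rw [← this]
    ring
  have upd : ∀ x : Space, ∀ j : ℕ, j ≤ k → Function.update p i x (i + 1 + j) = U j := fun x j hj =>
    Function.update_of_ne (cast_ne j hj) _ _
  have upd' : ∀ x : Space, Function.update p i x (i + 1 + ((k + 1 : ℕ) : ZMod (k + 2))) = x := by
    intro x
    rw [cast_last, Function.update_self]
  have per : i + 1 + ((k + 2 : ℕ) : ZMod (k + 2)) = i + 1 + ((0 : ℕ) : ZMod (k + 2)) := by simp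
  have hUk : U k = p (i - 1) := by
    have : i + 1 + (k : ZMod (k + 2)) = i - 1 := by
      rw [eq_sub_iff_add_eq]
      conv_rhs => rw [← cast_last]
      push_cast
      ring
    rw [hU]
    simp only [this]
  have hU0 : U 0 = p (i + 1) := by simp [hU]
  have loop : ∀ x : Space, Function.Injective (point (Function.update p i x)) →
      IsSimpleLoop (k + 2) (closeUp (k + 1) fun j => if j ≤ k then U j else x) := by
    intro x hx
    refine (isSimpleLoop_of_injective (injective_point_rotate hx (i + 1))).congr fun j hj => ?_
    rcases (by omega : j ≤ k ∨ j = k + 1 ∨ j = k + 1 + 1) with h | rfl | rfl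
    · rw [closeUp_of_le _ (by omega), if_pos h, upd x j h]
    · rw [closeUp_of_le _ le_rfl, if_neg (by omega), upd']
    · rw [closeUp_succ, if_pos (Nat.zero_le _), per, upd x 0 (Nat.zero_le _)]
  have carrier : ∀ x : Space, trace (Function.update p i x) =
      pathSet k U ∪ segment ℝ (U k) x ∪ segment ℝ x (U 0) := by
    intro x
    rw [← trace_rotate _ (i + 1), ← pathSet_natCast, pathSet_succ, pathSet_succ, upd', upd x k le_rfl,
      per, upd x 0 (Nat.zero_le _), pathSet_congr (upd x)]
  refine Knot.equivalent_of_vertex_move hk (U := U) (b := p i) (b' := b') (fun t ht => loop _ (hp t ht))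
    ?_ (by rwa [hUk, hU0]) ?_ (carrier b')
  · refine (isSimpleLoop_of_injective (injective_point_rotate h' i)).congr fun j hj => ?_
    rcases (by omega : j = 0 ∨ (1 ≤ j ∧ j ≤ k + 1) ∨ j = k + 1 + 1) with rfl | ⟨hj1, hj2⟩ | rfl
    · rw [closeUp_of_le _ (by omega), if_pos rfl]
      simp
    · obtain ⟨j, rfl⟩ := Nat.exists_eq_add_of_le' hj1
      rw [closeUp_of_le _ (by omega), if_neg (by omega), Nat.add_sub_cancel, ← upd b' j (by omega)]
      congr 1
      push_cast
      ring
    · rw [closeUp_succ, if_pos rfl, ZMod.natCast_self, add_zero, Function.update_self]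
  · rw [← carrier, Function.update_eq_self]
    rfl

theorem affineSpan_triple_ne_top (a b c : Space) : affineSpan ℝ {a, b, c} ≠ ⊤ := by
  intro h
  have h1 := (coplanar_triple ℝ a b c).finrank_le_two
  rw [← direction_affineSpan, h, AffineSubspace.direction_top, finrank_top] at h1
  simp at h1

/-- Polygons close to a simple polygon represent equivalent knots. -/
theorem Knot.eventually_equivalent {n : ℕ} [NeZero n] {p : ZMod n → Space}
    (h : Function.Injective (point p)) : ∀ᶠ q in 𝓝 p, ∃ h' : Function.Injective (point q),
      (Knot.ofPolygon h).Equivalent (Knot.ofPolygon h') := by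
  obtain ⟨ε, hε, hball⟩ := Metric.eventually_nhds_iff.1 (eventually_injective_point h)
  have key : ∀ q, (∀ i, q i ∈ Metric.ball (p i) ε) → Function.Injective (point q) := by
    intro q hq
    exact hball ((dist_pi_lt_iff hε).2 fun i => hq i)
  -- moving one vertex within its ball
  have move : ∀ (q : ZMod n → Space) (hq : ∀ i, q i ∈ Metric.ball (p i) ε) (i : ZMod n) (b : Space)
      (_ : b ∈ Metric.ball (p i) ε) (hq' : Function.Injective (point q))
      (hb' : Function.Injective (point (Function.update q i b))),
      b ∉ affineSpan ℝ {q (i - 1), q i, q (i + 1)} →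
      (Knot.ofPolygon hq').Equivalent (Knot.ofPolygon hb') := by
    intro q hq i b hb hq' hb' hspan
    refine Knot.equivalent_update i (fun t ht => key _ fun j => ?_) hspan hq' hb'
    rcases eq_or_ne j i with rfl | hj
    · rw [Function.update_self]
      exact (convex_ball _ _).segment_subset (hq j) hb (mem_segment_iff_lineMap.2 ⟨t, ht.1, ht.2, rfl⟩)
    · rw [Function.update_of_ne hj]
      exact hq j
  have upd : ∀ (q : ZMod n → Space) (_ : ∀ i, q i ∈ Metric.ball (p i) ε) (i : ZMod n) (b : Space)
      (_ : b ∈ Metric.ball (p i) ε), ∀ j, Function.update q i b j ∈ Metric.ball (p j) ε := by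
    intro q hq i b hb j
    rcases eq_or_ne j i with rfl | hj
    · rwa [Function.update_self]
    · rw [Function.update_of_ne hj]
      exact hq j
  have move2 : ∀ (q : ZMod n → Space) (hq : ∀ i, q i ∈ Metric.ball (p i) ε) (i : ZMod n) (b : Space)
      (hb : b ∈ Metric.ball (p i) ε), (Knot.ofPolygon (key q hq)).Equivalent
        (Knot.ofPolygon (key _ (upd q hq i b hb))) := by
    intro q hq i b hb
    set r := Function.update q i b with hr
    -- To reach an arbitrary `b`, compare the positions before and after with a third one, `b'`, off
    -- the two relevant planes. Both moves to `b'` are then admissible.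
    obtain ⟨b', hb', hb1⟩ : ∃ b' ∈ Metric.ball (p i) ε,
        b' ∉ ⋃ f : Bool, ((bif f then affineSpan ℝ {q (i - 1), q i, q (i + 1)} else
          affineSpan ℝ {r (i - 1), r i, r (i + 1)} : AffineSubspace ℝ Space) : Set Space) := by
      by_contra! hsub
      have h1 := interior_iUnion_affineSubspace (fun f : Bool =>
        (bif f then affineSpan ℝ {q (i - 1), q i, q (i + 1)} else
          affineSpan ℝ {r (i - 1), r i, r (i + 1)} : AffineSubspace ℝ Space)) (by
            intro f
            cases f <;> exact affineSpan_triple_ne_top _ _ _)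
      have h2 := Metric.isOpen_ball.subset_interior_iff.2 hsub (Metric.mem_ball_self hε)
      rw [h1] at h2
      exact h2
    simp only [Set.mem_iUnion, not_exists, Bool.forall_bool, cond_true, cond_false,
      SetLike.mem_coe] at hb1
    have e : Function.update r i b' = Function.update q i b' := Function.update_idem _ _ _
    have m1 := move q hq i b' hb' (key q hq) (key _ (upd q hq i b' hb')) hb1.2
    have m2 := move r (upd q hq i b hb) i b' hb' (key _ (upd q hq i b hb))
      (key _ (upd r (upd q hq i b hb) i b' hb')) hb1.1
    have e' : Knot.ofPolygon (key _ (upd r (upd q hq i b hb) i b' hb')) =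
      Knot.ofPolygon (key _ (upd q hq i b' hb')) := Knot.ext (congrArg trace e)
    rw [e'] at m2
    exact .trans _ _ _ m1 (.symm _ _ m2)
  filter_upwards [Metric.ball_mem_nhds p hε] with q hq
  have hq' : ∀ i, q i ∈ Metric.ball (p i) ε := fun i => (dist_pi_lt_iff hε).1 hq i
  have hp' : ∀ i, p i ∈ Metric.ball (p i) ε := fun i => Metric.mem_ball_self hε
  classical
  -- The vertices are moved one at a time, always within their balls, where every polygon is simple.
  have main : ∀ s : Finset (ZMod n), ∃ r : ZMod n → Space, ∃ hr : ∀ i, r i ∈ Metric.ball (p i) ε,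
      (∀ i ∈ s, r i = q i) ∧ (Knot.ofPolygon h).Equivalent (Knot.ofPolygon (key r hr)) := by
    intro s
    induction s using Finset.induction_on with
    | empty => exact ⟨p, hp', by simp, .refl _⟩
    | insert i s hi ih =>
      obtain ⟨r, hr, hrs, he⟩ := ih
      refine ⟨Function.update r i (q i), upd r hr i _ (hq' i), ?_,
        .trans _ _ _ he (move2 r hr i (q i) (hq' i))⟩
      intro j hj
      rcases eq_or_ne j i with rfl | hji
      · rw [Function.update_self]
      · rw [Function.update_of_ne hji, hrs j ((Finset.mem_insert.1 hj).resolve_left hji)]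
  obtain ⟨r, hr, hrq, he⟩ := main Finset.univ
  obtain rfl : r = q := funext fun i => hrq i (Finset.mem_univ i)
  exact ⟨_, he⟩

/-! ### Generic projections -/

/-- If the zero set had interior, the identity theorem would make `f` vanish everywhere. -/
theorem dense_ne_zero_of_analytic {E : Type*} [NormedAddCommGroup E] [NormedSpace ℝ E] {f : E → ℝ}
    (hf : AnalyticOnNhd ℝ f univ) {w : E} (hw : f w ≠ 0) : Dense {q | f q ≠ 0} := by
  have h : interior {q | f q = 0} = ∅ := by
    rw [Set.eq_empty_iff_forall_notMem]
    intro z hz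
    have := hf.eqOn_zero_of_preconnected_of_eventuallyEq_zero isPreconnected_univ (mem_univ z)
      (mem_interior_iff_mem_nhds.1 hz)
    exact hw (this (mem_univ w))
  exact interior_eq_empty_iff_dense_compl.1 h

/-- This determinant vanishes if the lines `aa'`, `bb'` and `cc'` have a common point. -/
def concurrenceDet (a a' b b' c c' : Plane) : ℝ :=
  planeDet a (a' - a) * planeDet (b' - b) (c' - c) +
    planeDet b (b' - b) * planeDet (c' - c) (a' - a) +
    planeDet c (c' - c) * planeDet (a' - a) (b' - b)

theorem concurrenceDet_eq_zero {a a' b b' c c' w : Plane} {r s t : ℝ}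
    (ha : AffineMap.lineMap a a' r = w) (hb : AffineMap.lineMap b b' s = w)
    (hc : AffineMap.lineMap c c' t = w) : concurrenceDet a a' b b' c c' = 0 := by
  simp only [AffineMap.lineMap_apply, vsub_eq_sub, vadd_eq_add] at ha hb hc
  rw [concurrenceDet]
  generalize a' - a = d at *
  generalize b' - b = e at *
  generalize c' - c = f at *
  rw [eq_sub_of_add_eq' ha, eq_sub_of_add_eq' hb, eq_sub_of_add_eq' hc]
  simp only [planeDet, Prod.fst_sub, Prod.snd_sub, Prod.smul_fst, Prod.smul_snd, smul_eq_mul]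
  ring

section Generic

variable {n : ℕ}

/-- The edges from `i` to `i + 1` and from `j` to `j + 1` have no common end point. -/
def Apart (i j : ZMod n) : Prop := i ≠ j ∧ i ≠ j + 1 ∧ j ≠ i + 1

/-- No three vertices are collinear, and no three pairwise non-adjacent edges are concurrent. -/
structure IsGeneric (v : ZMod n → Plane) : Prop where
  not_collinear : ∀ i j k, i ≠ j → j ≠ k → i ≠ k → planeDet (v j - v i) (v k - v i) ≠ 0
  not_concurrent : ∀ i j k, Apart i j → Apart j k → Apart i k →
    concurrenceDet (v i) (v (i + 1)) (v j) (v (j + 1)) (v k) (v (k + 1)) ≠ 0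

/-- Each forbidden coincidence is the vanishing of a polynomial in the coordinates. One
configuration where it does not vanish makes its complement dense, and finitely many open dense sets
are intersected. -/
theorem dense_isGeneric [NeZero n] (h1 : ∀ i : ZMod n, i ≠ i + 1) :
    Dense {q : ZMod n → Space | IsGeneric fun i => (q i).1} := by
  have hx : ∀ i (q : ZMod n → Space), AnalyticAt ℝ (fun q : ZMod n → Space => (q i).1.1) q :=
    fun i q => ((ContinuousLinearMap.fst ℝ ℝ ℝ).comp ((ContinuousLinearMap.fst ℝ Plane ℝ).comp
      (ContinuousLinearMap.proj (R := ℝ) (φ := fun _ : ZMod n => Space) i))).analyticAt q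
  have hy : ∀ i (q : ZMod n → Space), AnalyticAt ℝ (fun q : ZMod n → Space => (q i).1.2) q :=
    fun i q => ((ContinuousLinearMap.snd ℝ ℝ ℝ).comp ((ContinuousLinearMap.fst ℝ Plane ℝ).comp
      (ContinuousLinearMap.proj (R := ℝ) (φ := fun _ : ZMod n => Space) i))).analyticAt q
  have good : ∀ (f : (ZMod n → Space) → ℝ), AnalyticOnNhd ℝ f univ → ∀ w, f w ≠ 0 →
      IsOpen {q | f q ≠ 0} ∧ Dense {q | f q ≠ 0} := fun f hf w hw =>
    ⟨isOpen_ne_fun (continuousOn_univ.1 hf.continuousOn) continuous_const,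
      dense_ne_zero_of_analytic hf hw⟩
  have hcol : ∀ t : {t : ZMod n × ZMod n × ZMod n // t.1 ≠ t.2.1 ∧ t.2.1 ≠ t.2.2 ∧ t.1 ≠ t.2.2},
      IsOpen {q : ZMod n → Space | planeDet ((q t.1.2.1).1 - (q t.1.1).1)
        ((q t.1.2.2).1 - (q t.1.1).1) ≠ 0} ∧
      Dense {q : ZMod n → Space | planeDet ((q t.1.2.1).1 - (q t.1.1).1)
        ((q t.1.2.2).1 - (q t.1.1).1) ≠ 0} := by
    rintro ⟨⟨i, j, k⟩, hij, hjk, hik⟩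
    refine good _ ?_ (fun l => if l = j then ((1, 0), 0) else if l = k then ((0, 1), 0) else 0) ?_
    · intro q _
      simp only [planeDet, Prod.fst_sub, Prod.snd_sub]
      exact (((hx _ _).sub (hx _ _)).mul ((hy _ _).sub (hy _ _))).sub
        (((hy _ _).sub (hy _ _)).mul ((hx _ _).sub (hx _ _)))
    · simp only at hij hjk hik
      simp [planeDet, hij, hik, hjk.symm]
  have hcon : ∀ t : {t : ZMod n × ZMod n × ZMod n //
      Apart t.1 t.2.1 ∧ Apart t.2.1 t.2.2 ∧ Apart t.1 t.2.2},
      IsOpen {q : ZMod n → Space | concurrenceDet (q t.1.1).1 (q (t.1.1 + 1)).1 (q t.1.2.1).1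
        (q (t.1.2.1 + 1)).1 (q t.1.2.2).1 (q (t.1.2.2 + 1)).1 ≠ 0} ∧
      Dense {q : ZMod n → Space | concurrenceDet (q t.1.1).1 (q (t.1.1 + 1)).1 (q t.1.2.1).1
        (q (t.1.2.1 + 1)).1 (q t.1.2.2).1 (q (t.1.2.2 + 1)).1 ≠ 0} := by
    rintro ⟨⟨i, j, k⟩, ⟨a1, a2, a3⟩, ⟨b1, b2, b3⟩, c1, c2, c3⟩
    -- The witness places the three edges along the three sides of a triangle, whose lines have no
    -- common point.
    refine good _ ?_ (fun l => if l = i + 1 ∨ l = k + 1 then ((0, 1), 0) else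
      if l = j + 1 ∨ l = k then ((1, 0), 0) else 0) ?_
    · have hdet : ∀ (a b c d : ZMod n) (q : ZMod n → Space), AnalyticAt ℝ (fun q : ZMod n → Space =>
          planeDet ((q a).1 - (q b).1) ((q c).1 - (q d).1)) q := by
        intro a b c d q
        simp only [planeDet, Prod.fst_sub, Prod.snd_sub]
        exact (((hx _ _).sub (hx _ _)).mul ((hy _ _).sub (hy _ _))).sub
          (((hy _ _).sub (hy _ _)).mul ((hx _ _).sub (hx _ _)))
      have hdet' : ∀ (a c d : ZMod n) (q : ZMod n → Space), AnalyticAt ℝ (fun q : ZMod n → Space =>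
          planeDet (q a).1 ((q c).1 - (q d).1)) q := by
        intro a c d q
        simp only [planeDet, Prod.fst_sub, Prod.snd_sub]
        exact ((hx _ _).mul ((hy _ _).sub (hy _ _))).sub ((hy _ _).mul ((hx _ _).sub (hx _ _)))
      intro q _
      exact ((((hdet' _ _ _ _).mul (hdet _ _ _ _ _)).add ((hdet' _ _ _ _).mul (hdet _ _ _ _ _))).add
        ((hdet' _ _ _ _).mul (hdet _ _ _ _ _)))
    · simp only at a1 a2 a3 b1 b2 b3 c1 c2 c3
      simp [concurrenceDet, planeDet, a2, a3, b1, b2, b3, c1, c2, c3, h1, Ne.symm a1, Ne.symm b3]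
  have h := (dense_iInter_of_isOpen (fun t => (hcol t).1) fun t => (hcol t).2).inter_of_isOpen_right
    (dense_iInter_of_isOpen (fun t => (hcon t).1) fun t => (hcon t).2)
    (isOpen_iInter_of_finite fun t => (hcon t).1)
  refine h.mono ?_
  rintro q ⟨hq1, hq2⟩
  rw [Set.mem_iInter] at hq1 hq2
  exact ⟨fun i j k hij hjk hik => hq1 ⟨(i, j, k), hij, hjk, hik⟩,
    fun i j k hij hjk hik => hq2 ⟨(i, j, k), hij, hjk, hik⟩⟩

/-- Non-collinearity excludes double points on one edge or on adjacent edges. For other edges, the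
determinant showing that `v i` is off the line of edge `j` equals `s` times the determinant of the
two directions, so neither factor vanishes. -/
theorem IsGeneric.apart {v : ZMod n → Plane} (hv : IsGeneric v) (h1 : ∀ i : ZMod n, i ≠ i + 1)
    (h2 : ∀ i : ZMod n, i ≠ i + 1 + 1) {x y : Param n} (hxy : x ≠ y) (h : point v x = point v y) :
    Apart x.1 y.1 ∧ (x.2 : ℝ) ≠ 0 ∧
      planeDet (v (x.1 + 1) - v x.1) (v (y.1 + 1) - v y.1) ≠ 0 := by
  have adj : ∀ (i : ZMod n) (s t : ℝ), s < 1 →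
      AffineMap.lineMap (v i) (v (i + 1)) s ≠ AffineMap.lineMap (v (i + 1)) (v (i + 1 + 1)) t := by
    intro i s t hs he
    have hdet := hv.not_collinear (i + 1) i (i + 1 + 1) (h1 i).symm (h2 i) (h1 _)
    simp only [AffineMap.lineMap_apply, vsub_eq_sub, vadd_eq_add] at he
    have := (Diagram.smul_eq_zero_of_planeDet hdet (a := 1 - s) (b := -t) (by
      rw [← sub_eq_zero_of_eq he]
      module)).1
    linarith
  obtain ⟨i, s, hs0, hs1⟩ := x
  obtain ⟨j, t, ht0, ht1⟩ := y
  simp only [point] at h ⊢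
  have hij : i ≠ j := by
    rintro rfl
    have hdet := hv.not_collinear i (i + 1) (i + 1 + 1) (h1 i) (h1 _) (h2 i)
    have hne : v i ≠ v (i + 1) := by
      intro he
      rw [← he, sub_self] at hdet
      simp [planeDet] at hdet
    have := AffineMap.lineMap_injective ℝ hne h
    subst this
    exact hxy rfl
  have hij1 : i ≠ j + 1 := by
    rintro rfl
    exact adj j t s ht1 h.symm
  have hji1 : j ≠ i + 1 := by
    rintro rfl
    exact adj i s t hs1 h
  have hdet := hv.not_collinear j (j + 1) i (h1 j) hij1.symm hij.symm
  have e : v i - v j = t • (v (j + 1) - v j) + (-s) • (v (i + 1) - v i) := by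
    simp only [AffineMap.lineMap_apply, vsub_eq_sub, vadd_eq_add] at h
    rw [← sub_eq_zero, ← sub_eq_zero_of_eq h]
    module
  have e' : planeDet (v (j + 1) - v j) (v i - v j) =
      s * planeDet (v (i + 1) - v i) (v (j + 1) - v j) := by
    rw [e, planeDet_smul_add]
    simp only [planeDet]
    ring
  rw [e'] at hdet
  exact ⟨⟨hij, hij1, hji1⟩, left_ne_zero_of_mul hdet, right_ne_zero_of_mul hdet⟩

/-- A simple polygon in general position lies over a diagram. -/
theorem exists_isLift_of_isGeneric [NeZero n] {q : ZMod n → Space}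
    (h : Function.Injective (point q)) (hq : IsGeneric fun i => (q i).1) :
    ∃ D : Diagram, D.IsLift (Knot.ofPolygon h) := by
  set v : ZMod n → Plane := fun i => (q i).1 with hv
  have h1 : ∀ i : ZMod n, i ≠ i + 1 := fun i he => ne_of_injective_point h i (by rw [← he])
  have h2 := ne_add_two_of_injective_point h
  have hfst : ∀ x, (point q x).1 = point v x := by
    intro x
    simp [point, AffineMap.lineMap_apply, hv]
  have hne : ∀ x y : Param n, x ≠ y → point v x = point v y → (point q x).2 ≠ (point q y).2 :=
    fun x y hxy he he' => hxy (h (Prod.ext (by rw [hfst, hfst, he]) he'))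
  have triple : ∀ x y z : Param n, point v x = point v y → point v y = point v z →
      x = y ∨ y = z ∨ x = z := by
    intro x y z hxy hyz
    by_contra! hcon
    exact hq.not_concurrent x.1 y.1 z.1 (hq.apart h1 h2 hcon.1 hxy).1
      (hq.apart h1 h2 hcon.2.1 hyz).1 (hq.apart h1 h2 hcon.2.2 (hxy.trans hyz)).1
      (concurrenceDet_eq_zero rfl hxy.symm (hxy.trans hyz).symm)
  let D : Diagram :=
    { n := n
      n_pos := Nat.pos_of_ne_zero (NeZero.ne n)
      vertex := v
      transverse := by
        intro x y hxy he
        obtain ⟨-, h3, h4⟩ := hq.apart h1 h2 hxy he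
        exact ⟨h3, LinearIndependent.pair_iff.2 fun s t hst => Diagram.smul_eq_zero_of_planeDet h4 hst⟩
      no_triple := triple
      upper := {x | ∃ y, y ≠ x ∧ point v y = point v x ∧ (point q y).2 < (point q x).2}
      upper_double := fun x ⟨y, hy, he, _⟩ => ⟨y, hy, he⟩
      upper_iff := by
        intro x y hxy he
        constructor
        · rintro ⟨z, hz, hzx, hlt⟩ ⟨w, hw, hwy, hlt'⟩
          have e1 : z = y := by
            rcases triple z x y hzx he with h | h | h
            exacts [absurd h hz, absurd h hxy, h]
          have e2 : w = x := by
            rcases triple w y x hwy he.symm with h | h | h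
            exacts [absurd h hw, absurd h hxy.symm, h]
          rw [e1] at hlt
          rw [e2] at hlt'
          exact lt_asymm hlt hlt'
        · intro hy
          refine ⟨y, hxy.symm, he.symm, lt_of_le_of_ne (not_lt.1 fun hlt => hy ?_)
            (hne y x hxy.symm he.symm)⟩
          exact ⟨x, hxy, he, hlt⟩ }
  refine ⟨D, Diagram.isLift_of_eq_trace (D := D) q (fun _ => rfl) ?_ rfl⟩
  rintro x y hxy he ⟨z, hz, hzx, hlt⟩
  change point v x = point v y at he
  have e1 : z = y := by
    rcases triple z x y hzx he with h | h | h
    exacts [absurd h hz, absurd h hxy, h]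
  rwa [e1] at hlt

end Generic

/-- Every knot has a diagram. -/
theorem Knot.exists_isDiagramOf (K : Knot) : ∃ D : Diagram, D.IsDiagramOf K := by
  obtain ⟨n, p, hn, h, hK⟩ := K.isPolygon
  have : NeZero n := ⟨hn.ne'⟩
  have hp : Knot.ofPolygon h = K := Knot.ext hK.symm
  have h1 : ∀ i : ZMod n, i ≠ i + 1 := fun i he => ne_of_injective_point h i (by rw [← he])
  -- Generic polygons are dense, and all polygons near the given one are equivalent to it.
  obtain ⟨q, hq, h', he⟩ := (dense_isGeneric h1).inter_nhds_nonempty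
    (Knot.eventually_equivalent h)
  obtain ⟨D, hD⟩ := exists_isLift_of_isGeneric h' hq
  rw [hp] at he
  exact ⟨D, _, hD, .symm _ _ he⟩

/-! ### Minimal diagrams and the conclusion -/

theorem Diagram.exists_bounds (D : Diagram) :
    ∃ c u : ℕ, D.crossingNumber = c ∧ D.regionUnknottingNumber ≤ u ∧ 2 * u ≤ c + 2 := by
  obtain ⟨S, hS⟩ := D.exists_isDiagramOfTrivial
  exact D.regionUnknottingNumber_le hS

/-- Diagrams exist, and a nonempty set of extended natural numbers contains its infimum. -/
theorem Knot.exists_crossingNumber_eq (K : Knot) :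
    ∃ D : Diagram, D.IsDiagramOf K ∧ D.crossingNumber = K.crossingNumber := by
  obtain ⟨D, hD⟩ := K.exists_isDiagramOf
  obtain ⟨D', hD', he⟩ := csInf_mem
    (s := {k : ℕ∞ | ∃ D : Diagram, D.IsDiagramOf K ∧ k = D.crossingNumber}) ⟨_, D, hD, rfl⟩
  exact ⟨D', hD', he.symm⟩

end PLKnot

theorem mainTheorem4 (K : PLKnot.Knot) :
    ∃ c u : ℕ, K.crossingNumber = (c : ℕ∞) ∧ K.regionUnknottingNumber = (u : ℕ∞) ∧
      (u : ℝ) ≤ (c : ℝ) / 2 + 1 := by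
  obtain ⟨D, hD, hcK⟩ := K.exists_crossingNumber_eq
  obtain ⟨c, u, hc, hu, hcu⟩ := D.exists_bounds
  -- One diagram with the minimal number of crossings already bounds the minimum, which is therefore
  -- finite.
  have hle : K.regionUnknottingNumber ≤ u :=
    le_trans (sInf_le ⟨D, hD, hcK, rfl⟩) hu
  obtain ⟨m, hm⟩ := ENat.ne_top_iff_exists.1 (ne_top_of_le_ne_top (ENat.natCast_ne_top u) hle)
  refine ⟨c, m, by rw [← hcK, hc], hm.symm, ?_⟩
  rw [← hm, Nat.cast_le] at hle
  have h : ((2 * m : ℕ) : ℝ) ≤ ((c + 2 : ℕ) : ℝ) := Nat.cast_le.2 (by omega)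
  push_cast at h
  linarith
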